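/- **Conventions.** $\lg=\log_2$, $\lg^{(1)}u=\lg u$, $\lg^{(i+1)}u=\lg\lg^{(i)}u$, and $\lg^* u=\min\{i\ge 1: \lg^{(i)}u\le 1\}$. $\Sigma$ is a finite alphabet of size $\sigma$, and $S\in\Sigma^*$ is a text with $|S|\ge 2$. **The grammar.** The *edit-sensitive parsing* (ESP) of $S$ replaces a string of symbols by a shorter one until one symbol is left. One step cuts the string into the maximal repetitions $a^\ell$ ($\ell\ge2$; type 1) and the maximal substrings between them; the latter are of type 2 if they are longer than $2\lg^*|S|$ and of type 3 otherwise. A piece of length one is attached to the repetition on its left (to the one on its right at the beginning of the string). Pieces of types 1 and 3 are cut from left to right into pairs, with one final triple if the length is odd. Pieces of type 2 are cut into pairs and triples by alphabet reduction ($\lg^*|S|$ rounds, performed on pairwise distinct integer names, less than $n+\sigma$, of the symbols, followed by the elimination of the labels $5,4,3$ and by the choice of landmarks; the symbols in front of the first and behind the last cut so obtained are parsed as in type 3). A pair $AB$ is replaced by a variable $X\to AB$, and a triple $ABC$ by a variable $X\to AY$ with $Y\to BC$; equal right-hand sides get the same variable. This yields a straight-line program with parse tree $T$ and $n$ variables.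 The post-order partial parse tree (POPPT) is obtained from $T$ by deleting everything below each node that is not the leftmost occurrence of its variable; the variables are numbered by the post-order of the internal nodes of the POPPT. **The index.** The OESP-index of $S$ consists of the post-order bit string $B$ of the POPPT with a range min tree, the sequence $L$ of its leaf labels in a wavelet tree, the array of the lengths $|val(X)|$, and the reverse dictionary $(X,Y)\mapsto Z$ for the rules $Z\to XY$, stored as a chaining hash table with $\lceil\alpha n\rceil$ entries, where $\alpha\in(0,1]$ is the load factor. The chains contain variables, whose right-hand sides are read off from $B$ and $L$ when a chain is searched. The hash function is uniformly random. The names of the symbols used by the alphabet reduction can be read in constant time. **Evidences.** Embedding nodes of a pattern $P\in\Sigma^*$ over an occurrence of $P$ in $S$ are nodes $v_1,\dots,v_k$ of $T$ whose leaf intervals are consecutive and together form this occurrence (so $yield(v_1\cdots v_k)=P$). The string $Q$ of the labels of $v_1,\dots,v_k$ is then called an evidence of $P$. **Theorem.** There are a word-RAM program with access to the OESP-index, a constant $C$, and for every $\sigma$ a constant $D_\sigma$ such that the following holds for every alphabet of size $\sigma$, every text $S$ with $|S|\ge 2$, every OESP-index of $S$ with load factor $\alpha\in(0,1]$, and every non-empty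 pattern $P\in\Sigma^*$ (with machine words of at least $\lg(|S|+\sigma+|P|)+O(1)$ bits). The program with input $P$ halts in expected time at most $$C\cdot\frac1\alpha\,|P|\,\lg(n+\sigma)\,\lg^*|S|,$$ and its output is a string $Q$, which does not depend on the hash function. If $P$ occurs in $S$, then $Q$ is an evidence of $P$; more precisely, every occurrence of $P$ in $S$ has embedding nodes with label string $Q$. Moreover $Q=Q_1\cdots Q_t$, where each $Q_i$ is a maximal repetition or a symbol and $t\le D_\sigma\,(1+\lg|P|)\,\lg^*|S|$. -/

import Mathlib

namespace OESP

/-! ## Iterated logarithm -/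

/-- `lg* u = min {i ≥ 1 | lg^(i) u ≤ 1}`, where `lg = log₂` and `lg^(i)` is its `i`-fold iterate. -/
noncomputable def lgStar (u : ℕ) : ℕ :=
  sInf {i : ℕ | 1 ≤ i ∧ (Real.logb 2)^[i] (u : ℝ) ≤ 1}

/-! ## Straight-line programs, parse trees and post-order partial parse trees

The letters of an alphabet of size `σ` are `0, …, σ - 1`; the variables are `σ, …, σ + n - 1`. -/

/-- An SLP: the alphabet size and the right-hand sides of the rules.
The variable `σ + k` has the rule `rules[k]`. -/
structure Slp where
  sigma : ℕ
  rules : List (ℕ × ℕ)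

/-- The number of variables. -/
def Slp.n (G : Slp) : ℕ := G.rules.length

/-- The number of symbols (letters and variables). -/
def Slp.numSymbols (G : Slp) : ℕ := G.n + G.sigma

/-- The right-hand sides only use letters and earlier variables, and different variables have
different right-hand sides (so that the reverse dictionary `D⁻¹` is a partial map). -/
def Slp.WellFormed (G : Slp) : Prop :=
  (∀ k y z, G.rules[k]? = some (y, z) → y < G.sigma + k ∧ z < G.sigma + k) ∧ G.rules.Nodup

/-- The string derived from a symbol. -/
def Slp.val (G : Slp) (X : ℕ) : List ℕ :=
  if X < G.sigma then [X]
  else match G.rules[X - G.sigma]? with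
    | none => []
    | some (y, z) => if _h : y < X ∧ z < X then G.val y ++ G.val z else []
termination_by X
decreasing_by
  · exact _h.1
  · exact _h.2

/-- Ordered binary trees whose nodes carry symbols. -/
inductive PTree where
  | leaf (a : ℕ)
  | node (X : ℕ) (l r : PTree)

namespace PTree

def label : PTree → ℕ
  | leaf a => a
  | node X _ _ => X

/-- The label sequence of the leaves, from left to right. -/
def yield : PTree → List ℕ
  | leaf a => [a]
  | node _ l r => l.yield ++ r.yield

/-- Labels of the internal nodes, in post-order. -/
def internals : PTree → List ℕ
  | leaf _ => []
  | node X l r => l.internals ++ r.internals ++ [X]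

/-- Left-to-right pruning: a node whose variable was completed before (the list `seen`) becomes a
leaf.  The second component is the updated list of completed variables. -/
def prune : PTree → List ℕ → PTree × List ℕ
  | leaf a, seen => (leaf a, seen)
  | node X l r, seen =>
    if X ∈ seen then (leaf X, seen)
    else
      let l' := l.prune seen
      let r' := r.prune l'.2
      (node X l'.1 r'.1, X :: r'.2)

/-- The partial parse tree: everything below a node is deleted unless the node is the leftmost
occurrence of its variable. -/
def partialTree (T : PTree) : PTree := (T.prune []).1

/-- Post-order bit string of a tree: `0` (`false`) for a leaf, `1` (`true`) for an internal node. -/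
def bits : PTree → List Bool
  | leaf _ => [false]
  | node _ l r => l.bits ++ r.bits ++ [true]

end PTree

/-- `T` is a derivation tree of the grammar `G`. -/
def Slp.IsParseTree (G : Slp) : PTree → Prop
  | .leaf a => a < G.sigma
  | .node X l r =>
    (∃ k, X = G.sigma + k ∧ G.rules[k]? = some (l.label, r.label)) ∧
      G.IsParseTree l ∧ G.IsParseTree r

/-- `G` is a post-order SLP with parse tree `T`: the variables at the internal nodes of the partial
parse tree, read in post-order, are `σ, σ + 1, …, σ + n - 1`. -/
def Slp.IsPoslp (G : Slp) (T : PTree) : Prop :=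
  G.WellFormed ∧ G.IsParseTree T ∧ T.partialTree.internals = List.range' G.sigma G.n

/-! ## Edit-sensitive parsing

One level of the parsing cuts a string `x` of length at least two into blocks of length two and
three.  The parameter `k` is `lg* |S|`. -/

/-- Left-aligned parsing of a piece of length `m`: pairs, and one final triple if `m` is odd. -/
def leftAligned : ℕ → List ℕ
  | 0 => []
  | 1 => [1]
  | 2 => [2]
  | 3 => [3]
  | m + 4 => 2 :: leftAligned (m + 2)

/-- The position of the lowest bit in which `a ≠ b` differ. -/
def lowDiff (a b : ℕ) : ℕ :=
  if h : a = b then 0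
  else if a % 2 = b % 2 then lowDiff (a / 2) (b / 2) + 1 else 0
termination_by a + b
decreasing_by omega

/-- New label of a symbol `b` with left neighbour `a`: `2 ℓ + bit(ℓ, b)`, where `ℓ` is the lowest
bit position in which `a` and `b` differ. -/
def reduceLabel (a b : ℕ) : ℕ := 2 * lowDiff a b + b / 2 ^ lowDiff a b % 2

/-- Labels after `i` rounds of alphabet reduction (meaningful at positions `j ≥ i`). -/
def reduced (x : ℕ → ℕ) : ℕ → ℕ → ℕ
  | 0, j => x j
  | i + 1, j => reduceLabel (reduced x i (j - 1)) (reduced x i j)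

/-- The least element of `{0, 1, 2}` different from `a` and `b`. -/
def freeLabel (a b : ℕ) : ℕ :=
  if a ≠ 0 ∧ b ≠ 0 then 0 else if a ≠ 1 ∧ b ≠ 1 then 1 else 2

/-- Replace every label `c` by the least element of `{0, 1, 2}` not used by its two neighbours. -/
def eliminate (c : ℕ) (y : ℕ → ℕ) (j : ℕ) : ℕ :=
  if y j = c then freeLabel (y (j - 1)) (y (j + 1)) else y j

/-- The final labels: `k` rounds of alphabet reduction, then the elimination of `5`, `4`, `3`. -/
def finalLabel (k : ℕ) (x : ℕ → ℕ) : ℕ → ℕ :=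
  eliminate 3 (eliminate 4 (eliminate 5 (reduced x k)))

def IsLocalMax (y : ℕ → ℕ) (j : ℕ) : Prop := y (j - 1) < y j ∧ y (j + 1) < y j

def IsLocalMin (y : ℕ → ℕ) (j : ℕ) : Prop := y j < y (j - 1) ∧ y j < y (j + 1)

/-- Landmarks: the local maxima, and the local minima that are not adjacent to a local maximum. -/
def IsLandmark (y : ℕ → ℕ) (j : ℕ) : Prop :=
  IsLocalMax y j ∨ (IsLocalMin y j ∧ ¬ IsLocalMax y (j - 1) ∧ ¬ IsLocalMax y (j + 1))

/-- Cuts of a repetition-free piece `m`, where `p` is a cut if a block starts at position `p`.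
Every position belongs to the block of its closest landmark, and to the right one in case of a tie;
as landmarks are two or three positions apart, the block of a landmark `j` starts at `j - 1`.
The bounds say that the labels that decide whether `p + 1` is a landmark, which depend on the symbols
at the positions `p - k - 4, …, p + 6`, are all defined. -/
def IsCut (k : ℕ) (m : List ℕ) (p : ℕ) : Prop :=
  k + 4 ≤ p ∧ p + 7 ≤ m.length ∧ IsLandmark (finalLabel k (fun j => m.getD j 0)) (p + 1)

instance (k : ℕ) (m : List ℕ) (p : ℕ) : Decidable (IsCut k m p) := by
  unfold IsCut IsLandmark IsLocalMax IsLocalMin; infer_instance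

/-- Left-aligned parsing of the pieces between consecutive positions `s, c₁, c₂, …, e`. -/
def parseGaps (s : ℕ) (cuts : List ℕ) (e : ℕ) : List ℕ :=
  match cuts with
  | [] => leftAligned (e - s)
  | c :: cs => leftAligned (c - s) ++ parseGaps c cs e

/-- Block lengths for a long repetition-free piece (type 2).  The symbols in front of the first cut
and behind the last cut are parsed as in type 3. -/
def typeTwoBlocks (k : ℕ) (m : List ℕ) : List ℕ :=
  parseGaps 0 ((List.range m.length).filter (fun p => IsCut k m p)) m.length

/-- The pieces of a string: the maximal repetitions `a^ℓ` with `ℓ ≥ 2`, and the maximal substrings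
between them. -/
def pieces (x : List ℕ) : List (List ℕ) :=
  ((x.splitBy (fun a b => a == b)).splitBy
    (fun g h => decide (g.length = 1 ∧ h.length = 1))).map List.flatten

/-- A piece of length one that follows another piece is appended to that piece. -/
def attachLeft : List (List ℕ) → List (List ℕ)
  | m :: [a] :: rest => (m ++ [a]) :: attachLeft rest
  | m :: rest => m :: attachLeft rest
  | [] => []

/-- Pieces of length one are attached to the neighbouring repetition: to the left one, or to the
right one at the beginning of the string. -/
def attach : List (List ℕ) → List (List ℕ)
  | [a] :: m :: rest => attachLeft ((a :: m) :: rest)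
  | ms => attachLeft ms

/-- Block lengths of one piece: alphabet reduction if it is repetition-free and longer than `2 k`
(type 2), left-aligned parsing otherwise (types 1 and 3). -/
def pieceBlocks (k : ℕ) (m : List ℕ) : List ℕ :=
  if m.IsChain (· ≠ ·) ∧ 2 * k < m.length then typeTwoBlocks k m else leftAligned m.length

/-- The block lengths of one level of edit-sensitive parsing. -/
def blocks (k : ℕ) (x : List ℕ) : List ℕ := (attach (pieces x)).flatMap (pieceBlocks k)

/-- The forest `us` arises from `ts` by building a 2-tree `X → A B` over each block of length two
and a 2-2-tree `X → A Y`, `Y → B C` over each block of length three. -/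
inductive Grouped : List ℕ → List PTree → List PTree → Prop
  | nil : Grouped [] [] []
  | pair {bs ts us} (X : ℕ) (a b : PTree) : Grouped bs ts us →
      Grouped (2 :: bs) (a :: b :: ts) (.node X a b :: us)
  | triple {bs ts us} (X Y : ℕ) (a b c : PTree) : Grouped bs ts us →
      Grouped (3 :: bs) (a :: b :: c :: ts) (.node X a (.node Y b c) :: us)

/-- Repeated parsing of the sequence of names of the roots of a forest until one tree is left. -/
inductive EspTree (k : ℕ) (name : ℕ → ℕ) : List PTree → PTree → Prop
  | single (t : PTree) : EspTree k name [t] t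
  | level {ts us : List PTree} {t : PTree} : 2 ≤ ts.length →
      Grouped (blocks k (ts.map (fun u => name u.label))) ts us → EspTree k name us t →
      EspTree k name ts t

/-- Different symbols have different names, and the names are numbers below `n + σ`.  These are the
integers on which the alphabet reduction operates: the post-order numbers themselves (`name = id`),
or the numbers of the variables in the order in which the parser has created them. -/
def IsNaming (G : Slp) (name : ℕ → ℕ) : Prop :=
  Set.InjOn name (Set.Iio G.numSymbols) ∧ ∀ X < G.numSymbols, name X < G.numSymbols

/-- `G` is a post-order SLP of the string `S`, and its parse tree `T` is the ESP-tree of `S`. -/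
def IsEspGrammar (G : Slp) (name : ℕ → ℕ) (S : List ℕ) (T : PTree) : Prop :=
  G.IsPoslp T ∧ IsNaming G name ∧ EspTree (lgStar S.length) name (S.map PTree.leaf) T

/-! ## Evidences -/

/-- `OccursAt T i t`: the tree `t` is the subtree at some node of `T`, and the leaves below this node
start at position `i` (counted from `0`) of the leaf sequence of `T`. -/
inductive OccursAt : PTree → ℕ → PTree → Prop
  | here (T : PTree) : OccursAt T 0 T
  | left {X l r i t} : OccursAt l i t → OccursAt (.node X l r) i t
  | right {X l r i t} : OccursAt r i t → OccursAt (.node X l r) (l.yield.length + i) t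

/-- The nodes `v₁, …, v_k` of `T` cover consecutive intervals of leaves, starting at position `i`. -/
def Consecutive (T : PTree) : ℕ → List PTree → Prop
  | _, [] => True
  | i, v :: vs => OccursAt T i v ∧ Consecutive T (i + v.yield.length) vs

/-- `Q` is the label string of embedding nodes of `P` over the occurrence of `P` at position `i`. -/
def IsEvidenceAt (T : PTree) (P : List ℕ) (i : ℕ) (Q : List ℕ) : Prop :=
  ∃ vs : List PTree, Consecutive T i vs ∧ vs.flatMap PTree.yield = P ∧ vs.map PTree.label = Q

/-- `Q` is an evidence of `P`. -/
def IsEvidence (T : PTree) (P Q : List ℕ) : Prop := ∃ i, IsEvidenceAt T P i Q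

/-- The least `t` such that `Q = Q₁ ⋯ Q_t` where each `Q_i` is a symbol or a maximal repetition. -/
def numRuns (Q : List ℕ) : ℕ := (Q.splitBy (fun a b => a == b)).length

/-! ## The data structures of the index

Operations return their result together with the number of steps that they take. -/

/-- Range min tree over a bit string.  The excess of a bit string is its number of `0`s minus its
number of `1`s; an inner node stores the length, the number of `1`s and the excess of its part of
the string, and the minimum of the excesses of the proper prefixes of its part. -/
inductive RangeMin where
  | leaf (b : Bool)
  | node (size ones : ℕ) (excess low : ℤ) (l r : RangeMin)

namespace RangeMin

def size : RangeMin → ℕ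
  | leaf _ => 1
  | node s _ _ _ _ _ => s

def ones : RangeMin → ℕ
  | leaf b => b.toNat
  | node _ o _ _ _ _ => o

def excess : RangeMin → ℤ
  | leaf b => if b then -1 else 1
  | node _ _ e _ _ _ => e

def low : RangeMin → ℤ
  | leaf _ => 0
  | node _ _ _ m _ _ => m

/-- The inner node with the given children. -/
def join (l r : RangeMin) : RangeMin :=
  node (l.size + r.size) (l.ones + r.ones) (l.excess + r.excess) (min l.low (l.excess + r.low)) l r

/-- The balanced tree of a (non-empty) bit string. -/
def ofList (B : List Bool) : RangeMin :=
  if h : 2 ≤ B.length then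
    join (ofList (B.take (B.length / 2))) (ofList (B.drop (B.length / 2)))
  else leaf (B.headD false)
termination_by B.length
decreasing_by
  · simp only [List.length_take]; omega
  · simp only [List.length_drop]; omega

/-- The bit at position `p` and the number of `1`s before position `p`. -/
def accessRank : RangeMin → ℕ → (Bool × ℕ) × ℕ
  | leaf b, _ => ((b, 0), 1)
  | node _ _ _ _ l r, p =>
    if p < l.size then
      let q := l.accessRank p
      (q.1, q.2 + 1)
    else
      let q := r.accessRank (p - l.size)
      ((q.1.1, l.ones + q.1.2), q.2 + 1)

/-- The position of the `i`-th `1`, where `i` counts from `0`. -/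
def select : RangeMin → ℕ → ℕ × ℕ
  | leaf _, _ => (0, 1)
  | node _ _ _ _ l r, i =>
    if i < l.ones then
      let q := l.select i
      (q.1, q.2 + 1)
    else
      let q := r.select (i - l.ones)
      (l.size + q.1, q.2 + 1)

/-- Backward search: the largest `q < p` such that the first `q` bits have excess at most `v`. -/
def lastBelow : RangeMin → ℕ → ℤ → Option ℕ × ℕ
  | leaf _, p, v => (if 0 < p ∧ 0 ≤ v then some 0 else none, 1)
  | node _ _ _ m l r, p, v =>
    if v < m then (none, 1)
    else if p ≤ l.size then
      let q := l.lastBelow p v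
      (q.1, q.2 + 1)
    else
      let q := r.lastBelow (p - l.size) (v - l.excess)
      match q.1 with
      | some j => (some (l.size + j), q.2 + 1)
      | none =>
        let q' := l.lastBelow l.size v
        (q'.1, q.2 + q'.2 + 1)

end RangeMin

/-- Wavelet trees.  The bit string of an inner node is a fully indexable dictionary: reading a bit
together with its rank is one step. -/
inductive Wavelet where
  | leaf (a : ℕ)
  | node (A : List Bool) (l r : Wavelet)

namespace Wavelet

/-- The wavelet tree of a sequence over the range `[a..b]`. -/
def build (a b : ℕ) (L : List ℕ) : Wavelet :=
  if h : a < b then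
    node (L.map (fun c => decide ((a + b) / 2 < c)))
      (build a ((a + b) / 2) (L.filter (fun c => c ≤ (a + b) / 2)))
      (build ((a + b) / 2 + 1) b (L.filter (fun c => (a + b) / 2 < c)))
  else leaf a
termination_by b - a
decreasing_by
  · omega
  · omega

/-- The `i`-th element of the sequence, where `i` counts from `0`. -/
def access : Wavelet → ℕ → ℕ × ℕ
  | leaf a, _ => (a, 1)
  | node A l r, i =>
    if A.getD i false then
      let q := r.access ((A.take i).count true)
      (q.1, q.2 + 1)
    else
      let q := l.access ((A.take i).count false)
      (q.1, q.2 + 1)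

end Wavelet

/-- The index: the succinct tree `B` of the POPPT, the leaf sequence `L` of the POPPT in a wavelet
tree, the chaining hash table (hash function and chains) and the array `R` of lengths `|val(X)|`;
and the names of the symbols on which the parser operates. -/
structure Index where
  sigma : ℕ
  n : ℕ
  B : RangeMin
  L : Wavelet
  hash : ℕ → ℕ → ℕ
  H : ℕ → List ℕ
  R : List ℕ
  name : ℕ → ℕ

/-- The number of entries of the hash table with load factor `α`. -/
noncomputable def tableSize (G : Slp) (α : ℝ) : ℕ := ⌈α * G.n⌉₊

/-- The hash functions: all maps from pairs of symbols to entries of the table. -/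
abbrev HashFun (G : Slp) (m : ℕ) : Type :=
  Fin G.numSymbols × Fin G.numSymbols → Fin m

/-- The entry for a pair of symbols (`0` for numbers that are not symbols). -/
def hashVal (G : Slp) {m : ℕ} (h : HashFun G m) (x y : ℕ) : ℕ :=
  if hxy : x < G.numSymbols ∧ y < G.numSymbols then (h (⟨x, hxy.1⟩, ⟨y, hxy.2⟩)).val else 0

/-- The index of the grammar `G` with parse tree `T`, for the hash function `h`.  The last bit `1` of
`B` is the virtual node.  The chain of an entry contains the numbers `i` of all variables whose
right-hand side is hashed to this entry. -/
def buildIndex (G : Slp) (name : ℕ → ℕ) (T : PTree) {m : ℕ} (h : HashFun G m) : Index where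
  sigma := G.sigma
  n := G.n
  B := RangeMin.ofList (T.partialTree.bits ++ [true])
  L := Wavelet.build 0 (G.numSymbols - 1) T.partialTree.yield
  hash := hashVal G h
  H := fun e => (List.range G.n).filter
    (fun i => hashVal G h (G.rules.getD i (0, 0)).1 (G.rules.getD i (0, 0)).2 = e)
  R := (List.range G.n).map (fun i => (G.val (G.sigma + i)).length)
  name := name

namespace Index

/-- The symbol at the node of the POPPT with position `p` in `B`: an internal node carries the
variable given by its post-order rank, a leaf carries its entry in `L`. -/
def symbolAt (I : Index) (p : ℕ) : ℕ × ℕ :=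
  let q := I.B.accessRank p
  if q.1.1 then (I.sigma + q.1.2, q.2 + 1)
  else
    let s := I.L.access (p - q.1.2)
    (s.1, q.2 + s.2 + 1)

/-- Phrase dictionary: the right-hand side of the variable `σ + i`, read off the POPPT.  The node is
the `i`-th `1` of `B`, at position `p`; its right child is at `p - 1`, and its left child is in front
of the subtree of the right child, which is found by a backward search. -/
def digram (I : Index) (i : ℕ) : (ℕ × ℕ) × ℕ :=
  let p := I.B.select i
  let y := I.symbolAt (p.1 - 1)
  let q := I.B.lastBelow p.1 ((p.1 : ℤ) - 2 * i - 1)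
  let x := I.symbolAt (q.1.getD 0 - 1)
  ((x.1, y.1), p.2 + y.2 + q.2 + x.2 + 1)

/-- Search of a chain for the variable with right-hand side `(x, y)`. -/
def scan (I : Index) (x y : ℕ) : List ℕ → Option ℕ × ℕ
  | [] => (none, 1)
  | i :: rest =>
    let d := I.digram i
    if d.1 = (x, y) then (some (I.sigma + i), d.2 + 1)
    else
      let q := I.scan x y rest
      (q.1, d.2 + q.2 + 1)

/-- Reverse dictionary: the variable with right-hand side `(x, y)`, if there is one. -/
def reverse (I : Index) (x y : ℕ) : Option ℕ × ℕ :=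
  let q := I.scan x y (I.H (I.hash x y))
  (q.1, q.2 + 1)

end Index

/-! ## The machine

A word RAM with words of `w` bits, programmed by structured programs, with access to the index. -/

inductive BinOp where
  | plus | minus | times | quot | rem | less | equal

/-- Truncated difference, quotient and remainder; `1` is true and `0` is false. -/
def BinOp.apply : BinOp → ℕ → ℕ → ℕ
  | plus, a, b => a + b
  | minus, a, b => a - b
  | times, a, b => a * b
  | quot, a, b => a / b
  | rem, a, b => a % b
  | less, a, b => if a < b then 1 else 0
  | equal, a, b => if a = b then 1 else 0

inductive Expr where
  | lit (c : ℕ)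
  | reg (x : ℕ)
  | load (e : Expr)
  | bin (o : BinOp) (e f : Expr)

/-- A state: the contents of the registers and of the memory. -/
structure State where
  reg : ℕ → ℕ
  mem : ℕ → ℕ

def Expr.eval (w : ℕ) (s : State) : Expr → ℕ
  | lit c => c % 2 ^ w
  | .reg x => s.reg x
  | load e => s.mem (e.eval w s)
  | bin o e f => o.apply (e.eval w s) (f.eval w s) % 2 ^ w

/-- One step per operation. -/
def Expr.cost : Expr → ℕ
  | lit _ => 1
  | .reg _ => 1
  | load e => e.cost + 1
  | bin _ e f => e.cost + f.cost + 1

inductive Program where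
  | skip
  | assign (x : ℕ) (e : Expr)
  | store (a e : Expr)
  /-- Phrase dictionary: store the right-hand side of the variable `e` in the registers `x`, `y`. -/
  | phrase (x y : ℕ) (e : Expr)
  /-- Reverse dictionary: store in the register `x` the variable with right-hand side `(e, f)`, or
  the number `n + σ`, which is not a symbol, if there is none. -/
  | reverse (x : ℕ) (e f : Expr)
  /-- Store the length of the string derived from the variable `e` in the register `x`. -/
  | length (x : ℕ) (e : Expr)
  /-- Store the name of the symbol `e` in the register `x`. -/
  | name (x : ℕ) (e : Expr)
  | seq (p q : Program)
  | cond (e : Expr) (p q : Program)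
  | loop (e : Expr) (p : Program)

def State.setReg (s : State) (x v : ℕ) : State := { s with reg := Function.update s.reg x v }

def State.setMem (s : State) (a v : ℕ) : State := { s with mem := Function.update s.mem a v }

/-- `Exec I w p s s' t`: started in state `s`, the program `p` halts in state `s'` after `t` steps. -/
inductive Exec (I : Index) (w : ℕ) : Program → State → State → ℕ → Prop
  | skip (s : State) : Exec I w .skip s s 1
  | assign (x : ℕ) (e : Expr) (s : State) :
      Exec I w (.assign x e) s (s.setReg x (e.eval w s)) (e.cost + 1)
  | store (a e : Expr) (s : State) :
      Exec I w (.store a e) s (s.setMem (a.eval w s) (e.eval w s)) (a.cost + e.cost + 1)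
  | phrase (x y : ℕ) (e : Expr) (s : State) :
      Exec I w (.phrase x y e) s
        ((s.setReg x (I.digram (e.eval w s - I.sigma)).1.1).setReg y
          (I.digram (e.eval w s - I.sigma)).1.2)
        (e.cost + (I.digram (e.eval w s - I.sigma)).2 + 1)
  | reverse (x : ℕ) (e f : Expr) (s : State) :
      Exec I w (.reverse x e f) s
        (s.setReg x ((I.reverse (e.eval w s) (f.eval w s)).1.getD (I.n + I.sigma)))
        (e.cost + f.cost + (I.reverse (e.eval w s) (f.eval w s)).2 + 1)
  | length (x : ℕ) (e : Expr) (s : State) :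
      Exec I w (.length x e) s (s.setReg x (I.R.getD (e.eval w s - I.sigma) 0)) (e.cost + 1)
  | name (x : ℕ) (e : Expr) (s : State) :
      Exec I w (.name x e) s (s.setReg x (I.name (e.eval w s) % 2 ^ w)) (e.cost + 1)
  | seq {p q : Program} {s s' s'' : State} {t t' : ℕ} :
      Exec I w p s s' t → Exec I w q s' s'' t' → Exec I w (.seq p q) s s'' (t + t')
  | condTrue {e : Expr} {p q : Program} {s s' : State} {t : ℕ} : e.eval w s ≠ 0 →
      Exec I w p s s' t → Exec I w (.cond e p q) s s' (e.cost + t + 1)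
  | condFalse {e : Expr} {p q : Program} {s s' : State} {t : ℕ} : e.eval w s = 0 →
      Exec I w q s s' t → Exec I w (.cond e p q) s s' (e.cost + t + 1)
  | loopTrue {e : Expr} {p : Program} {s s' s'' : State} {t t' : ℕ} : e.eval w s ≠ 0 →
      Exec I w p s s' t → Exec I w (.loop e p) s' s'' t' →
      Exec I w (.loop e p) s s'' (e.cost + t + t' + 1)
  | loopFalse {e : Expr} {p : Program} {s : State} : e.eval w s = 0 →
      Exec I w (.loop e p) s s (e.cost + 1)

/-- The input: the memory contains `P`, the first registers contain `|P|`, `|S|`, `σ`, `n` and the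
parameter `k = lg* |S|` of the parser; everything else is `0`. -/
def inputState (G : Slp) (textLength k : ℕ) (P : List ℕ) : State where
  reg := fun x => [P.length, textLength, G.sigma, G.n, k].getD x 0
  mem := fun a => P.getD a 0

/-- The output: the memory segment whose address and length are in the registers `0` and `1`. -/
def output (s : State) : List ℕ := (List.range (s.reg 1)).map (fun j => s.mem (s.reg 0 + j))

/-- The program `p` with input `P` halts with output `Q` after `t` steps. -/
def Computes (G : Slp) (name : ℕ → ℕ) (T : PTree) (k : ℕ) {m : ℕ} (h : HashFun G m) (w : ℕ) (p : Program)
    (P Q : List ℕ) (t : ℕ) : Prop :=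
  ∃ s' : State, Exec (buildIndex G name T h) w p (inputState G T.yield.length k P) s' t ∧
    output s' = Q

/-- The expectation of a running time under a uniformly random hash function. -/
noncomputable def expectedTime (G : Slp) (m : ℕ) (time : HashFun G m → ℕ) : ℝ :=
  (∑ h : HashFun G m, (time h : ℝ)) / Fintype.card (HashFun G m)

end OESP

/-! The blocks of one level are governed by the positions where the parsing starts anew: the end of
the string, the starts of pieces (after single symbols have been attached), and the cuts inside
pieces of type 2. These are the positions with `Hard`. Starts of pieces and landmarks are recognised
from nearby symbols; a cut also needs a sufficiently long repetition-free window around it. No two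
consecutive positions are hard (`Hard.not_succ`), so one greedy rule recovers all blocks: take a
pair, unless a triple is needed to hit the next hard position (`blocksFrom`,
`blocks_eq_blocksFrom`).

For a string `p` of symbols, `Sure` singles out the positions whose hardness is visible inside `p`;
they are hard in every occurrence (`Sure.hard`). Conversely, between two sure positions every
position that is hard in some context is sure (`sure_of_hard`). Hence the blocks between the first
and the last sure position are the same in all occurrences. Their variables, obtained from the
reverse dictionary, form `core p`, which is at most half as long as `p`. The evidence keeps the
symbols in front of the first and behind the last sure position and recurses on the core.
`EspTree.exists_evidence` follows an occurrence up through the levels of the parse tree and finds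
nodes with these labels.

A kept segment has no sure position in its interior. Apart from its first symbol it is therefore a
repetition followed by a tail which, up to three symbols at its end, is repetition-free. After
`lgStar |S|` rounds all labels are bounded by a constant depending on σ (`reduced_le_of_lgStar`),
and bounded labels with distinct neighbours soon have a local maximum, which would be a sure cut. So
for fixed σ the tail has length `O(lgStar |S|)`. There are two segments per level and at most `1 +
lg |P|` levels (`numRuns_evidence_le`).

For the time bound, let `e` be the number of bits of a name and `k = lgStar |S|`. A level with `m`
symbols costs `O(m k e)` for the alphabet reduction, where differing bits are searched one by one,
and `O(m)` queries of the reverse dictionary. A query inspects the variables of one chain; each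
right-hand side is read in `O(e)` steps by navigation in the range min tree and the wavelet tree
(`IndexOk.digram_eq`), and the expected chain length is at most `1 + n / ⌈α n⌉`
(`expectedTime_chainLength`). The answers do not depend on the hash function, so neither do the
states of the machine, and expected costs simply add up (`Env.wp`). Since lengths halve from level
to level, the total is a geometric sum.

If `P` does not occur, some queries fail and yield `n + σ`. This number gets a name of its own, so
the same computation goes through and the time bound still holds. -/

namespace OESP

/-! ## Range min trees -/

/-- The number of `0`s minus the number of `1`s. -/
def exc (B : List Bool) : ℤ := (B.count false : ℤ) - B.count true

@[simp] theorem exc_nil : exc [] = 0 := rfl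

theorem exc_append (A B : List Bool) : exc (A ++ B) = exc A + exc B := by
  unfold exc
  rw [List.count_append, List.count_append]
  push_cast
  ring

theorem exc_singleton (b : Bool) : exc [b] = if b then -1 else 1 := by cases b <;> rfl

theorem length_eq_count_add_count (B : List Bool) :
    B.length = B.count true + B.count false := by
  exact (List.count_true_add_count_false B).symm

namespace RangeMin

/-- `t` is a range min tree of depth at most `d` for the bit string `B`. -/
inductive Represents : List Bool → RangeMin → ℕ → Prop
  | leaf (b : Bool) (d : ℕ) : Represents [b] (leaf b) d
  | join {A B : List Bool} {l r : RangeMin} {d : ℕ} : Represents A l d → Represents B r d →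
      Represents (A ++ B) (join l r) (d + 1)

theorem represents_ofList (d : ℕ) : ∀ (B : List Bool), B ≠ [] → B.length ≤ 2 ^ d →
    Represents B (ofList B) d := by
  induction d with
  | zero =>
    intro B hB hd
    match B, hB, hd with
    | [b], _, _ => rw [ofList]; exact .leaf b 0
  | succ d ih =>
    intro B hB hd
    rw [ofList]
    split_ifs with h
    · rw [pow_succ] at hd
      have h1 : Represents (B.take (B.length / 2)) (ofList (B.take (B.length / 2))) d := by
        apply ih
        · rw [ne_eq, List.take_eq_nil_iff]; push Not; exact ⟨by omega, hB⟩
        · rw [List.length_take]; omega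
      have h2 : Represents (B.drop (B.length / 2)) (ofList (B.drop (B.length / 2))) d := by
        apply ih
        · rw [ne_eq, List.drop_eq_nil_iff]; omega
        · rw [List.length_drop]; omega
      have := Represents.join h1 h2
      rwa [List.take_append_drop] at this
    · match B, hB, h with
      | [b], _, _ => exact .leaf b _
      | _ :: _ :: _, _, h => simp at h

theorem size_join (l r : RangeMin) : (join l r).size = l.size + r.size := rfl

theorem ones_join (l r : RangeMin) : (join l r).ones = l.ones + r.ones := rfl

theorem excess_join (l r : RangeMin) : (join l r).excess = l.excess + r.excess := rfl

theorem low_join (l r : RangeMin) : (join l r).low = min l.low (l.excess + r.low) := rfl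

variable {B : List Bool} {t : RangeMin} {d : ℕ}

theorem Represents.size_eq (h : Represents B t d) : t.size = B.length := by
  induction h with
  | leaf => rfl
  | join _ _ h1 h2 => simp [size_join, h1, h2]

theorem Represents.length_pos (h : Represents B t d) : 0 < B.length := by
  induction h with
  | leaf => simp
  | join _ _ h1 h2 => simp; omega

theorem Represents.ones_eq (h : Represents B t d) : t.ones = B.count true := by
  induction h with
  | leaf b => cases b <;> rfl
  | join _ _ h1 h2 => simp [ones_join, h1, h2]

theorem Represents.excess_eq (h : Represents B t d) : t.excess = exc B := by
  induction h with
  | leaf b => cases b <;> rfl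
  | join _ _ h1 h2 => simp [excess_join, h1, h2, exc_append]

/-- This direction makes pruning sound. That the minimum is attained is needed as well, but only
inside `lastBelow_full`. -/
theorem Represents.low_le (h : Represents B t d) : ∀ q < B.length, t.low ≤ exc (B.take q) := by
  induction h with
  | leaf b => intro q hq; simp at hq; subst hq; simp [low]
  | @join A B l r d hl hr h1 h2 =>
    intro q hq
    rw [low_join, List.take_append, exc_append]
    rcases lt_or_ge q A.length with h | h
    · have := h1 q h
      rw [Nat.sub_eq_zero_of_le h.le]
      simp; left; exact this
    · rw [List.take_of_length_le h]
      have := h2 (q - A.length) (by simp at hq; omega)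
      rw [hl.excess_eq]
      exact (min_le_right _ _).trans (by linarith)

theorem Represents.accessRank_eq (h : Represents B t d) : ∀ p < B.length,
    (t.accessRank p).1 = (B.getD p false, (B.take p).count true) ∧
      (t.accessRank p).2 ≤ d + 1 := by
  induction h with
  | leaf b d => intro p hp; simp at hp; subst hp; simp [accessRank]
  | @join A B l r d hl hr h1 h2 =>
    intro p hp
    simp only [RangeMin.join, accessRank, hl.size_eq]
    split_ifs with h
    · obtain ⟨e1, e2⟩ := h1 p h
      refine ⟨?_, Nat.succ_le_succ e2⟩
      simp only [e1]
      rw [List.getD_append _ _ _ _ h, List.take_append_of_le_length h.le]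
    · obtain ⟨e1, e2⟩ := h2 (p - A.length) (by simp at hp; omega)
      refine ⟨?_, Nat.succ_le_succ e2⟩
      simp only [e1, hl.ones_eq]
      rw [List.getD_append_right _ _ _ _ (by omega), List.take_append (l₁ := A),
        List.take_of_length_le (l := A) (by omega), List.count_append]

theorem Represents.select_eq (h : Represents B t d) : ∀ (A C : List Bool), B = A ++ true :: C →
    (t.select (A.count true)).1 = A.length ∧ (t.select (A.count true)).2 ≤ d + 1 := by
  induction h with
  | leaf b d =>
    intro A C h
    match A, h with
    | [], h => simp [select]
    | [_], h => simp at h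
  | @join B₁ B₂ l r d hl hr h1 h2 =>
    intro A C h
    simp only [RangeMin.join, select, hl.ones_eq]
    rcases List.append_eq_append_iff.1 h with ⟨as, e1, e2⟩ | ⟨bs, e1, e2⟩
    · subst e1
      have h3 := h2 as C e2
      rw [if_neg (by simp)]
      simp only [List.count_append, Nat.add_sub_cancel_left, hl.size_eq, List.length_append]
      exact ⟨by rw [h3.1], by omega⟩
    -- The split may fall exactly between the two halves; then the wanted `1` is the first bit of
    -- the right half.
    · cases bs with
      | nil =>
        simp at e1 e2
        subst e1
        have h3 := h2 [] C e2.symm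
        rw [if_neg (by simp)]
        simp only [Nat.sub_self, hl.size_eq]
        simp at h3
        exact ⟨by rw [h3.1]; rfl, by omega⟩
      | cons b bs =>
        simp at e2
        obtain ⟨rfl, e2⟩ := e2
        have h3 := h1 A bs e1
        rw [if_pos (by subst e1; simp)]
        exact ⟨h3.1, by simp; omega⟩

/-- When the whole part is searched, the stored minimum decides at once whether the search can
succeed. A failing call therefore costs one step, and a successful one fails at most once per level,
in the right child. This keeps the cost linear in the depth although both children may be visited.
-/
theorem Represents.lastBelow_full (h : Represents B t d) : ∀ v,
    (t.lastBelow B.length v).2 ≤ 2 * d + 1 ∧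
    (∀ q, (t.lastBelow B.length v).1 = some q → q < B.length ∧ exc (B.take q) ≤ v ∧
      ∀ q', q < q' → q' < B.length → v < exc (B.take q')) ∧
    ((t.lastBelow B.length v).1 = none → (t.lastBelow B.length v).2 = 1 ∧
      ∀ q < B.length, v < exc (B.take q)) := by
  induction h with
  | leaf b d =>
    intro v
    simp only [lastBelow, List.length_singleton]
    refine ⟨by simp, ?_, ?_⟩
    · intro q hq
      simp at hq
      obtain ⟨hv, rfl⟩ := hq
      simp only [List.take_zero, exc_nil]
      exact ⟨by omega, hv, by intros; omega⟩
    · intro hq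
      simp at hq
      simpa using hq
  | @join A B l r d hl hr h1 h2 =>
    intro v
    have hlow := (Represents.join hl hr).low_le
    rw [low_join] at hlow
    simp only [RangeMin.join, lastBelow]
    have hpA := hl.length_pos
    have hpB := hr.length_pos
    rw [hl.excess_eq, hl.size_eq] at *
    split_ifs with hv h
    · refine ⟨by simp, by simp, fun _ => ⟨rfl, fun q hq => lt_of_lt_of_le hv (hlow q hq)⟩⟩
    · rw [List.length_append] at h; omega
    · have e : (A ++ B).length - A.length = B.length := by simp
      rw [e]
      obtain ⟨a1, a2, a3⟩ := h2 (v - exc A)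
      obtain ⟨b1, b2, b3⟩ := h1 v
      have key : ∀ q, A.length ≤ q → exc ((A ++ B).take q) = exc A + exc (B.take (q - A.length)) := by
        intro q hq; rw [List.take_append, List.take_of_length_le hq, exc_append]
      have key' : ∀ q, q ≤ A.length → exc ((A ++ B).take q) = exc (A.take q) := by
        intro q hq; rw [List.take_append_of_le_length hq]
      cases hr' : (r.lastBelow B.length (v - exc A)).1 with
      | some j =>
        obtain ⟨c1, c2, c3⟩ := a2 j hr'
        refine ⟨by simp; omega, ?_, by simp⟩
        intro q hq; simp at hq; subst hq
        refine ⟨by simp; omega, ?_, ?_⟩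
        · rw [key _ (by omega)]; simp; linarith
        · intro q' hq1 hq2
          rw [key _ (by omega)]
          have := c3 (q' - A.length) (by omega) (by simp at hq2; omega)
          linarith
      | none =>
        obtain ⟨c1, c2⟩ := a3 hr'
        refine ⟨by simp; omega, ?_, ?_⟩
        · intro q hq; simp at hq
          obtain ⟨d1, d2, d3⟩ := b2 q hq
          refine ⟨by simp; omega, by rwa [key' _ d1.le], ?_⟩
          intro q' hq1 hq2
          rcases lt_or_ge q' A.length with h' | h'
          · rw [key' _ h'.le]; exact d3 q' hq1 h'
          · rw [key _ h']
            have := c2 (q' - A.length) (by simp at hq2; omega)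
            linarith
        · intro hq; simp at hq
          exfalso
          obtain ⟨d1, d2⟩ := b3 hq
          push Not at hv
          -- The minimum is attained by a proper prefix, so passing the pruning test guarantees a
          -- solution; both children cannot fail.
          have m1 : ∃ q < A.length + B.length, exc ((A ++ B).take q) ≤ v := by
            by_contra hcon
            push Not at hcon
            have e1 : ∀ {B : List Bool} {t : RangeMin} {d : ℕ}, Represents B t d →
                ∃ q < B.length, exc (B.take q) = t.low := by
              intro B t d h
              induction h with
              | leaf b d => exact ⟨0, by simp, by simp [low]⟩
              | @join A B l r d hl hr h1 h2 =>
                obtain ⟨q1, g1, g2⟩ := h1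
                obtain ⟨q2, g3, g4⟩ := h2
                rw [low_join]
                rcases min_choice l.low (l.excess + r.low) with hm | hm <;> rw [hm]
                · exact ⟨q1, by simp; omega, by rw [List.take_append_of_le_length g1.le, g2]⟩
                · refine ⟨A.length + q2, by simp; omega, ?_⟩
                  rw [List.take_append, List.take_of_length_le (by omega), exc_append,
                    hl.excess_eq, ← g4]; simp
            obtain ⟨q, g1, g2⟩ := e1 (Represents.join hl hr)
            have := hcon q (by simpa using g1)
            rw [low_join, hl.excess_eq] at g2
            rw [g2] at this
            omega
          obtain ⟨q, g1, g2⟩ := m1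
          rcases lt_or_ge q A.length with h' | h'
          · rw [key' _ h'.le] at g2; have := d2 q h'; omega
          · rw [key _ h'] at g2; have := c2 (q - A.length) (by omega); omega

/-- With a bound `p` inside the part the pruning test is inconclusive only along the path to `p`.
The left siblings of this path are searched in full, so by `lastBelow_full` each failure there costs
one step, and the first success ends the search. This explains the separate, smaller bound for
failing calls. -/
theorem Represents.lastBelow_spec (h : Represents B t d) : ∀ p v, p ≤ B.length →
    (t.lastBelow p v).2 ≤ 4 * d + 1 ∧
    (∀ q, (t.lastBelow p v).1 = some q → q < p ∧ exc (B.take q) ≤ v ∧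
      ∀ q', q < q' → q' < p → v < exc (B.take q')) ∧
    ((t.lastBelow p v).1 = none → (t.lastBelow p v).2 ≤ 2 * d + 1 ∧
      ∀ q < p, v < exc (B.take q)) := by
  induction h with
  | leaf b d =>
    intro p v hp
    simp only [lastBelow]
    refine ⟨by simp, ?_, ?_⟩
    · intro q hq
      simp at hq
      obtain ⟨⟨hp', hv⟩, rfl⟩ := hq
      simp at hp
      simp [hp', hv]; intros; omega
    · intro hq
      simp at hq hp
      refine ⟨by simp, ?_⟩
      intro q hq'
      obtain rfl : q = 0 := by omega
      simpa using hq hq'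
  | @join A B l r d hl hr h1 h2 =>
    intro p v hp
    have hlow := (Represents.join hl hr).low_le
    rw [low_join] at hlow
    simp only [RangeMin.join, lastBelow]
    rw [hl.excess_eq, hl.size_eq] at *
    have key : ∀ q, A.length ≤ q → exc ((A ++ B).take q) = exc A + exc (B.take (q - A.length)) := by
      intro q hq; rw [List.take_append, List.take_of_length_le hq, exc_append]
    have key' : ∀ q, q ≤ A.length → exc ((A ++ B).take q) = exc (A.take q) := by
      intro q hq; rw [List.take_append_of_le_length hq]
    split_ifs with hv h
    · refine ⟨by simp, by simp, fun _ => ⟨by simp, fun q hq =>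
        lt_of_lt_of_le hv (hlow q (by omega))⟩⟩
    · obtain ⟨a1, a2, a3⟩ := h1 p v h
      refine ⟨by simp; omega, ?_, ?_⟩
      · intro q hq
        obtain ⟨c1, c2, c3⟩ := a2 q hq
        refine ⟨c1, by rwa [key' _ (by omega)], ?_⟩
        intro q' h1 h2; rw [key' _ (by omega)]; exact c3 q' h1 h2
      · intro hq
        obtain ⟨c1, c2⟩ := a3 hq
        exact ⟨by simp; omega, fun q h1 => by rw [key' _ (by omega)]; exact c2 q h1⟩
    · obtain ⟨a1, a2, a3⟩ := h2 (p - A.length) (v - exc A) (by simp at hp; omega)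
      obtain ⟨b1, b2, b3⟩ := hl.lastBelow_full v
      cases hr' : (r.lastBelow (p - A.length) (v - exc A)).1 with
      | some j =>
        obtain ⟨c1, c2, c3⟩ := a2 j hr'
        refine ⟨by simp; omega, ?_, by simp⟩
        intro q hq; simp at hq; subst hq
        refine ⟨by omega, ?_, ?_⟩
        · rw [key _ (by omega)]; simp; linarith
        · intro q' hq1 hq2
          rw [key _ (by omega)]
          have := c3 (q' - A.length) (by omega) (by omega)
          linarith
      | none =>
        obtain ⟨c1, c2⟩ := a3 hr'
        refine ⟨by simp; omega, ?_, ?_⟩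
        · intro q hq; simp at hq
          obtain ⟨d1, d2, d3⟩ := b2 q hq
          refine ⟨by omega, by rwa [key' _ d1.le], ?_⟩
          intro q' hq1 hq2
          rcases lt_or_ge q' A.length with h' | h'
          · rw [key' _ h'.le]; exact d3 q' hq1 h'
          · rw [key _ h']
            have := c2 (q' - A.length) (by omega)
            linarith
        · intro hq; simp at hq
          obtain ⟨d1, d2⟩ := b3 hq
          refine ⟨by simp; omega, ?_⟩
          intro q hq1
          rcases lt_or_ge q A.length with h' | h'
          · rw [key' _ h'.le]; exact d2 q h'
          · rw [key _ h']
            have := c2 (q - A.length) (by omega)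
            linarith

end RangeMin

/-! ## Wavelet trees -/

/-- The rank identity behind wavelet trees: descending to a child sends an index to the number of
earlier elements that go to the same child. -/
theorem count_take_filter {α : Type*} (p : α → Bool) (l : List α) : ∀ i (h : i < l.length),
    p l[i] = true → (l.filter p)[((l.take i).filter p).length]? = some l[i] := by
  intro i h hp
  have : l = l.take i ++ l[i] :: l.drop (i + 1) := by simp
  conv_lhs => rw [this]
  rw [List.filter_append, List.filter_cons_of_pos (by simpa using hp)]
  simp

theorem Wavelet.access_build (d : ℕ) : ∀ (a b : ℕ) (L : List ℕ), b - a < 2 ^ d →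
    (∀ c ∈ L, a ≤ c ∧ c ≤ b) → ∀ i (h : i < L.length),
    ((build a b L).access i).1 = L[i] ∧ ((build a b L).access i).2 ≤ d + 1 := by
  induction d with
  | zero =>
    intro a b L hd hL i hi
    rw [build, dif_neg (by omega)]
    have := hL _ (List.getElem_mem hi)
    simp [access]; omega
  | succ d ih =>
    intro a b L hd hL i hi
    rw [build]
    split_ifs with hab
    swap
    · have := hL _ (List.getElem_mem hi)
      simp [access]; omega
    rw [pow_succ] at hd
    simp only [access]
    have e1 : (L.map (fun c => decide ((a + b) / 2 < c))).getD i false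
        = decide ((a + b) / 2 < L[i]) := by
      simp [List.getD, hi]
    rw [e1]
    split_ifs with h
    · have hq := count_take_filter (fun c => decide ((a + b) / 2 < c)) L i hi h
      have e2 : ((L.map (fun c => decide ((a + b) / 2 < c))).take i).count true
          = ((L.take i).filter (fun c => decide ((a + b) / 2 < c))).length := by
        rw [← List.map_take, List.count, List.countP_map, List.countP_eq_length_filter]
        congr 2; funext x; simp
      rw [e2]
      obtain ⟨hlt, hget⟩ := List.getElem?_eq_some_iff.1 hq
      have := ih ((a + b) / 2 + 1) b (L.filter (fun c => decide ((a + b) / 2 < c))) (by omega)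
        (by intro c hc; simp at hc; have := hL c hc.1; omega) _ hlt
      exact ⟨by rw [this.1, hget], by simp; omega⟩
    · have hq := count_take_filter (fun c => decide (c ≤ (a + b) / 2)) L i hi (by
        simp at h; simpa using h)
      have e2 : ((L.map (fun c => decide ((a + b) / 2 < c))).take i).count false
          = ((L.take i).filter (fun c => decide (c ≤ (a + b) / 2))).length := by
        rw [← List.map_take, List.count, List.countP_map, List.countP_eq_length_filter]
        congr 2; funext x; simp
        by_cases hx : x ≤ (a + b) / 2 <;> simp [hx] <;> omega
      rw [e2]
      obtain ⟨hlt, hget⟩ := List.getElem?_eq_some_iff.1 hq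
      have := ih a ((a + b) / 2) (L.filter (fun c => decide (c ≤ (a + b) / 2))) (by omega)
        (by intro c hc; simp at hc; have := hL c hc.1; omega) _ hlt
      exact ⟨by rw [this.1, hget], by simp; omega⟩

/-! ## Navigation in the partial parse tree -/

namespace PTree

theorem count_true_bits (t : PTree) : t.bits.count true = t.internals.length := by
  induction t with
  | leaf a => rfl
  | node X l r hl hr => simp [bits, internals, hl, hr, List.count_append]

theorem count_false_bits (t : PTree) : t.bits.count false = t.yield.length := by
  induction t with
  | leaf a => rfl
  | node X l r hl hr => simp [bits, yield, hl, hr, List.count_append]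

theorem length_yield (t : PTree) : t.yield.length = t.internals.length + 1 := by
  induction t with
  | leaf a => rfl
  | node X l r hl hr => simp [internals, yield, hl, hr]; omega

theorem length_bits (t : PTree) : t.bits.length = 2 * t.internals.length + 1 := by
  rw [length_eq_count_add_count, count_true_bits, count_false_bits, length_yield]; omega

theorem exc_bits (t : PTree) : exc t.bits = 1 := by
  rw [exc, count_true_bits, count_false_bits, length_yield]; push_cast; ring

/-- A prefix of a post-order code is the code of a stack of completed subtrees, and its excess is
the height of the stack. -/
theorem one_le_exc_take_bits (t : PTree) :
    ∀ q, 0 < q → q ≤ t.bits.length → 1 ≤ exc (t.bits.take q) := by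
  induction t with
  | leaf a =>
    intro q h0 h1
    obtain rfl : q = 1 := by simp [bits] at h1; omega
    simp [bits, exc]
  | node X l r hl hr =>
    intro q h0 h1
    rcases Nat.lt_or_ge l.bits.length q with h | h
    · rcases Nat.lt_or_ge (l.bits.length + r.bits.length) q with h' | h'
      · rw [List.take_of_length_le (by simp [bits] at h1 ⊢; omega), exc_bits]
      · rw [bits, List.append_assoc, List.take_append, List.take_of_length_le h.le, exc_append,
          exc_bits, List.take_append_of_le_length (by omega)]
        have := hr (q - l.bits.length) (by omega) (by omega)
        omega
    · rw [bits, List.append_assoc, List.take_append_of_le_length h]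
      exact hl q h0 h

/-- Every internal node carries a variable with the rule given by its children, and the leaves carry
symbols. -/
def Follows (G : Slp) : PTree → Prop
  | .leaf a => a < G.numSymbols
  | .node X l r =>
    (∃ k, X = G.sigma + k ∧ G.rules[k]? = some (l.label, r.label)) ∧ l.Follows G ∧ r.Follows G

theorem follows_of_isParseTree {G : Slp} : ∀ {t : PTree}, G.IsParseTree t → t.Follows G
  | .leaf _, h => Nat.lt_of_lt_of_le h (Nat.le_add_left _ _)
  | .node _ _ _, h => ⟨h.1, follows_of_isParseTree h.2.1, follows_of_isParseTree h.2.2⟩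

theorem Follows.label_lt {G : Slp} {t : PTree} (h : t.Follows G) : t.label < G.numSymbols := by
  cases t with
  | leaf a => exact h
  | node X l r =>
    obtain ⟨⟨k, rfl, hk⟩, -⟩ := h
    have := (List.getElem?_eq_some_iff.1 hk).1
    simp only [label, Slp.numSymbols, Slp.n]; omega

theorem label_prune (t : PTree) (seen : List ℕ) : (t.prune seen).1.label = t.label := by
  cases t with
  | leaf a => rfl
  | node X l r => rw [prune]; split_ifs <;> rfl

/-- Pruning changes no label of a surviving node, so surviving inner nodes keep their rules, and a
variable cut off at an earlier occurrence is a legitimate leaf. -/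
theorem Follows.prune {G : Slp} {t : PTree} (h : t.Follows G) :
    ∀ seen, (t.prune seen).1.Follows G := by
  induction t with
  | leaf a => intro seen; exact h
  | node X l r hl hr =>
    intro seen
    rw [PTree.prune]
    split_ifs with hX
    · exact h.label_lt
    · exact ⟨by simpa only [label_prune] using h.1, hl h.2.1 _, hr h.2.2 _⟩

theorem length_internals_prune (t : PTree) :
    ∀ seen, (t.prune seen).1.internals.length ≤ t.internals.length := by
  induction t with
  | leaf a => intro seen; simp [PTree.prune]
  | node X l r hl hr =>
    intro seen
    rw [PTree.prune]
    split_ifs with hX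
    · simp [internals]
    · have := hl seen
      have := hr (l.prune seen).2
      simp [internals]; omega

theorem Follows.yield_lt {G : Slp} {t : PTree} (h : t.Follows G) :
    ∀ c ∈ t.yield, c < G.numSymbols := by
  induction t with
  | leaf a => intro c hc; simp [yield] at hc; subst hc; exact h
  | node X l r hl hr =>
    intro c hc
    simp only [yield, List.mem_append] at hc
    exact hc.elim (hl h.2.1 c) (hr h.2.2 c)

/-- `t` is a subtree of `T`; the bit string, the internal labels and the leaves of `T` in front of
`t` are `A`, `I` and `Y`, and those behind `t` are `C`, `J` and `Z`. -/
structure Located (T t : PTree) (A C : List Bool) (I J Y Z : List ℕ) : Prop where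
  bits_eq : T.bits = A ++ t.bits ++ C
  internals_eq : T.internals = I ++ t.internals ++ J
  yield_eq : T.yield = Y ++ t.yield ++ Z
  count_true : A.count true = I.length
  count_false : A.count false = Y.length

theorem located_self (t : PTree) : Located t t [] [] [] [] [] [] :=
  ⟨by simp, by simp, by simp, rfl, rfl⟩

theorem Located.left {T : PTree} {X : ℕ} {l r : PTree} {A C : List Bool} {I J Y Z : List ℕ}
    (h : Located T (.node X l r) A C I J Y Z) :
    Located T l A (r.bits ++ [true] ++ C) I (r.internals ++ [X] ++ J) Y (r.yield ++ Z) :=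
  ⟨by simp [h.bits_eq, bits], by simp [h.internals_eq, internals], by simp [h.yield_eq, yield],
    h.count_true, h.count_false⟩

theorem Located.right {T : PTree} {X : ℕ} {l r : PTree} {A C : List Bool} {I J Y Z : List ℕ}
    (h : Located T (.node X l r) A C I J Y Z) :
    Located T r (A ++ l.bits) (true :: C) (I ++ l.internals) (X :: J) (Y ++ l.yield) Z :=
  ⟨by simp [h.bits_eq, bits], by simp [h.internals_eq, internals], by simp [h.yield_eq, yield],
    by simp [h.count_true, count_true_bits], by simp [h.count_false, count_false_bits]⟩

/-- The ranks of the left subtree, of the right subtree and of the root occupy consecutive intervals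
in post-order, so a rank determines the descent to its node. -/
theorem exists_located {G : Slp} {T : PTree} : ∀ (t : PTree) {A C : List Bool} {I J Y Z : List ℕ},
    t.Follows G → Located T t A C I J Y Z → ∀ i, I.length ≤ i → i < I.length + t.internals.length →
    ∃ (X : ℕ) (l r : PTree) (A' C' : List Bool) (I' J' Y' Z' : List ℕ),
      (node X l r).Follows G ∧ Located T (.node X l r) A' C' I' J' Y' Z' ∧
      i = I'.length + l.internals.length + r.internals.length := by
  intro t
  induction t with
  | leaf a => intro A C I J Y Z _ _ i h1 h2; simp [internals] at h2; omega
  | node X l r hl hr =>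
    intro A C I J Y Z hF h i h1 h2
    simp [internals] at h2
    rcases Nat.lt_or_ge i (I.length + l.internals.length) with h3 | h3
    · exact hl hF.2.1 h.left i h1 h3
    · rcases Nat.lt_or_ge i (I.length + l.internals.length + r.internals.length) with h4 | h4
      · exact hr hF.2.2 h.right i (by simpa using h3) (by simpa using h4)
      · exact ⟨X, l, r, A, C, I, J, Y, Z, hF, h, by omega⟩

end PTree

/-! ## The phrase dictionary -/

section Navigation

variable {G : Slp} {name : ℕ → ℕ} {T : PTree} {m e : ℕ} {h : HashFun G m}

/-- The facts about the index on which its operations rely; `e` is the number of bits of a symbol. -/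
structure IndexOk (G : Slp) (T : PTree) (e : ℕ) : Prop where
  isPoslp : G.IsPoslp T
  sigma_pos : 0 < G.sigma
  lt_pow : G.numSymbols < 2 ^ e

theorem IndexOk.follows (H : IndexOk G T e) : T.partialTree.Follows G :=
  (PTree.follows_of_isParseTree H.isPoslp.2.1).prune []

theorem IndexOk.internals_length (H : IndexOk G T e) : T.partialTree.internals.length = G.n := by
  rw [H.isPoslp.2.2]; simp

theorem IndexOk.represents (H : IndexOk G T e) :
    RangeMin.Represents (T.partialTree.bits ++ [true]) (buildIndex G name T h).B (e + 1) := by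
  apply RangeMin.represents_ofList
  · simp
  · have h1 := H.lt_pow
    have h2 := H.sigma_pos
    simp only [List.length_append, PTree.length_bits, H.internals_length, Slp.numSymbols,
      List.length_singleton] at *
    rw [pow_succ]; omega

-- The last bit of the code of a subtree belongs to its root. If it is `1`, the number of preceding
-- `1`s is the post-order rank, which is the variable because the grammar is a post-order SLP. If it
-- is `0`, the number of preceding `0`s is the index of the leaf in `L`.
open PTree in
theorem IndexOk.symbolAt_eq (H : IndexOk G T e) {t : PTree} {A C : List Bool} {I J Y Z : List ℕ}
    (ht : Located T.partialTree t A C I J Y Z) :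
    ((buildIndex G name T h).symbolAt (A.length + t.bits.length - 1)).1 = t.label := by
  have hr := (H.represents (name := name) (h := h)).accessRank_eq
    (A.length + t.bits.length - 1) (by
      rw [ht.bits_eq]; simp [length_bits]; omega)
  rw [Index.symbolAt, hr.1]
  have hint := H.isPoslp.2.2
  cases t with
  | leaf a =>
    have e0 : A.length + (leaf a).bits.length - 1 = A.length := by simp [bits]
    have e1 : (T.partialTree.bits ++ [true]) = A ++ (false :: (C ++ [true])) := by
      rw [ht.bits_eq]; simp [bits]
    rw [e0, e1]
    simp only [List.getD_append_right _ _ _ _ le_rfl, Nat.sub_self, List.getD_cons_zero,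
      List.take_left]
    have e2 : A.length - A.count true = Y.length := by
      have := length_eq_count_add_count A
      rw [← ht.count_false]; omega
    have hY : Y.length < T.partialTree.yield.length := by rw [ht.yield_eq]; simp [yield]
    have := Wavelet.access_build e 0 (G.numSymbols - 1) T.partialTree.yield (by
      have := H.lt_pow; omega) (by
        intro c hc
        have := H.follows.yield_lt c hc
        omega) Y.length hY
    simp only [Bool.false_eq_true, if_false, e2]
    rw [show (buildIndex G name T h).L = Wavelet.build 0 (G.numSymbols - 1) T.partialTree.yield
      from rfl, this.1]
    simp [ht.yield_eq, yield, label]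
  | node X l r =>
    have e0 : A.length + (node X l r).bits.length - 1 = (A ++ (l.bits ++ r.bits)).length := by
      simp [bits]; omega
    have e1 : (T.partialTree.bits ++ [true]) = (A ++ (l.bits ++ r.bits)) ++ (true :: (C ++ [true])) := by
      rw [ht.bits_eq]; simp [bits]
    rw [e0, e1]
    simp only [List.getD_append_right _ _ _ _ le_rfl, Nat.sub_self, List.getD_cons_zero,
      List.take_left, if_true]
    rw [ht.internals_eq] at hint
    have e2 : ((A ++ (l.bits ++ r.bits)).count true) = (I ++ (l.internals ++ r.internals)).length := by
      simp [ht.count_true, count_true_bits]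
    rw [e2]
    have e3 : I ++ (node X l r).internals ++ J = (I ++ (l.internals ++ r.internals)) ++ (X :: J) := by
      simp [internals]
    rw [e3] at hint
    have e4 := congrArg (fun L => L[(I ++ (l.internals ++ r.internals)).length]?) hint
    simp only [List.getElem?_append_right le_rfl, Nat.sub_self, List.getElem?_cons_zero] at e4
    have e5 := (List.getElem?_eq_some_iff.1 e4.symm)
    obtain ⟨e6, e7⟩ := e5
    rw [List.getElem_range'] at e7
    change G.sigma + _ = X
    omega

theorem IndexOk.symbolAt_cost (H : IndexOk G T e) (p : ℕ) (hp : p < T.partialTree.bits.length) :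
    ((buildIndex G name T h).symbolAt p).2 ≤ 2 * e + 4 := by
  have hr := (H.represents (name := name) (h := h)).accessRank_eq p (by simp; omega)
  rw [Index.symbolAt, hr.1]
  have h2 := hr.2
  split_ifs with hb
  · simp; omega
  · have hlt : p - ((T.partialTree.bits ++ [true]).take p).count true
        < T.partialTree.yield.length := by
      rw [List.take_append_of_le_length hp.le]
      have e1 := length_eq_count_add_count (T.partialTree.bits.take p)
      -- The bit at `p` is itself a `0`, so strictly fewer `0`s precede it than there are leaves,
      -- and the access to `L` is in range.
      have e2 : (T.partialTree.bits.take (p + 1)).count false ≤ T.partialTree.bits.count false :=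
        List.Sublist.count_le _ (List.take_sublist _ _)
      rw [List.take_add_one, List.getElem?_eq_getElem hp, List.count_append,
        PTree.count_false_bits] at e2
      simp [List.getD, List.getElem?_append_left hp, hp] at hb
      simp [hb] at e2
      rw [List.length_take, min_eq_left hp.le] at e1
      omega
    have := Wavelet.access_build e 0 (G.numSymbols - 1) T.partialTree.yield (by
      have := H.lt_pow; omega) (by
        intro c hc
        have := H.follows.yield_lt c hc
        omega) _ hlt
    have h3 := this.2
    change _ + ((Wavelet.build 0 (G.numSymbols - 1) T.partialTree.yield).access _).2 + 1 ≤ _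
    simp only at h3 ⊢
    omega

-- With `A` the code in front of the node, the excess is `exc A + 1` directly after the left subtree
-- and at least `exc A + 2` at every later position inside the right subtree. So the backward search
-- for excess at most `exc A + 1` stops exactly at the end of the left child. The cost is the sum of
-- one selection, one backward search and two symbol look-ups.
open PTree in
theorem IndexOk.digram_eq (H : IndexOk G T e) {i : ℕ} (hi : i < G.n) :
    ((buildIndex G name T h).digram i).1 = G.rules.getD i (0, 0) ∧
      ((buildIndex G name T h).digram i).2 ≤ 9 * e + 16 := by
  obtain ⟨X, l, r, A, C, I, J, Y, Z, hF, ht, hi'⟩ := exists_located (G := G) T.partialTree H.follows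
    (located_self T.partialTree) i (by simp) (by simpa [H.internals_length] using hi)
  have hrep := H.represents (name := name) (h := h)
  have hsplit : T.partialTree.bits ++ [true] = (A ++ l.bits ++ r.bits) ++ true :: (C ++ [true]) := by
    rw [ht.bits_eq]; simp [bits]
  have hsel := hrep.select_eq _ _ hsplit
  have hcnt : (A ++ l.bits ++ r.bits).count true = i := by
    simp [ht.count_true, count_true_bits, hi', Nat.add_assoc]
  rw [hcnt] at hsel
  have hlen : A.length = I.length + Y.length := by
    rw [length_eq_count_add_count, ht.count_true, ht.count_false]
  have hbl := l.length_bits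
  have hbr := r.length_bits
  -- There are `i` ones in front of the node, so `p - 2 i` is the excess there. Both children are
  -- complete, hence it equals `exc A + 2`.
  have hv : (((A ++ l.bits ++ r.bits).length : ℕ) : ℤ) - 2 * i - 1 = exc A + 1 := by
    rw [exc, ht.count_true, ht.count_false, hi']
    simp only [List.length_append, hbl, hbr, hlen]
    push_cast; ring
  have hlb := hrep.lastBelow_spec (A ++ l.bits ++ r.bits).length (exc A + 1) (by
    rw [hsplit]; simp)
  have hexl : exc ((T.partialTree.bits ++ [true]).take (A ++ l.bits).length) = exc A + 1 := by
    rw [hsplit, List.append_assoc, List.take_left, exc_append, exc_bits]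
  have hexr : ∀ q', (A ++ l.bits).length < q' → q' < (A ++ l.bits ++ r.bits).length →
      exc A + 1 < exc ((T.partialTree.bits ++ [true]).take q') := by
    intro q' h1 h2
    rw [hsplit, List.take_append_of_le_length h2.le, List.take_append,
      List.take_of_length_le h1.le, exc_append, exc_append, exc_bits]
    have := r.one_le_exc_take_bits (q' - (A ++ l.bits).length) (by omega) (by
      simp only [List.length_append] at *; omega)
    omega
  have hq : ((buildIndex G name T h).B.lastBelow (A ++ l.bits ++ r.bits).length (exc A + 1)).1
      = some (A ++ l.bits).length := by
    cases hq : ((buildIndex G name T h).B.lastBelow (A ++ l.bits ++ r.bits).length (exc A + 1)).1 with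
    | none =>
      have := (hlb.2.2 hq).2 (A ++ l.bits).length (by simp; omega)
      rw [hexl] at this
      omega
    | some q =>
      obtain ⟨g1, g2, g3⟩ := hlb.2.1 q hq
      congr 1
      by_contra hne
      rcases Nat.lt_or_ge q (A ++ l.bits).length with h1 | h1
      · have := g3 _ h1 (by simp; omega)
        rw [hexl] at this; omega
      · have := hexr q (by omega) g1
        omega
  have hy := H.symbolAt_eq (name := name) (h := h) ht.right
  have hx := H.symbolAt_eq (name := name) (h := h) ht.left
  have hyc := H.symbolAt_cost (name := name) (h := h) ((A ++ l.bits ++ r.bits).length - 1) (by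
    rw [ht.bits_eq]; simp [bits]; omega)
  have hxc := H.symbolAt_cost (name := name) (h := h) ((A ++ l.bits).length - 1) (by
    rw [ht.bits_eq]; simp [bits]; omega)
  have hlbc := hlb.1
  rw [← List.length_append] at hy hx
  rw [Index.digram]
  simp only [hsel.1, hv, hq, Option.getD_some]
  refine ⟨?_, ?_⟩
  · rw [hx, hy]
    obtain ⟨⟨k, hk1, hk2⟩, -⟩ := hF
    have hint := H.isPoslp.2.2
    rw [ht.internals_eq] at hint
    have e3 : I ++ (node X l r).internals ++ J = (I ++ (l.internals ++ r.internals)) ++ (X :: J) := by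
      simp [internals]
    rw [e3] at hint
    have e4 := congrArg (fun L => L[(I ++ (l.internals ++ r.internals)).length]?) hint
    simp only [List.getElem?_append_right le_rfl, Nat.sub_self, List.getElem?_cons_zero] at e4
    obtain ⟨e6, e7⟩ := (List.getElem?_eq_some_iff.1 e4.symm)
    rw [List.getElem_range'] at e7
    simp only [List.length_append] at e7
    obtain rfl : k = i := by omega
    simp [List.getD, hk2]
  · have := hsel.2
    omega

end Navigation

/-! ## The reverse dictionary -/

/-- The variable with right-hand side `(x, y)`, or `σ + n` if there is none. -/
def Slp.rev (G : Slp) (x y : ℕ) : ℕ := G.sigma + G.rules.idxOf (x, y)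

theorem Slp.WellFormed.rev_eq {G : Slp} (hG : G.WellFormed) {k x y : ℕ}
    (h : G.rules[k]? = some (x, y)) : G.rev x y = G.sigma + k := by
  obtain ⟨h1, h2⟩ := List.getElem?_eq_some_iff.1 h
  rw [rev, ← h2, hG.2.idxOf_getElem]

theorem Slp.rev_le (G : Slp) (x y : ℕ) : G.rev x y ≤ G.numSymbols := by
  have := List.idxOf_le_length (a := (x, y)) (l := G.rules)
  simp only [rev, numSymbols, n]; omega

section Scan

variable {G : Slp} {name : ℕ → ℕ} {T : PTree} {m e : ℕ} {h : HashFun G m}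

/-- Rules are pairwise distinct, so comparing right-hand sides along a chain amounts to looking for
the single index `idxOf (x, y)`. -/
theorem IndexOk.scan_eq (H : IndexOk G T e) (x y : ℕ) : ∀ L : List ℕ, (∀ i ∈ L, i < G.n) →
    ((buildIndex G name T h).scan x y L).1 =
      (if G.rules.idxOf (x, y) ∈ L then some (G.rev x y) else none) ∧
    ((buildIndex G name T h).scan x y L).2 ≤ L.length * (9 * e + 17) + 1 := by
  intro L
  induction L with
  | nil => intro _; simp [Index.scan]
  | cons i L ih =>
    intro hL
    have hi : i < G.n := hL i (by simp)
    have hi' : i < G.rules.length := hi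
    obtain ⟨d1, d2⟩ := H.digram_eq (name := name) (h := h) hi
    obtain ⟨i1, i2⟩ := ih (fun j hj => hL j (by simp [hj]))
    have hgd : G.rules.getD i (0, 0) = G.rules[i] := by
      simp [List.getD, hi']
    rw [Index.scan]
    simp only [d1]
    split_ifs with hxy h2 h2
    · have : G.rules.idxOf (x, y) = i := by
        rw [← hxy, hgd, H.isPoslp.1.2.idxOf_getElem]
      refine ⟨by simp [Slp.rev, this]; rfl, ?_⟩
      simp only [List.length_cons, Nat.add_mul]
      omega
    · exfalso; apply h2
      rw [← hxy, hgd, H.isPoslp.1.2.idxOf_getElem]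
      simp
    · have hne : G.rules.idxOf (x, y) ≠ i := by
        intro hcon
        apply hxy
        have hlt : G.rules.idxOf (x, y) < G.rules.length := by rw [hcon]; exact hi
        have := List.getElem_idxOf hlt
        rw [hgd, ← this]
        congr 1; exact hcon.symm
      have h3 : G.rules.idxOf (x, y) ∈ L := by simpa [hne] using h2
      rw [if_pos h3] at i1
      refine ⟨i1, ?_⟩
      simp only [List.length_cons, Nat.add_mul] at i2 ⊢
      omega
    · have h3 : G.rules.idxOf (x, y) ∉ L := fun h => h2 (by simp [h])
      rw [if_neg h3] at i1
      refine ⟨i1, ?_⟩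
      simp only [List.length_cons, Nat.add_mul] at i2 ⊢
      omega

/-- The length of the chain that is searched for the right-hand side `(x, y)`. -/
def chainLength (G : Slp) {m : ℕ} (h : HashFun G m) (x y : ℕ) : ℕ :=
  ((List.range G.n).filter (fun i => hashVal G h (G.rules.getD i (0, 0)).1
    (G.rules.getD i (0, 0)).2 = hashVal G h x y)).length

/-- A variable with the queried right-hand side would lie in the searched chain, so failure of the
scan means that there is none. Then `idxOf` is the number of rules, and `rev` agrees with the
default value `n + σ` of the machine. -/
theorem IndexOk.reverse_eq (H : IndexOk G T e) (x y : ℕ) :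
    ((buildIndex G name T h).reverse x y).1.getD (G.n + G.sigma) = G.rev x y ∧
    ((buildIndex G name T h).reverse x y).2 ≤ chainLength G h x y * (9 * e + 17) + 2 := by
  rw [Index.reverse]
  obtain ⟨h1, h2⟩ := H.scan_eq (name := name) (h := h) x y
    ((buildIndex G name T h).H ((buildIndex G name T h).hash x y)) (by
      intro i hi
      simp only [buildIndex, List.mem_filter, List.mem_range] at hi
      exact hi.1)
  refine ⟨?_, ?_⟩
  · simp only [h1]
    split_ifs with hmem
    · rfl
    · have hge : G.n ≤ G.rules.idxOf (x, y) := by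
        by_contra hlt
        push Not at hlt
        apply hmem
        simp only [buildIndex, List.mem_filter, List.mem_range]
        refine ⟨hlt, ?_⟩
        have : G.rules.getD (G.rules.idxOf (x, y)) (0, 0) = (x, y) := by
          rw [List.getD, List.getElem?_eq_getElem (show _ < G.rules.length from hlt)]
          simp
        rw [this]; simp
      have hle : G.rules.idxOf (x, y) ≤ G.n := List.idxOf_le_length
      simp only [Option.getD_none, Slp.rev]
      omega
  · exact Nat.succ_le_succ h2

end Scan

/-! ## Expectations over the hash function -/

section Expectation

/-- Resampling one value of a uniformly random function leaves it uniformly random: exchanging the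
old and the new value is an involution of the pairs. -/
theorem sum_sum_update {A : Type*} [Fintype A] [DecidableEq A] {m : ℕ} (a : A)
    (F : (A → Fin m) → ℝ) :
    ∑ h : A → Fin m, ∑ c : Fin m, F (Function.update h a c) = m * ∑ h : A → Fin m, F h := by
  have h1 : ∑ x : (A → Fin m) × Fin m, F (Function.update x.1 a x.2)
      = ∑ x : (A → Fin m) × Fin m, F x.1 := by
    refine Fintype.sum_equiv
      ⟨fun x => (Function.update x.1 a x.2, x.1 a), fun x => (Function.update x.1 a x.2, x.1 a),
        ?_, ?_⟩ _ _ ?_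
    · intro x; simp
    · intro x; simp
    · intro x; rfl
  rw [Fintype.sum_prod_type, Fintype.sum_prod_type] at h1
  rw [h1]
  simp [Finset.mul_sum]

/-- Conditioned on all values of `h` except the one at `a`, the target `g h` is fixed and is hit
with probability at most `1 / m`. It is only an inequality because `g h` may lie outside the table.
-/
theorem sum_hash_eq_le {A : Type*} [Fintype A] [DecidableEq A] {m : ℕ} (a : A)
    (g : (A → Fin m) → ℕ) (hg : ∀ h c, g (Function.update h a c) = g h) :
    (m : ℝ) * ∑ h : A → Fin m, (if (h a : ℕ) = g h then (1 : ℝ) else 0)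
      ≤ Fintype.card (A → Fin m) := by
  rw [← sum_sum_update a]
  simp only [Function.update_self, hg]
  have : ∀ h : A → Fin m, ∑ c : Fin m, (if (c : ℕ) = g h then (1 : ℝ) else 0) ≤ 1 := by
    intro h
    by_cases hlt : g h < m
    · rw [Finset.sum_eq_single (⟨g h, hlt⟩ : Fin m)]
      · simp
      · intro b _ hb; rw [if_neg]; intro hcon; exact hb (Fin.ext hcon)
      · simp
    · rw [Finset.sum_eq_zero]
      · norm_num
      · intro c _; rw [if_neg]; intro hcon; have := c.2; omega
  refine (Finset.sum_le_sum (fun h _ => this h)).trans ?_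
  simp

variable {G : Slp} {m : ℕ}

theorem expectedTime_add (f g : HashFun G m → ℕ) :
    expectedTime G m (fun h => f h + g h) = expectedTime G m f + expectedTime G m g := by
  simp only [expectedTime, Nat.cast_add, Finset.sum_add_distrib, add_div]

theorem expectedTime_const [NeZero m] (c : ℕ) : expectedTime G m (fun _ => c) = c := by
  simp only [expectedTime, Finset.sum_const, Finset.card_univ, nsmul_eq_mul]
  rw [mul_div_cancel_left₀]
  exact_mod_cast Fintype.card_ne_zero

theorem expectedTime_mono {f g : HashFun G m → ℕ} (h : ∀ x, f x ≤ g x) :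
    expectedTime G m f ≤ expectedTime G m g := by
  unfold expectedTime
  gcongr with x
  exact h x

theorem expectedTime_mul (f : HashFun G m → ℕ) (c : ℕ) :
    expectedTime G m (fun h => f h * c) = expectedTime G m f * c := by
  simp only [expectedTime, Nat.cast_mul, ← Finset.sum_mul]
  ring

theorem chainLength_eq_sum (h : HashFun G m) (x y : ℕ) : (chainLength G h x y : ℝ) =
    ∑ i ∈ Finset.range G.n, (if hashVal G h (G.rules.getD i (0, 0)).1 (G.rules.getD i (0, 0)).2
      = hashVal G h x y then (1 : ℝ) else 0) := by
  rw [Finset.sum_boole, chainLength, ← List.toFinset_card_of_nodup (List.nodup_range.filter _)]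
  congr 2
  ext i; simp

/-- At most one variable has the queried right-hand side; it contributes at most `1`. Every other
one collides with the query with probability at most `1 / m`. The query need not consist of symbols:
its hash value is then constantly `0`, which is still independent of the value at another pair. -/
theorem expectedTime_chainLength [NeZero m] (hG : G.WellFormed) (x y : ℕ) :
    expectedTime G m (fun h => chainLength G h x y) ≤ 1 + (G.n : ℝ) / m := by
  have hcard : (0 : ℝ) < Fintype.card (HashFun G m) := by exact_mod_cast Fintype.card_pos
  have hm : (0 : ℝ) < m := by exact_mod_cast Nat.pos_of_ne_zero (NeZero.ne m)
  rw [expectedTime, div_le_iff₀ hcard]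
  simp only [chainLength_eq_sum]
  rw [Finset.sum_comm]
  have key : ∀ i ∈ Finset.range G.n, ∑ h : HashFun G m,
      (if hashVal G h (G.rules.getD i (0, 0)).1 (G.rules.getD i (0, 0)).2
        = hashVal G h x y then (1 : ℝ) else 0) ≤
      ((if G.rules.idxOf (x, y) = i then 1 else 0) + 1 / m) * Fintype.card (HashFun G m) := by
    intro i hi
    rw [Finset.mem_range] at hi
    have hgd : G.rules[i]? = some (G.rules.getD i (0, 0)) := by
      rw [List.getD, List.getElem?_eq_getElem (show i < G.rules.length from hi)]; rfl
    generalize G.rules.getD i (0, 0) = q at hgd ⊢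
    obtain ⟨y', z'⟩ := q
    have hlt := hG.1 i y' z' hgd
    have hn : G.sigma + i < G.numSymbols := by simp only [Slp.numSymbols]; omega
    simp only
    by_cases hxy : (x, y) = (y', z')
    · have : G.rules.idxOf (x, y) = i := by
        have := hG.rev_eq hgd
        rw [← hxy] at hgd
        have := hG.rev_eq hgd
        simp only [Slp.rev] at this; omega
      rw [if_pos this]
      calc _ ≤ ∑ h : HashFun G m, (1 : ℝ) := Finset.sum_le_sum (fun h _ => by split_ifs <;> norm_num)
        _ = 1 * Fintype.card (HashFun G m) := by simp
        _ ≤ _ := by gcongr; simp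
    · have := sum_hash_eq_le (m := m)
        ((⟨y', by omega⟩, ⟨z', by omega⟩) : Fin G.numSymbols × Fin G.numSymbols)
        (fun h => hashVal G h x y) (by
          intro h c
          unfold hashVal
          split_ifs with hs
          · rw [Function.update_of_ne]
            intro hcon
            apply hxy
            simpa using hcon
          · rfl)
      calc _ = ∑ h : HashFun G m, (if ((h (⟨y', by omega⟩, ⟨z', by omega⟩) : Fin m) : ℕ)
            = hashVal G h x y then (1 : ℝ) else 0) := by
            refine Finset.sum_congr rfl (fun h _ => ?_)
            rw [show hashVal G h y' z' = ((h (⟨y', by omega⟩, ⟨z', by omega⟩) : Fin m) : ℕ) by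
              unfold hashVal; rw [dif_pos ⟨by omega, by omega⟩]]
        _ ≤ Fintype.card (HashFun G m) / m := by rw [le_div_iff₀ hm, mul_comm]; exact this
        _ = (0 + 1 / m) * Fintype.card (HashFun G m) := by ring
        _ ≤ _ := by gcongr; split_ifs <;> norm_num
  refine (Finset.sum_le_sum key).trans ?_
  rw [← Finset.sum_mul]
  gcongr
  rw [Finset.sum_add_distrib]
  gcongr
  · rw [Finset.sum_ite_eq]; split_ifs <;> norm_num
  · simp [div_eq_mul_inv]

end Expectation

/-! ## A calculus of expected running times -/

/-- The data that a run of a program depends on, apart from the hash function. -/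
structure Env where
  G : Slp
  name : ℕ → ℕ
  T : PTree
  m : ℕ
  w : ℕ

/-- `R` bounds the expected cost of a query of the reverse dictionary. -/
structure Env.Ok (E : Env) (e R : ℕ) : Prop where
  table : E.m ≠ 0
  index : IndexOk E.G E.T e
  query : (1 + (E.G.n : ℝ) / E.m) * (9 * e + 17) + 2 ≤ R

/-- Started in `s`, the program `p` halts after at most `U` expected steps in a state that does not
depend on the hash function and satisfies `post`. -/
def Env.wp (E : Env) (p : Program) (s : State) (U : ℕ) (post : State → Prop) : Prop :=
  ∃ s', (∃ time : HashFun E.G E.m → ℕ,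
    (∀ h, Exec (buildIndex E.G E.name E.T h) E.w p s s' (time h)) ∧
      expectedTime E.G E.m time ≤ U) ∧ post s'

section Wp

variable {E : Env} {e R : ℕ} {p q : Program} {s : State} {U V : ℕ} {post mid : State → Prop}

theorem Env.wp.mono {U' : ℕ} {post' : State → Prop} (h : E.wp p s U post) (hU : U ≤ U')
    (hp : ∀ s', post s' → post' s') : E.wp p s U' post' := by
  obtain ⟨s', ⟨time, h1, h2⟩, h3⟩ := h
  exact ⟨s', ⟨time, h1, h2.trans (by exact_mod_cast hU)⟩, hp _ h3⟩

theorem Env.Ok.of_const (H : E.Ok e R) {s' : State} (t : ℕ)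
    (h : ∀ h : HashFun E.G E.m, Exec (buildIndex E.G E.name E.T h) E.w p s s' t) (hU : t ≤ U) (hp : post s') :
    E.wp p s U post := by
  have : NeZero E.m := ⟨H.table⟩
  exact ⟨s', ⟨fun _ => t, h, by rw [expectedTime_const]; exact_mod_cast hU⟩, hp⟩

theorem Env.Ok.assign (H : E.Ok e R) {x : ℕ} {f : Expr} (hU : f.cost + 1 ≤ U)
    (hp : post (s.setReg x (f.eval E.w s))) : E.wp (.assign x f) s U post :=
  H.of_const _ (fun _ => .assign x f s) hU hp

theorem Env.Ok.store (H : E.Ok e R) {a f : Expr} (hU : a.cost + f.cost + 1 ≤ U)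
    (hp : post (s.setMem (a.eval E.w s) (f.eval E.w s))) : E.wp (.store a f) s U post :=
  H.of_const _ (fun _ => .store a f s) hU hp

theorem Env.Ok.name (H : E.Ok e R) {x : ℕ} {f : Expr} (hU : f.cost + 1 ≤ U)
    (hp : post (s.setReg x (E.name (f.eval E.w s) % 2 ^ E.w))) : E.wp (.name x f) s U post :=
  H.of_const _ (fun _ => .name x f s) hU hp

/-- In this calculus it is the only instruction whose cost is random. Its answer is not, and this
keeps the resulting state independent of the hash function. -/
theorem Env.Ok.reverse (H : E.Ok e R) {x : ℕ} {f g : Expr} (hU : f.cost + g.cost + 1 + R ≤ U)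
    (hp : post (s.setReg x (E.G.rev (f.eval E.w s) (g.eval E.w s)))) :
    E.wp (.reverse x f g) s U post := by
  have : NeZero E.m := ⟨H.table⟩
  refine ⟨_, ⟨fun h => f.cost + g.cost + ((buildIndex E.G E.name E.T h).reverse
    (f.eval E.w s) (g.eval E.w s)).2 + 1, fun h => ?_, ?_⟩, hp⟩
  · have h1 := Exec.reverse (I := buildIndex E.G E.name E.T h) (w := E.w) x f g s
    have h2 := (H.index.reverse_eq (name := E.name) (h := h) (f.eval E.w s) (g.eval E.w s)).1
    rwa [show (buildIndex E.G E.name E.T h).n = E.G.n from rfl,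
      show (buildIndex E.G E.name E.T h).sigma = E.G.sigma from rfl, h2] at h1
  · refine (expectedTime_mono (g := fun h => (f.cost + g.cost + 1) +
      (chainLength E.G h (f.eval E.w s) (g.eval E.w s) * (9 * e + 17) + 2)) (fun h => ?_)).trans ?_
    · have h2 := (H.index.reverse_eq (name := E.name) (h := h) (f.eval E.w s) (g.eval E.w s)).2
      omega
    · rw [expectedTime_add, expectedTime_const, expectedTime_add, expectedTime_const,
        expectedTime_mul]
      have h3 := expectedTime_chainLength (m := E.m) H.index.isPoslp.1 (f.eval E.w s)
        (g.eval E.w s)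
      have h4 := H.query
      have h5 : ((f.cost + g.cost + 1 + R : ℕ) : ℝ) ≤ U := by exact_mod_cast hU
      push_cast at h5 ⊢
      have h6 := mul_le_mul_of_nonneg_right h3 (by positivity : (0 : ℝ) ≤ 9 * e + 17)
      linarith

/-- Linearity of expectation. No independence is required, because the second program starts in the
same state for every hash function. -/
theorem Env.wp.seq (h : E.wp p s U mid) (hq : ∀ s', mid s' → E.wp q s' V post) :
    E.wp (.seq p q) s (U + V) post := by
  obtain ⟨s1, ⟨t1, h1, h2⟩, h3⟩ := h
  obtain ⟨s2, ⟨t2, h4, h5⟩, h6⟩ := hq s1 h3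
  refine ⟨s2, ⟨fun h => t1 h + t2 h, fun h => .seq (h1 h) (h4 h), ?_⟩, h6⟩
  rw [expectedTime_add]; push_cast; linarith

theorem Env.wp.step (H : E.Ok e R) {f : HashFun E.G E.m → ℕ} {s' : State} (c : ℕ)
    (hf : expectedTime E.G E.m f ≤ U)
    (h : ∀ h, Exec (buildIndex E.G E.name E.T h) E.w p s s' (c + f h)) (hp : post s')
    (hV : c + U ≤ V) : E.wp p s V post := by
  have : NeZero E.m := ⟨H.table⟩
  refine ⟨s', ⟨_, h, ?_⟩, hp⟩
  rw [expectedTime_add, expectedTime_const]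
  have : ((c + U : ℕ) : ℝ) ≤ V := by exact_mod_cast hV
  push_cast at this
  linarith

theorem Env.Ok.condTrue (H : E.Ok e R) {f : Expr} (hf : f.eval E.w s ≠ 0) (h : E.wp p s U post)
    (hV : U + f.cost + 1 ≤ V) : E.wp (.cond f p q) s V post := by
  obtain ⟨s1, ⟨t1, h1, h2⟩, h3⟩ := h
  refine Env.wp.step H (f.cost + 1) h2 (fun h => ?_) h3 (by omega)
  have := Exec.condTrue (q := q) hf (h1 h)
  rwa [show f.cost + t1 h + 1 = f.cost + 1 + t1 h by omega] at this

theorem Env.Ok.condFalse (H : E.Ok e R) {f : Expr} (hf : f.eval E.w s = 0) (h : E.wp q s U post)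
    (hV : U + f.cost + 1 ≤ V) : E.wp (.cond f p q) s V post := by
  obtain ⟨s1, ⟨t1, h1, h2⟩, h3⟩ := h
  refine Env.wp.step H (f.cost + 1) h2 (fun h => ?_) h3 (by omega)
  have := Exec.condFalse (p := p) hf (h1 h)
  rwa [show f.cost + t1 h + 1 = f.cost + 1 + t1 h by omega] at this

/-- Loops with a bound `B` on the costs in terms of a decreasing number. -/
theorem Env.Ok.loop (H : E.Ok e R) {f : Expr} (B : ℕ → ℕ) (Inv : ℕ → State → Prop)
    (hstep : ∀ i s, Inv i s → (f.eval E.w s = 0 ∧ f.cost + 1 ≤ B i ∧ post s) ∨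
      (f.eval E.w s ≠ 0 ∧ ∃ j < i, ∃ V, E.wp p s V (Inv j) ∧ V + f.cost + 1 + B j ≤ B i)) :
    ∀ i s, Inv i s → E.wp (.loop f p) s (B i) post := by
  intro i
  induction i using Nat.strong_induction_on with
  | _ i ih =>
    intro s hs
    rcases hstep i s hs with ⟨h0, h1, h2⟩ | ⟨h0, j, hj, V, ⟨s1, ⟨t1, h1, h2⟩, h3⟩, hV⟩
    · exact H.of_const _ (fun _ => .loopFalse h0) h1 h2
    · obtain ⟨s2, ⟨t2, h4, h5⟩, h6⟩ := ih j hj s1 h3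
      refine Env.wp.step H (f.cost + 1) (f := fun h => t1 h + t2 h) (U := V + B j) ?_
        (fun h => ?_) h6 (by omega)
      · rw [expectedTime_add]; push_cast; linarith
      · have := Exec.loopTrue h0 (h1 h) (h4 h)
        rwa [show f.cost + t1 h + t2 h + 1 = f.cost + 1 + (t1 h + t2 h) by omega] at this

/-- Loops with `N` rounds of cost `V`. -/
theorem Env.Ok.loopFor (H : E.Ok e R) {f : Expr} (N V : ℕ) (Inv : ℕ → State → Prop)
    (hstep : ∀ i s, i < N → Inv i s → f.eval E.w s ≠ 0 ∧ E.wp p s V (Inv (i + 1)))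
    (hend : ∀ s, Inv N s → f.eval E.w s = 0) (h0 : Inv 0 s)
    (hU : N * (V + f.cost + 1) + f.cost + 1 ≤ U) :
    E.wp (.loop f p) s U (Inv N) := by
  have key := H.loop (f := f) (p := p) (post := Inv N)
    (fun i => i * (V + f.cost + 1) + f.cost + 1) (fun i s => i ≤ N ∧ Inv (N - i) s) (by
      rintro i s ⟨hi, hs⟩
      rcases Nat.eq_zero_or_pos i with rfl | hpos
      · left; exact ⟨hend s hs, by omega, hs⟩
      · right
        obtain ⟨g1, g2⟩ := hstep (N - i) s (by omega) hs
        refine ⟨g1, i - 1, by omega, V, g2.mono le_rfl fun s' h' => ⟨by omega, ?_⟩, ?_⟩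
        · rwa [show N - (i - 1) = N - i + 1 by omega]
        · obtain ⟨j, rfl⟩ : ∃ j, i = j + 1 := ⟨i - 1, by omega⟩
          simp only [Nat.add_sub_cancel, Nat.add_mul]; omega) N s ⟨le_rfl, by simpa using h0⟩
  exact key.mono hU fun _ h => h

end Wp

/-! ## Evaluation of expressions -/

section Eval

variable {w a b : ℕ} {s : State} {e f : Expr} {P Q : Prop}

theorem State.setReg_reg (s : State) (x v y : ℕ) :
    (s.setReg x v).reg y = if y = x then v else s.reg y := by
  simp [State.setReg, Function.update_apply]

theorem State.setReg_mem (s : State) (x v : ℕ) : (s.setReg x v).mem = s.mem := rfl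

theorem State.setMem_reg (s : State) (x v : ℕ) : (s.setMem x v).reg = s.reg := rfl

theorem State.setMem_mem (s : State) (x v y : ℕ) :
    (s.setMem x v).mem y = if y = x then v else s.mem y := by
  simp [State.setMem, Function.update_apply]

theorem Expr.eval_reg (x : ℕ) : (Expr.reg x).eval w s = s.reg x := rfl

theorem Expr.eval_load (h : e.eval w s = a) : (Expr.load e).eval w s = s.mem a := by
  rw [Expr.eval, h]

theorem Expr.eval_lit (h : a < 2 ^ w) : (Expr.lit a).eval w s = a := Nat.mod_eq_of_lt h

theorem Expr.eval_plus (he : e.eval w s = a) (hf : f.eval w s = b) (h : a + b < 2 ^ w) :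
    (Expr.bin .plus e f).eval w s = a + b := by
  rw [Expr.eval, he, hf]; exact Nat.mod_eq_of_lt h

theorem Expr.eval_minus (he : e.eval w s = a) (hf : f.eval w s = b) (h : a < 2 ^ w) :
    (Expr.bin .minus e f).eval w s = a - b := by
  rw [Expr.eval, he, hf]; exact Nat.mod_eq_of_lt (lt_of_le_of_lt (Nat.sub_le _ _) h)

theorem Expr.eval_times (he : e.eval w s = a) (hf : f.eval w s = b) (h : a * b < 2 ^ w) :
    (Expr.bin .times e f).eval w s = a * b := by
  rw [Expr.eval, he, hf]; exact Nat.mod_eq_of_lt h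

theorem Expr.eval_quot (he : e.eval w s = a) (hf : f.eval w s = b) (h : a < 2 ^ w) :
    (Expr.bin .quot e f).eval w s = a / b := by
  rw [Expr.eval, he, hf]; exact Nat.mod_eq_of_lt (lt_of_le_of_lt (Nat.div_le_self _ _) h)

theorem Expr.eval_rem (he : e.eval w s = a) (hf : f.eval w s = b) (h : a < 2 ^ w) :
    (Expr.bin .rem e f).eval w s = a % b := by
  rw [Expr.eval, he, hf]; exact Nat.mod_eq_of_lt (lt_of_le_of_lt (Nat.mod_le _ _) h)

/-- The value of `e` is the truth value of `P`. -/
def Expr.Tests (w : ℕ) (s : State) (e : Expr) (P : Prop) : Prop :=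
  (P → e.eval w s = 1) ∧ (¬ P → e.eval w s = 0)

theorem Expr.Tests.ne_zero_iff (h : e.Tests w s P) : e.eval w s ≠ 0 ↔ P := by
  by_cases hP : P
  · simp [h.1 hP, hP]
  · simp [h.2 hP, hP]

theorem Expr.Tests.eq_zero_iff (h : e.Tests w s P) : e.eval w s = 0 ↔ ¬ P := by
  by_cases hP : P
  · simp [h.1 hP, hP]
  · simp [h.2 hP, hP]

theorem Expr.Tests.eval_eq [Decidable P] (h : e.Tests w s P) :
    e.eval w s = if P then 1 else 0 := by
  split_ifs with hP
  · exact h.1 hP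
  · exact h.2 hP

theorem Expr.Tests.congr (h : e.Tests w s P) (hPQ : P ↔ Q) : e.Tests w s Q :=
  ⟨fun hQ => h.1 (hPQ.2 hQ), fun hQ => h.2 fun hP => hQ (hPQ.1 hP)⟩

theorem Expr.tests_less (hw : 1 < 2 ^ w) (he : e.eval w s = a) (hf : f.eval w s = b) :
    (Expr.bin .less e f).Tests w s (a < b) := by
  constructor <;> intro h <;> simp only [Expr.eval, BinOp.apply, he, hf, h, if_true, if_false]
  · exact Nat.mod_eq_of_lt hw
  · exact Nat.zero_mod _

theorem Expr.tests_equal (hw : 1 < 2 ^ w) (he : e.eval w s = a) (hf : f.eval w s = b) :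
    (Expr.bin .equal e f).Tests w s (a = b) := by
  constructor <;> intro h <;> simp only [Expr.eval, BinOp.apply, he, hf, h, if_true, if_false]
  · exact Nat.mod_eq_of_lt hw
  · exact Nat.zero_mod _

theorem Expr.Tests.and (hw : 1 < 2 ^ w) (he : e.Tests w s P) (hf : f.Tests w s Q) :
    (Expr.bin .times e f).Tests w s (P ∧ Q) := by
  classical
  constructor
  · rintro ⟨h1, h2⟩
    rw [Expr.eval, he.1 h1, hf.1 h2]; exact Nat.mod_eq_of_lt hw
  · intro h
    rw [Expr.eval]
    rcases not_and_or.1 h with h | h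
    · rw [he.2 h]; simp [BinOp.apply]
    · rw [hf.2 h]; simp [BinOp.apply]

/-- Negation of a truth value. -/
def Expr.neg (e : Expr) : Expr := .bin .equal e (.lit 0)

theorem Expr.Tests.neg (hw : 1 < 2 ^ w) (he : e.Tests w s P) : e.neg.Tests w s (¬ P) := by
  have := Expr.tests_equal (e := e) (f := .lit 0) hw rfl (Expr.eval_lit (s := s) (a := 0) (by omega))
  exact this.congr he.eq_zero_iff

/-- Disjunction of truth values. -/
def Expr.or (e f : Expr) : Expr := .neg (.bin .times e.neg f.neg)

theorem Expr.Tests.or (hw : 1 < 2 ^ w) (he : e.Tests w s P) (hf : f.Tests w s Q) :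
    (Expr.or e f).Tests w s (P ∨ Q) :=
  (((he.neg hw).and hw (hf.neg hw)).neg hw).congr (by tauto)

end Eval

/-! ## Block boundaries -/

/-- Every round looks one symbol to the left, so `i` rounds depend on the symbol and its `i`
predecessors. -/
theorem reduced_congr {X Y : ℕ → ℕ} : ∀ (i a b : ℕ), (∀ t ≤ i, X (a + t) = Y (b + t)) →
    reduced X i (a + i) = reduced Y i (b + i)
  | 0, a, b, h => h 0 le_rfl
  | i + 1, a, b, h => by
    have h1 := reduced_congr i a b (fun t ht => h t (by omega))
    have h2 := reduced_congr i (a + 1) (b + 1) (fun t ht => by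
      have := h (t + 1) (by omega)
      rwa [show a + 1 + t = a + (t + 1) by omega, show b + 1 + t = b + (t + 1) by omega])
    rw [show a + 1 + i = a + (i + 1) by omega, show b + 1 + i = b + (i + 1) by omega] at h2
    rw [reduced, reduced, h2, show a + (i + 1) - 1 = a + i by omega,
      show b + (i + 1) - 1 = b + i by omega, h1]

theorem eliminate_congr {X Y : ℕ → ℕ} (c : ℕ) {a b : ℕ} (h0 : X a = Y b)
    (h1 : X (a + 1) = Y (b + 1)) (h2 : X (a + 2) = Y (b + 2)) :
    eliminate c X (a + 1) = eliminate c Y (b + 1) := by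
  simp only [eliminate, Nat.add_sub_cancel, h0, h1, h2]

/-- Each of the three eliminations widens the window by one on both sides, in addition to the `k`
symbols on the left used by the rounds. -/
theorem finalLabel_congr {X Y : ℕ → ℕ} (k a b : ℕ) (h : ∀ t ≤ k + 6, X (a + t) = Y (b + t)) :
    finalLabel k X (a + k + 3) = finalLabel k Y (b + k + 3) := by
  have h0 : ∀ t ≤ 6, reduced X k (a + k + t) = reduced Y k (b + k + t) := by
    intro t ht
    have := reduced_congr (X := X) (Y := Y) k (a + t) (b + t) (fun u hu => by
      have := h (t + u) (by omega)
      rwa [← Nat.add_assoc, ← Nat.add_assoc] at this)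
    rwa [show a + t + k = a + k + t by omega, show b + t + k = b + k + t by omega] at this
  have h1 : ∀ t ≤ 4, eliminate 5 (reduced X k) (a + k + t + 1)
      = eliminate 5 (reduced Y k) (b + k + t + 1) := fun t ht =>
    eliminate_congr 5 (h0 t (by omega)) (h0 (t + 1) (by omega)) (h0 (t + 2) (by omega))
  have h2 : ∀ t ≤ 2, eliminate 4 (eliminate 5 (reduced X k)) (a + k + t + 1 + 1)
      = eliminate 4 (eliminate 5 (reduced Y k)) (b + k + t + 1 + 1) := fun t ht =>
    eliminate_congr 4 (h1 t (by omega)) (h1 (t + 1) (by omega)) (h1 (t + 2) (by omega))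
  exact eliminate_congr 3 (h2 0 (by omega)) (h2 1 (by omega)) (h2 2 (by omega))

/-- The landmark test inspects labels at distance at most two. The resulting window of `k + 11`
symbols is the one that the bounds in `IsCut` keep inside the piece. -/
theorem isLandmark_congr {X Y : ℕ → ℕ} (k a b : ℕ) (h : ∀ t ≤ k + 10, X (a + t) = Y (b + t)) :
    IsLandmark (finalLabel k X) (a + k + 5) ↔ IsLandmark (finalLabel k Y) (b + k + 5) := by
  have h0 : ∀ t ≤ 4, finalLabel k X (a + k + 3 + t) = finalLabel k Y (b + k + 3 + t) := by
    intro t ht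
    have := finalLabel_congr (X := X) (Y := Y) k (a + t) (b + t) (fun u hu => by
      have := h (t + u) (by omega)
      rwa [← Nat.add_assoc, ← Nat.add_assoc] at this)
    rwa [show a + t + k + 3 = a + k + 3 + t by omega,
      show b + t + k + 3 = b + k + 3 + t by omega] at this
  have e0 := h0 0 (by omega)
  have e1 := h0 1 (by omega)
  have e2 := h0 2 (by omega)
  have e3 := h0 3 (by omega)
  have e4 := h0 4 (by omega)
  simp only [IsLandmark, IsLocalMax, IsLocalMin]
  simp only [show ∀ c, c + k + 5 - 1 = c + k + 3 + 1 by omega,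
    show ∀ c, c + k + 5 + 1 = c + k + 3 + 3 by omega, show ∀ c, c + k + 5 = c + k + 3 + 2 by omega,
    show ∀ c, c + k + 3 + 1 - 1 = c + k + 3 + 0 by omega,
    show ∀ c, c + k + 3 + 3 - 1 = c + k + 3 + 2 by omega,
    show ∀ c, c + k + 3 + 3 + 1 = c + k + 3 + 4 by omega, e0, e1, e2, e3, e4]

/-- Two neighbours cannot both be maxima or both be minima, and a minimum next to a maximum is not a
landmark. -/
theorem IsLandmark.not_succ {y : ℕ → ℕ} {j : ℕ} (h : IsLandmark y j) :
    ¬ IsLandmark y (j + 1) := by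
  simp only [IsLandmark, IsLocalMax, IsLocalMin, Nat.add_sub_cancel] at *
  omega

section Boundaries

variable (k : ℕ) (X : ℕ → ℕ) (N : ℕ)

/-- Position `j` of the string `X 0, …, X (N - 1)` does not belong to a repetition. -/
def Solo (j : ℕ) : Prop :=
  j < N ∧ (j = 0 ∨ X (j - 1) ≠ X j) ∧ (j + 1 = N ∨ X j ≠ X (j + 1))

/-- A piece (after the attachment of pieces of length one) starts at the inner position `q`. -/
def PieceStart (q : ℕ) : Prop :=
  2 ≤ q ∧ q + 1 < N ∧ X (q - 1) ≠ X q ∧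
    (X q = X (q + 1) ∨ (X (q - 2) = X (q - 1) ∧ (q + 2 = N ∨ X (q + 1) ≠ X (q + 2))))

/-- A block in a piece of type 2 starts at the cut `q`. -/
def CutAt (q : ℕ) : Prop :=
  ∃ s e, s + k + 4 ≤ q ∧ q + 7 ≤ e ∧ s + 2 * k < e ∧ (∀ j, s ≤ j → j < e → Solo X N j) ∧
    IsLandmark (finalLabel k X) (q + 1)

/-- The positive positions from which the parsing starts anew. -/
def Hard (q : ℕ) : Prop := q = N ∨ PieceStart X N q ∨ CutAt k X N q

variable {k X N}

theorem Hard.two_le {q : ℕ} (h : Hard k X N q) (hN : 2 ≤ N) : 2 ≤ q := by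
  rcases h with h | h | ⟨s, e, h, -⟩
  · omega
  · exact h.1
  · omega

theorem Hard.le {q : ℕ} (h : Hard k X N q) : q ≤ N := by
  rcases h with h | h | ⟨s, e, h1, h2, -, h3, -⟩
  · omega
  · have := h.2.1; omega
  · have := (h3 q (by omega) (by omega)).1; omega

/-- This spacing makes the greedy choice of blocks work, since no piece of length one is left over.
A start of a piece touches a repetition, whereas a cut lies well inside a repetition-free window, so
the two kinds cannot be adjacent. Adjacent starts are excluded by the attachment of single symbols,
and adjacent cuts because landmarks are not adjacent. -/
theorem Hard.not_succ {q : ℕ} (h : Hard k X N q) : ¬ Hard k X N (q + 1) := by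
  intro h'
  rcases h with h | ⟨a1, a2, a3, a4⟩ | ⟨s, e, h1, h2, -, h3, h4⟩
  · have := h'.le; omega
  · rcases h' with h' | ⟨b1, b2, b3, b4⟩ | ⟨s, e, h1, h2, -, h3, h4⟩
    · omega
    · simp only [Nat.add_sub_cancel, show q + 1 - 2 = q - 1 by omega,
        show q + 1 + 1 = q + 2 by omega] at b3 b4
      rcases a4 with a4 | ⟨a4, a5⟩
      · exact b3 a4
      · rcases b4 with b4 | b4
        · rcases a5 with a5 | a5
          · omega
          · exact a5 b4
        · exact a3 b4.1
    · have s1 := h3 q (by omega) (by omega)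
      have s2 := h3 (q - 1) (by omega) (by omega)
      rcases a4 with a4 | ⟨a4, -⟩
      · rcases s1.2.2 with h | h
        · omega
        · exact h a4
      · rcases s2.2.1 with h | h
        · omega
        · exact h a4
  · rcases h' with h' | ⟨b1, b2, b3, b4⟩ | ⟨s', e', -, -, -, -, h4'⟩
    · have := (h3 (q + 6) (by omega) (by omega)).1; omega
    · rcases b4 with b4 | ⟨b4, -⟩
      · rcases (h3 (q + 1) (by omega) (by omega)).2.2 with h | h
        · omega
        · exact h b4
      · rcases (h3 q (by omega) (by omega)).2.1 with h | h
        · omega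
        · exact h b4
    · exact h4.not_succ h4'

end Boundaries

open Classical in
/-- The block lengths between the positions `i` and `e`, if the parsing starts anew at the positions
with `F`. -/
noncomputable def blocksFrom (F : ℕ → Prop) (i e : ℕ) : List ℕ :=
  if i < e then
    if ¬ F (i + 2) ∧ F (i + 3) then 3 :: blocksFrom F (i + 3) e else 2 :: blocksFrom F (i + 2) e
  else []
termination_by e - i

section BlocksFrom

variable {F : ℕ → Prop}

theorem blocksFrom_of_le {i e : ℕ} (h : e ≤ i) : blocksFrom F i e = [] := by
  rw [blocksFrom, if_neg (by omega)]

theorem blocksFrom_triple {i e : ℕ} (h : i < e) (h2 : ¬ F (i + 2)) (h3 : F (i + 3)) :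
    blocksFrom F i e = 3 :: blocksFrom F (i + 3) e := by
  rw [blocksFrom, if_pos h, if_pos ⟨h2, h3⟩]

theorem blocksFrom_pair {i e : ℕ} (h : i < e) (h2 : F (i + 2) ∨ ¬ F (i + 3)) :
    blocksFrom F i e = 2 :: blocksFrom F (i + 2) e := by
  rw [blocksFrom, if_pos h, if_neg (by tauto)]

/-- Induction along the blocks between `i` and a position `e` with `F`. -/
theorem blocks_induction (hF : ∀ q, F q → ¬ F (q + 1)) {e : ℕ} (he : F e) {P : ℕ → Prop}
    (hend : P e)
    (hpair : ∀ i, ¬ F (i + 1) → i + 2 ≤ e → (F (i + 2) ∨ ¬ F (i + 3)) → P (i + 2) → P i)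
    (htriple : ∀ i, i + 3 ≤ e → ¬ F (i + 1) → ¬ F (i + 2) → F (i + 3) → P (i + 3) → P i) :
    ∀ i, i ≤ e → ¬ F (i + 1) → P i := by
  suffices H : ∀ d i, i + d = e → ¬ F (i + 1) → P i by
    intro i hi h1
    exact H (e - i) i (by omega) h1
  intro d
  induction d using Nat.strong_induction_on with
  | _ d ih =>
    intro i hi h1
    rcases Nat.eq_zero_or_pos d with rfl | hd
    · rw [show i = e by omega]; exact hend
    have hd1 : d ≠ 1 := by rintro rfl; rw [hi] at h1; exact h1 he
    by_cases h2 : F (i + 2)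
    · refine hpair i h1 (by omega) (Or.inl h2) (ih (d - 2) (by omega) (i + 2) (by omega) (hF _ h2))
    · by_cases h3 : F (i + 3)
      · have hd2 : d ≠ 2 := by rintro rfl; rw [hi] at h2; exact h2 he
        exact htriple i (by omega) h1 h2 h3
          (ih (d - 3) (by omega) (i + 3) (by omega) (hF _ h3))
      · exact hpair i h1 (by omega) (Or.inr h3) (ih (d - 2) (by omega) (i + 2) (by omega) h3)

/-- No position with `F` is jumped over: a pair from `i` could only skip `i + 1`, which the
invariant excludes, and a triple is chosen only if `i + 2` is not such a position. -/
theorem blocksFrom_append (hF : ∀ q, F q → ¬ F (q + 1)) {c e : ℕ} (hc : F c) (hce : c ≤ e) :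
    ∀ i, i ≤ c → ¬ F (i + 1) → blocksFrom F i e = blocksFrom F i c ++ blocksFrom F c e := by
  refine blocks_induction hF hc ?_ ?_ ?_
  · rw [blocksFrom_of_le (le_refl c)]; rfl
  · intro i _ hi h ih
    rw [blocksFrom_pair (by omega) h, blocksFrom_pair (e := c) (by omega) h, ih]; rfl
  · intro i hi _ h2 h3 ih
    rw [blocksFrom_triple (by omega) h2 h3, blocksFrom_triple (e := c) (by omega) h2 h3, ih]; rfl

theorem sum_blocksFrom (hF : ∀ q, F q → ¬ F (q + 1)) {e : ℕ} (he : F e) :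
    ∀ i, i ≤ e → ¬ F (i + 1) → i + (blocksFrom F i e).sum = e := by
  refine blocks_induction hF he ?_ ?_ ?_
  · rw [blocksFrom_of_le (le_refl e)]; rfl
  · intro i _ hi h ih
    rw [blocksFrom_pair (by omega) h, List.sum_cons]; omega
  · intro i hi _ h2 h3 ih
    rw [blocksFrom_triple (by omega) h2 h3, List.sum_cons]; omega

/-- The blocks between `i` and `e` are determined by the starts of the parsing between them. -/
theorem blocksFrom_congr {F' : ℕ → Prop} (hF : ∀ q, F q → ¬ F (q + 1)) {e : ℕ} (he : F e)
    (u : ℕ) (i₀ : ℕ) (h : ∀ q, i₀ < q → q ≤ e → (F q ↔ F' (u + q))) :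
    ∀ i, i ≤ e → ¬ F (i + 1) → i₀ ≤ i → blocksFrom F' (u + i) (u + e) = blocksFrom F i e := by
  refine blocks_induction hF he ?_ ?_ ?_
  · intro _; rw [blocksFrom_of_le (le_refl _), blocksFrom_of_le (le_refl _)]
  · intro i _ hi h2 ih h0
    rw [blocksFrom_pair (i := i) (by omega) h2, blocksFrom_pair (i := u + i) (by omega),
      Nat.add_assoc, ih (by omega)]
    rcases h2 with h2 | h2
    · left; exact (h _ (by omega) (by omega)).1 h2
    · by_cases h4 : i + 2 = e
      · left; rw [Nat.add_assoc]; exact (h _ (by omega) (by omega)).1 (h4 ▸ he)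
      · right; rw [Nat.add_assoc, ← h _ (by omega) (by omega)]; exact h2
  · intro i hi _ h2 h3 ih h0
    rw [blocksFrom_triple (i := i) (by omega) h2 h3, blocksFrom_triple (i := u + i) (by omega),
      Nat.add_assoc, ih (by omega)]
    · rw [Nat.add_assoc, ← h _ (by omega) (by omega)]; exact h2
    · rw [Nat.add_assoc, ← h _ (by omega) (by omega)]; exact h3

/-- Without a start in between, the greedy rule takes pairs until the end is exactly three positions
away. -/
theorem blocksFrom_eq_leftAligned (hF : ∀ q, F q → ¬ F (q + 1)) {e : ℕ} (he : F e) (i₀ : ℕ)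
    (h : ∀ q, i₀ < q → q < e → ¬ F q) : ∀ i, i ≤ e → ¬ F (i + 1) → i₀ ≤ i →
    blocksFrom F i e = leftAligned (e - i) := by
  refine blocks_induction hF he ?_ ?_ ?_
  · intro _; rw [blocksFrom_of_le (le_refl _), Nat.sub_self]; rfl
  · intro i h1 hi h2 ih h0
    rw [blocksFrom_pair (by omega) h2, ih (by omega)]
    obtain ⟨d, hd⟩ : ∃ d, e = i + 2 + d := ⟨e - (i + 2), by omega⟩
    subst hd
    rw [show i + 2 + d - (i + 2) = d by omega, show i + 2 + d - i = d + 2 by omega]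
    -- For `d = 1` the end would be at `i + 3`, and a triple would have been taken instead of a
    -- pair.
    match d with
    | 0 => rfl
    | 1 =>
      exfalso
      rcases h2 with h2 | h2
      · exact h _ (by omega) (by omega) h2
      · exact h2 he
    | d + 2 => rfl
  · intro i hi _ h2 h3 ih h0
    have : i + 3 = e := by
      by_contra hne
      exact h (i + 3) (by omega) (by omega) h3
    subst this
    rw [blocksFrom_triple (by omega) h2 h3, blocksFrom_of_le (le_refl _),
      show i + 3 - i = 3 by omega]
    rfl

theorem blocksFrom_eq_parseGaps (hF : ∀ q, F q → ¬ F (q + 1)) {e : ℕ} (he : F e) :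
    ∀ (cuts : List ℕ) (i : ℕ), i ≤ e → ¬ F (i + 1) → (i :: cuts).Pairwise (· < ·) →
    (∀ q, q ∈ cuts ↔ i < q ∧ q < e ∧ F q) → blocksFrom F i e = parseGaps i cuts e
  | [], i, hi, h1, _, hmem => by
    rw [parseGaps]
    exact blocksFrom_eq_leftAligned hF he i (fun q h2 h3 h4 => by
      simpa using (hmem q).2 ⟨h2, h3, h4⟩) i hi h1 le_rfl
  | c :: cs, i, hi, h1, hp, hmem => by
    have hc := (hmem c).1 (by simp)
    rw [parseGaps, blocksFrom_append hF hc.2.2 hc.2.1.le i hc.1.le h1]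
    rw [List.pairwise_cons, List.pairwise_cons] at hp
    congr 1
    · refine blocksFrom_eq_leftAligned hF hc.2.2 i (fun q h2 h3 h4 => ?_) i hc.1.le h1 le_rfl
      have := (hmem q).2 ⟨h2, by omega, h4⟩
      rcases List.mem_cons.1 this with h | h
      · omega
      · have := hp.2.1 q h; omega
    · refine blocksFrom_eq_parseGaps hF he cs c hc.2.1.le (hF _ hc.2.2)
        (List.pairwise_cons.2 hp.2) (fun q => ⟨fun hq => ?_, fun hq => ?_⟩)
      · have h2 := (hmem q).1 (by simp [hq])
        exact ⟨hp.2.1 q hq, h2.2⟩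
      · have := (hmem q).2 ⟨by omega, hq.2⟩
        rcases List.mem_cons.1 this with h | h
        · omega
        · exact h

theorem parseGaps_add (o : ℕ) : ∀ (cuts : List ℕ) (s e : ℕ),
    parseGaps (o + s) (cuts.map (o + ·)) (o + e) = parseGaps s cuts e
  | [], s, e => by simp only [List.map_nil, parseGaps]; congr 1; omega
  | c :: cs, s, e => by
    simp only [List.map_cons, parseGaps, parseGaps_add o cs]
    congr 2; omega

end BlocksFrom

/-! ## The blocks of a level in terms of block boundaries -/

theorem hard_spacing (k : ℕ) (X : ℕ → ℕ) (N : ℕ) : ∀ q, Hard k X N q → ¬ Hard k X N (q + 1) :=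
  fun _ => Hard.not_succ

/-- A piece without inner starts of pieces and blocks: a repetition to which symbols may be
attached. -/
def RepLike (X : ℕ → ℕ) (o l : ℕ) : Prop :=
  2 ≤ l ∧ X (o + l - 2) = X (o + l - 1) ∧ ∀ q, o < q → q < o + l → X (q - 1) = X q ∨ q = 1

def ChainAt (X : ℕ → ℕ) (o l : ℕ) : Prop := ∀ q, o < q → q < o + l → X (q - 1) ≠ X q

/-- The pieces `ms` form the string `X o, …, X (N - 1)`. -/
def Laid (X : ℕ → ℕ) (N : ℕ) : ℕ → List (List ℕ) → Prop
  | o, [] => o = N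
  | o, m :: ms => (∀ i < m.length, X (o + i) = m.getD i 0) ∧ 1 ≤ m.length ∧
      (RepLike X o m.length ∨ ChainAt X o m.length) ∧
      (ms ≠ [] → X (o + m.length - 1) ≠ X (o + m.length)) ∧
      (∀ m' ∈ ms.head?, RepLike X o m.length ∨ RepLike X (o + m.length) m'.length) ∧
      Laid X N (o + m.length) ms

section Laid

variable {k : ℕ} {X : ℕ → ℕ} {N : ℕ}

theorem Laid.le {ms : List (List ℕ)} : ∀ {o : ℕ}, Laid X N o ms → o ≤ N := by
  induction ms with
  | nil => intro o h; exact le_of_eq h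
  | cons m ms ih => intro o h; have := ih h.2.2.2.2.2; omega

theorem RepLike.eq_succ {o l : ℕ} (h : RepLike X o l) (ho : 1 ≤ o) : X o = X (o + 1) := by
  rcases h.2.2 (o + 1) (by omega) (by have := h.1; omega) with h | h
  · simpa using h
  · omega

theorem RepLike.not_hard {o l : ℕ} (h : RepLike X o l) (hN : o + l ≤ N) {q : ℕ} (h1 : o < q)
    (h2 : q < o + l) : ¬ Hard k X N q := by
  rintro (h3 | h3 | ⟨s, e, h3, h4, -, h5, -⟩)
  · omega
  · rcases h.2.2 q h1 h2 with h4 | h4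
    · exact h3.2.2.1 h4
    · have := h3.1; omega
  · rcases h.2.2 q h1 h2 with h6 | h6
    · rcases (h5 q (by omega) (by omega)).2.1 with h7 | h7
      · omega
      · exact h7 h6
    · omega

theorem RepLike.not_solo {o l : ℕ} (h : RepLike X o l) (h1 : 1 ≤ o) (hN : o + l ≤ N) :
    ¬ Solo X N o := by
  rintro ⟨a1, a2, a3⟩
  have := h.eq_succ h1
  have := h.1
  rcases a3 with a3 | a3
  · omega
  · exact a3 ‹_›

/-- The positions at which a piece follows another piece. -/
theorem hard_of_repLike {o l : ℕ} (h2 : 2 ≤ o) (hne : X (o - 1) ≠ X o)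
    (h : RepLike X o l) (hN : o + l ≤ N) : Hard k X N o :=
  Or.inr (Or.inl ⟨h2, by have := h.1; omega, hne, Or.inl (h.eq_succ (by omega))⟩)

/-- The condition on the piece in front of a piece that starts at `o`. -/
def Fresh (X : ℕ → ℕ) (o : ℕ) (m : List ℕ) : Prop :=
  o = 0 ∨ (2 ≤ o ∧ X (o - 1) ≠ X o ∧ (RepLike X o m.length ∨ X (o - 2) = X (o - 1)))

theorem RepLike.not_isChain {o : ℕ} {m : List ℕ} (hm : ∀ i < m.length, X (o + i) = m.getD i 0)
    (h : RepLike X o m.length) : ¬ m.IsChain (· ≠ ·) := by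
  intro hc
  rw [List.isChain_iff_getElem] at hc
  have h1 := h.1
  have := hc (m.length - 2) (by omega)
  apply this
  have e1 := hm (m.length - 2) (by omega)
  have e2 := hm (m.length - 1) (by omega)
  have e3 := h.2.1
  rw [show o + (m.length - 2) = o + m.length - 2 by omega] at e1
  rw [show o + (m.length - 1) = o + m.length - 1 by omega] at e2
  rw [e1, e2] at e3
  rw [List.getD_eq_getElem _ _ (by omega), List.getD_eq_getElem _ _ (by omega)] at e3
  rw [e3]
  congr 1; omega

theorem ChainAt.isChain {o : ℕ} {m : List ℕ} (hm : ∀ i < m.length, X (o + i) = m.getD i 0)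
    (h : ChainAt X o m.length) : m.IsChain (· ≠ ·) := by
  rw [List.isChain_iff_getElem]
  intro i hi
  have := h (o + i + 1) (by omega) (by omega)
  rw [Nat.add_sub_cancel, Nat.add_assoc, hm i (by omega), hm (i + 1) hi,
    List.getD_eq_getElem _ _ (by omega), List.getD_eq_getElem _ _ (by omega)] at this
  exact this

theorem blocksFrom_repLike (hN : 2 ≤ N) {o : ℕ} {m : List ℕ}
    (hm : ∀ i < m.length, X (o + i) = m.getD i 0) (h : RepLike X o m.length)
    (ho : o = 0 ∨ Hard k X N o) (he : Hard k X N (o + m.length)) :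
    blocksFrom (Hard k X N) o N = pieceBlocks k m ++ blocksFrom (Hard k X N) (o + m.length) N := by
  have h1 : ¬ Hard k X N (o + 1) := by
    rcases ho with rfl | ho
    · intro h; have := h.two_le hN; omega
    · exact ho.not_succ
  rw [blocksFrom_append (hard_spacing k X N) he he.le o (by omega) h1, pieceBlocks,
    if_neg (fun hc => h.not_isChain hm hc.1),
    blocksFrom_eq_leftAligned (hard_spacing k X N) he o
      (fun q h2 h3 => h.not_hard he.le h2 h3) o (by omega) h1 le_rfl]
  congr 2; omega

/-- The positions next to the piece are not solo, so every witness window of `CutAt` lies inside the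
piece, and it may be enlarged to the whole piece. The symbols that decide about the landmark then
belong to the piece as well. -/
theorem cutAt_iff {o : ℕ} {m : List ℕ} (hm : ∀ i < m.length, X (o + i) = m.getD i 0)
    (h : ∀ j, o ≤ j → j < o + m.length → Solo X N j)
    (hs : o = 0 ∨ ¬ Solo X N (o - 1)) (he : ¬ Solo X N (o + m.length)) {p : ℕ}
    (hp : p < m.length) : CutAt k X N (o + p) ↔ 2 * k < m.length ∧ IsCut k m p := by
  have hl : k + 4 ≤ p → p + 7 ≤ m.length → (IsLandmark (finalLabel k X) (o + p + 1) ↔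
      IsLandmark (finalLabel k (fun j => m.getD j 0)) (p + 1)) := by
    intro h1 h2
    have := isLandmark_congr (X := X) (Y := fun j => m.getD j 0) k (o + (p - k - 4)) (p - k - 4)
      (fun t ht => by
        have := hm (p - k - 4 + t) (by omega)
        rwa [← Nat.add_assoc] at this)
    rwa [show o + (p - k - 4) + k + 5 = o + p + 1 by omega,
      show p - k - 4 + k + 5 = p + 1 by omega] at this
  constructor
  · rintro ⟨s, e, h1, h2, h3, h4, h5⟩
    have g1 : o ≤ s := by
      by_contra hlt
      rcases hs with hs | hs
      · omega
      · exact hs (h4 (o - 1) (by omega) (by omega))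
    have g2 : e ≤ o + m.length := by
      by_contra hlt
      exact he (h4 (o + m.length) (by omega) (by omega))
    exact ⟨by omega, by omega, by omega, (hl (by omega) (by omega)).1 h5⟩
  · rintro ⟨h1, h2, h3, h4⟩
    exact ⟨o, o + m.length, by omega, by omega, by omega, h, (hl h2 h3).2 h4⟩

/-- All positions of such a piece are solo, so no inner position starts a piece and the only hard
inner positions are cuts. In a piece of type 3 there are none, as every window is too short. -/
theorem blocksFrom_chainAt (hN : 2 ≤ N) {o : ℕ} {m : List ℕ}
    (hm : ∀ i < m.length, X (o + i) = m.getD i 0) (h : ChainAt X o m.length)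
    (h2 : 2 ≤ m.length) (ho : o = 0 ∨ Hard k X N o)
    (hs : o = 0 ∨ (2 ≤ o ∧ X (o - 1) ≠ X o ∧ X (o - 2) = X (o - 1)))
    (he : o + m.length = N ∨ (X (o + m.length - 1) ≠ X (o + m.length) ∧
      ∃ l, RepLike X (o + m.length) l ∧ o + m.length + l ≤ N)) :
    blocksFrom (Hard k X N) o N = pieceBlocks k m ++ blocksFrom (Hard k X N) (o + m.length) N := by
  have hH : Hard k X N (o + m.length) := by
    rcases he with he | ⟨he1, l, he2, he3⟩
    · exact Or.inl he
    · exact hard_of_repLike (by omega) he1 he2 he3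
  have hsolo : ∀ j, o ≤ j → j < o + m.length → Solo X N j := by
    intro j h3 h4
    have := hH.le
    refine ⟨by omega, ?_, ?_⟩
    · rcases Nat.eq_or_lt_of_le h3 with rfl | h3
      · rcases hs with hs | hs
        · left; exact hs
        · right; exact hs.2.1
      · right; exact h j h3 h4
    · by_cases h5 : j + 1 < o + m.length
      · right; exact h (j + 1) (by omega) h5
      · rw [show o + m.length = j + 1 by omega] at he
        rcases he with he | he
        · left; exact he
        · right; exact he.1
  have hs' : o = 0 ∨ ¬ Solo X N (o - 1) := by
    rcases hs with hs | hs
    · exact Or.inl hs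
    · right
      rintro ⟨-, g | g, -⟩
      · omega
      · exact g hs.2.2
  have he' : ¬ Solo X N (o + m.length) := by
    rcases he with he | ⟨he1, l, he2, he3⟩
    · intro h; have := h.1; omega
    · exact he2.not_solo (by omega) he3
  have hcut : ∀ p, p < m.length → (CutAt k X N (o + p) ↔ 2 * k < m.length ∧ IsCut k m p) :=
    fun p hp => cutAt_iff hm hsolo hs' he' hp
  have hhard : ∀ p, 0 < p → p < m.length → (Hard k X N (o + p) ↔ CutAt k X N (o + p)) := by
    intro p h3 h4
    have hle := hH.le
    refine ⟨?_, fun h => Or.inr (Or.inr h)⟩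
    rintro (g | ⟨g1, g2, g3, g4⟩ | g)
    · omega
    · exfalso
      rcases g4 with g4 | ⟨g4, -⟩
      · rcases (hsolo (o + p) (by omega) (by omega)).2.2 with g | g
        · omega
        · exact g g4
      · rcases (hsolo (o + p - 1) (by omega) (by omega)).2.1 with g | g
        · omega
        · exact g g4
    · exact g
  have h1 : ¬ Hard k X N (o + 1) := by
    rcases ho with rfl | ho
    · intro h; have := h.two_le hN; omega
    · exact ho.not_succ
  rw [blocksFrom_append (hard_spacing k X N) hH hH.le o (by omega) h1]
  congr 1
  rw [pieceBlocks]
  split_ifs with hk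
  · rw [typeTwoBlocks, ← parseGaps_add o]
    refine blocksFrom_eq_parseGaps (hard_spacing k X N) hH _ _ (by omega) h1 ?_ ?_
    · rw [List.pairwise_cons]
      constructor
      · intro a ha
        simp only [List.mem_map, List.mem_filter, decide_eq_true_eq] at ha
        obtain ⟨p, ⟨-, h3⟩, rfl⟩ := ha
        have := h3.1; omega
      · rw [List.pairwise_map]
        exact (List.pairwise_lt_range.filter _).imp (fun h => by omega)
    · intro q
      simp only [List.mem_map, List.mem_filter, List.mem_range, decide_eq_true_eq]
      constructor
      · rintro ⟨p, ⟨h3, h4⟩, rfl⟩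
        have := h4.1
        exact ⟨by omega, by omega, (hhard p (by omega) h3).2 ((hcut p h3).2 ⟨hk.2, h4⟩)⟩
      · rintro ⟨h3, h4, h5⟩
        obtain ⟨p, rfl⟩ : ∃ p, q = o + p := ⟨q - o, by omega⟩
        exact ⟨p, ⟨by omega, ((hcut p (by omega)).1 ((hhard p (by omega) (by omega)).1 h5)).2⟩, rfl⟩
  · rw [blocksFrom_eq_leftAligned (hard_spacing k X N) hH o ?_ o (by omega) h1 le_rfl]
    · congr 1; omega
    · intro q h3 h4 h5
      obtain ⟨p, rfl⟩ : ∃ p, q = o + p := ⟨q - o, by omega⟩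
      have := (hcut p (by omega)).1 ((hhard p (by omega) (by omega)).1 h5)
      exact hk ⟨h.isChain hm, this.1⟩

theorem attachLeft_cons_of_length {m m' : List ℕ} {rest : List (List ℕ)} (h : m'.length ≠ 1) :
    attachLeft (m :: m' :: rest) = m :: attachLeft (m' :: rest) := by
  match m', h with
  | [], _ => rfl
  | [_], h => simp at h
  | _ :: _ :: _, _ => rfl

/-- Induction along the pieces; `d` bounds the number of the remaining ones, since an attachment
consumes two at once. Of two neighbouring pieces one is a repetition, so a piece of length one that
follows another piece always follows a repetition. -/
theorem blocksFrom_attachLeft (hN : 2 ≤ N) (d : ℕ) : ∀ (o : ℕ) (m : List ℕ)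
    (rest : List (List ℕ)), rest.length ≤ d → Laid X N o (m :: rest) → (o = 0 ∨ Hard k X N o) →
    Fresh X o m → 2 ≤ m.length →
    blocksFrom (Hard k X N) o N = (attachLeft (m :: rest)).flatMap (pieceBlocks k) := by
  induction d with
  | zero =>
    intro o m rest hd hL ho hf h2
    obtain rfl : rest = [] := List.length_eq_zero_iff.1 (by omega)
    obtain ⟨l1, l2, l3, l4, l5, l6⟩ := hL
    have l6 : o + m.length = N := l6
    have hend : Hard k X N (o + m.length) := Or.inl l6
    have e1 : (attachLeft [m]).flatMap (pieceBlocks k) = pieceBlocks k m ++ [] := by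
      simp [attachLeft]
    rw [e1, ← blocksFrom_of_le (F := Hard k X N) (i := o + m.length) (e := N) (by omega)]
    by_cases hr : RepLike X o m.length
    · exact blocksFrom_repLike hN l1 hr ho hend
    · refine blocksFrom_chainAt hN l1 (l3.resolve_left hr) h2 ho ?_ (Or.inl l6)
      rcases hf with hf | ⟨f1, f2, f3⟩
      · exact Or.inl hf
      · exact Or.inr ⟨f1, f2, f3.resolve_left hr⟩
  | succ d ih =>
    intro o m rest hd hL ho hf h2
    cases rest with
    | nil => exact ih o m [] (by simp) hL ho hf h2
    | cons m' rest' =>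
    obtain ⟨l1, l2, l3, l4, l5, l6⟩ := hL
    have l6' := l6
    obtain ⟨r1, r2, r3, r4, r5, r6⟩ := l6
    have hne := l4 (by simp)
    have hadj := l5 m' (by simp)
    have hle := Laid.le r6
    simp only [List.length_cons] at hd
    by_cases hm' : m'.length = 1
    · -- the next piece is attached
      obtain ⟨b, rfl⟩ := List.length_eq_one_iff.1 hm'
      simp only [List.length_singleton] at *
      have hr : RepLike X o m.length := by
        rcases hadj with h | h
        · exact h
        · have := h.1; omega
      have hb : X (o + m.length) = b := by simpa using r1 0 (by omega)
      have key : ∀ i < (m ++ [b]).length, X (o + i) = (m ++ [b]).getD i 0 := by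
        intro i hi
        simp at hi
        rcases Nat.lt_or_ge i m.length with h | h
        · rw [l1 i h, List.getD_append _ _ _ _ h]
        · obtain rfl : i = m.length := by omega
          rw [List.getD_append_right _ _ _ _ le_rfl, hb]; simp
      have hend : Hard k X N (o + (m ++ [b]).length) := by
        rw [List.length_append, List.length_singleton, ← Nat.add_assoc]
        cases rest' with
        | nil => exact Or.inl r6
        | cons m'' rest'' =>
          have h3 := r5 m'' (by simp)
          have h4 : RepLike X (o + m.length + 1) m''.length := by
            rcases h3 with h3 | h3
            · have := h3.1; omega
            · exact h3
          exact hard_of_repLike (by omega) (by simpa using r4 (by simp)) h4 (by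
            have := Laid.le r6.2.2.2.2.2; omega)
      -- The attached symbol starts no piece: behind it the string ends or a repetition begins, and
      -- the length test in `PieceStart` fails. It is no cut either, because the window of a cut
      -- would contain the end of the repetition.
      have hno : ∀ q, o < q → q < o + (m ++ [b]).length → ¬ Hard k X N q := by
        intro q h3 h4
        rw [List.length_append, List.length_singleton] at h4
        by_cases h5 : q < o + m.length
        · exact hr.not_hard (by omega) h3 h5
        obtain rfl : q = o + m.length := by omega
        rintro (h6 | h6 | ⟨s, e, g1, g2, -, g3, -⟩)
        · omega
        · obtain ⟨g1, g2, g3, g4⟩ := h6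
          cases rest' with
          | nil => have : o + m.length + 1 = N := r6; omega
          | cons m'' rest'' =>
            have h3 := r5 m'' (by simp)
            have h4 : RepLike X (o + m.length + 1) m''.length := by
              rcases h3 with h3 | h3
              · have := h3.1; omega
              · exact h3
            have h5 := r4 (by simp)
            rw [Nat.add_sub_cancel] at h5
            have h6 := h4.eq_succ (by omega)
            have h7 := Laid.le r6.2.2.2.2.2
            have h8 := h4.1
            rcases g4 with g4 | ⟨-, g4 | g4⟩
            · exact h5 g4
            · omega
            · exact g4 h6
        · rcases (g3 (o + m.length - 1) (by omega) (by omega)).2.1 with h | h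
          · omega
          · exact h (by rw [show o + m.length - 1 - 1 = o + m.length - 2 by omega]; exact hr.2.1)
      have h1 : ¬ Hard k X N (o + 1) := by
        rcases ho with rfl | ho
        · intro h; have := h.two_le hN; omega
        · exact ho.not_succ
      have hnc : ¬ (m ++ [b]).IsChain (· ≠ ·) := fun hc =>
        hr.not_isChain l1 (List.IsChain.left_of_append hc)
      have step : blocksFrom (Hard k X N) o N = pieceBlocks k (m ++ [b]) ++
          blocksFrom (Hard k X N) (o + (m ++ [b]).length) N := by
        rw [blocksFrom_append (hard_spacing k X N) hend hend.le o (by omega) h1, pieceBlocks,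
          if_neg (fun hc => hnc hc.1),
          blocksFrom_eq_leftAligned (hard_spacing k X N) hend o hno o (by omega) h1 le_rfl]
        congr 2; omega
      have e1 : attachLeft (m :: [b] :: rest') = (m ++ [b]) :: attachLeft rest' := rfl
      rw [e1, List.flatMap_cons, step]
      congr 1
      rw [List.length_append, List.length_singleton, ← Nat.add_assoc] at hend ⊢
      cases rest' with
      | nil =>
        have : o + m.length + 1 = N := r6
        rw [blocksFrom_of_le (by omega)]; rfl
      | cons m'' rest'' =>
        have h3 := r5 m'' (by simp)
        have h4 : RepLike X (o + m.length + 1) m''.length := by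
          rcases h3 with h3 | h3
          · have := h3.1; omega
          · exact h3
        have h5 := r4 (by simp)
        simp only [List.length_cons] at hd
        exact ih _ m'' rest'' (by omega) r6 (Or.inr hend)
          (Or.inr ⟨by omega, by simpa using h5, Or.inl h4⟩) h4.1
    · have h2' : 2 ≤ m'.length := by omega
      rw [attachLeft_cons_of_length hm', List.flatMap_cons]
      by_cases hr : RepLike X o m.length
      · have hend : Hard k X N (o + m.length) := by
          rcases r3 with r3 | r3
          · exact hard_of_repLike (by omega) hne r3 (by omega)
          -- This is the second alternative of `PieceStart`: a repetition ends here, and the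
          -- repetition-free piece behind it has at least two symbols, so it is not attached.
          · refine Or.inr (Or.inl ⟨by omega, by omega, hne, Or.inr ⟨hr.2.1, ?_⟩⟩)
            rcases Nat.lt_or_ge 2 m'.length with h | h
            · right
              have := r3 (o + m.length + 2) (by omega) (by omega)
              simpa using this
            · have h : m'.length = 2 := by omega
              cases rest' with
              | nil =>
                left
                have : o + m.length + m'.length = N := r6
                omega
              | cons m'' rest'' =>
                right
                have := r4 (by simp)
                rw [h] at this
                simpa using this
        rw [blocksFrom_repLike hN l1 hr ho hend]
        congr 1
        exact ih _ m' rest' (by omega) l6' (Or.inr hend)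
          (Or.inr ⟨by omega, hne, Or.inr hr.2.1⟩) h2'
      · have hr' := hadj.resolve_left hr
        have hend : Hard k X N (o + m.length) :=
          hard_of_repLike (by omega) hne hr' (by omega)
        rw [blocksFrom_chainAt hN l1 (l3.resolve_left hr) h2 ho ?_
          (Or.inr ⟨hne, m'.length, hr', by omega⟩)]
        · congr 1
          exact ih _ m' rest' (by omega) l6' (Or.inr hend)
            (Or.inr ⟨by omega, hne, Or.inl hr'⟩) h2'
        · rcases hf with hf | ⟨f1, f2, f3⟩
          · exact Or.inl hf
          · exact Or.inr ⟨f1, f2, f3.resolve_left hr⟩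

theorem blocksFrom_attach (hN : 2 ≤ N) {ms : List (List ℕ)} (h : Laid X N 0 ms) :
    blocksFrom (Hard k X N) 0 N = (attach ms).flatMap (pieceBlocks k) := by
  cases ms with
  | nil => have : 0 = N := h; omega
  | cons m rest =>
    by_cases hm : m.length = 1
    · obtain ⟨a, rfl⟩ := List.length_eq_one_iff.1 hm
      obtain ⟨l1, l2, l3, l4, l5, l6⟩ := h
      simp only [List.length_singleton, Nat.zero_add] at *
      cases rest with
      | nil => have : 1 = N := l6; omega
      | cons m' rest' =>
        have hr : RepLike X 1 m'.length := by
          rcases l5 m' (by simp) with h | h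
          · have := h.1; omega
          · exact h
        obtain ⟨r1, r2, r3, r4, r5, r6⟩ := l6
        have e1 : attach ([a] :: m' :: rest') = attachLeft ((a :: m') :: rest') := rfl
        rw [e1]
        have h1 := hr.1
        -- The exception `q = 1` in `RepLike` is made for this case: a single first symbol joined to
        -- the repetition on its right.
        have hr' : RepLike X 0 (a :: m').length := by
          refine ⟨by simp; omega, ?_, ?_⟩
          · have := hr.2.1
            rw [List.length_cons]
            rwa [show 0 + (m'.length + 1) = 1 + m'.length by omega]
          · intro q h2 h3
            rw [List.length_cons] at h3
            rcases Nat.lt_or_ge 1 q with h4 | h4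
            · exact hr.2.2 q h4 (by omega)
            · right; omega
        refine blocksFrom_attachLeft hN rest'.length 0 (a :: m') rest' le_rfl ?_ (Or.inl rfl)
          (Or.inl rfl) (by simp; omega)
        refine ⟨?_, by simp, Or.inl hr', ?_, ?_, ?_⟩
        · intro i hi
          cases i with
          | zero => simpa using l1 0 (by omega)
          | succ i =>
            rw [List.length_cons] at hi
            have := r1 i (by omega)
            rw [Nat.zero_add, List.getD_cons_succ, ← this, Nat.add_comm]
        · intro hrest
          have := r4 hrest
          rw [List.length_cons, Nat.zero_add, Nat.add_comm m'.length]; exact this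
        · intro m'' _; exact Or.inl hr'
        · rw [List.length_cons, Nat.zero_add, Nat.add_comm m'.length]; exact r6
    · have e1 : attach (m :: rest) = attachLeft (m :: rest) := by
        match m, hm with
        | [], _ => rfl
        | [_], h => simp at h
        | _ :: _ :: _, _ => rfl
      rw [e1]
      have := h.2.1
      exact blocksFrom_attachLeft hN rest.length 0 m rest le_rfl h (Or.inl rfl) (Or.inl rfl)
        (by omega)

end Laid

/-! ## The pieces of a string -/

theorem _root_.List.IsChain.and {α : Type*} {R S : α → α → Prop} {l : List α} (hR : l.IsChain R)
    (hS : l.IsChain S) : l.IsChain (fun a b => R a b ∧ S a b) := by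
  rw [List.isChain_iff_getElem] at *
  exact fun i hi => ⟨hR i hi, hS i hi⟩

/-- Repetitions of length at least two. -/
def IsRep (m : List ℕ) : Prop := 2 ≤ m.length ∧ m.IsChain (· = ·)

/-- Translates adjacency conditions on a list of pieces into conditions on positions of the
concatenated string, the form in which hard positions are described. -/
theorem laid_of_isChain {X : ℕ → ℕ} {N : ℕ} : ∀ (ms : List (List ℕ)) (o : ℕ),
    (∀ m ∈ ms, m ≠ [] ∧ (IsRep m ∨ m.IsChain (· ≠ ·))) →
    ms.IsChain (fun m m' => (∀ a ∈ m.getLast?, ∀ b ∈ m'.head?, a ≠ b) ∧ (IsRep m ∨ IsRep m')) →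
    (∀ i < ms.flatten.length, X (o + i) = ms.flatten.getD i 0) → o + ms.flatten.length = N →
    Laid X N o ms := by
  have hrep : ∀ (m : List ℕ) (o : ℕ), (∀ i < m.length, X (o + i) = m.getD i 0) → IsRep m →
      RepLike X o m.length := by
    rintro m o hm ⟨h2, hc⟩
    rw [List.isChain_iff_getElem] at hc
    have key : ∀ i, i + 1 < m.length → X (o + i) = X (o + (i + 1)) := by
      intro i hi
      rw [hm i (by omega), hm (i + 1) hi, List.getD_eq_getElem _ _ (by omega),
        List.getD_eq_getElem _ _ hi]
      exact hc i hi
    refine ⟨h2, ?_, fun q h3 h4 => Or.inl ?_⟩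
    · have := key (m.length - 2) (by omega)
      rwa [show o + (m.length - 2) = o + m.length - 2 by omega,
        show o + (m.length - 2 + 1) = o + m.length - 1 by omega] at this
    · have := key (q - 1 - o) (by omega)
      rwa [show o + (q - 1 - o) = q - 1 by omega, show o + (q - 1 - o + 1) = q by omega] at this
  intro ms
  induction ms with
  | nil => intro o _ _ _ h; exact h
  | cons m ms ih =>
    intro o h1 h2 h3 h4
    rw [List.flatten_cons] at h3 h4
    rw [List.length_append] at h3 h4
    obtain ⟨hne, hm⟩ := h1 m (by simp)
    have hpos : 1 ≤ m.length := List.length_pos_iff.2 hne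
    have hX : ∀ i < m.length, X (o + i) = m.getD i 0 := by
      intro i hi
      rw [h3 i (by omega), List.getD_append _ _ _ _ hi]
    have hX' : ∀ i < ms.flatten.length, X (o + m.length + i) = ms.flatten.getD i 0 := by
      intro i hi
      rw [Nat.add_assoc, h3 _ (by omega), List.getD_append_right _ _ _ _ (by omega)]
      congr 1; omega
    have hX'' : ∀ m' ∈ ms.head?, ∀ i < m'.length, X (o + m.length + i) = m'.getD i 0 := by
      intro m' hm' i hi
      cases ms with
      | nil => simp at hm'
      | cons m₁ ms =>
        simp only [List.head?_cons, Option.mem_some_iff] at hm'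
        subst hm'
        rw [hX' i (by rw [List.flatten_cons, List.length_append]; omega), List.flatten_cons,
          List.getD_append _ _ _ _ hi]
    rw [List.isChain_cons] at h2
    refine ⟨hX, hpos, ?_, ?_, ?_, ih _ (fun m' hm' => h1 m' (by simp [hm'])) h2.2 hX' (by omega)⟩
    · rcases hm with hm | hm
      · exact Or.inl (hrep m o hX hm)
      · right
        intro q h5 h6
        rw [List.isChain_iff_getElem] at hm
        have := hm (q - 1 - o) (by omega)
        have e1 := hX (q - 1 - o) (by omega)
        have e2 := hX (q - 1 - o + 1) (by omega)
        rw [List.getD_eq_getElem _ _ (by omega)] at e1 e2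
        rw [← e1, ← e2] at this
        rwa [show o + (q - 1 - o) = q - 1 by omega, show o + (q - 1 - o + 1) = q by omega] at this
    · intro hms
      cases ms with
      | nil => simp at hms
      | cons m' ms =>
        have hm' : m' ≠ [] := (h1 m' (by simp)).1
        have hpos' : 0 < m'.length := List.length_pos_iff.2 hm'
        have h5 := (h2.1 m' (by simp)).1 (m.getLast hne) (List.getLast?_eq_getLast_of_ne_nil hne)
          (m'.head hm') (List.head?_eq_some_head hm')
        have e1 := hX (m.length - 1) (by omega)
        have e2 := hX'' m' (by simp) 0 hpos'
        rw [List.getD_eq_getElem _ _ (by omega)] at e1 e2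
        rw [List.getLast_eq_getElem, List.head_eq_getElem] at h5
        rw [show o + m.length - 1 = o + (m.length - 1) by omega, e1]
        rw [Nat.add_zero] at e2
        rw [e2]
        exact h5
    · intro m' hm'
      rcases (h2.1 m' hm').2 with h | h
      · exact Or.inl (hrep m o hX h)
      · exact Or.inr (hrep m' _ (hX'' m' hm') h)

/-- The inner `splitBy` yields maximal runs, and the outer one joins neighbouring runs of length
one. So a group is either a single long run or a sequence of one-symbol runs with distinct
neighbours, and a boundary between groups lies next to a long run. -/
theorem laid_pieces (x : List ℕ) : Laid (fun j => x.getD j 0) x.length 0 (pieces x) := by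
  have hflat : (pieces x).flatten = x := by
    rw [pieces, ← List.flatten_flatten, List.flatten_splitBy, List.flatten_splitBy]
  have hruns := List.isChain_getLast_head_splitBy (fun a b : ℕ => a == b) x
  have hrun : ∀ r ∈ x.splitBy (fun a b : ℕ => a == b), r ≠ [] ∧ r.IsChain (· = ·) := fun r hr =>
    ⟨List.ne_nil_of_mem_splitBy hr, (List.isChain_of_mem_splitBy hr).imp (by simp)⟩
  have hgroups := List.isChain_getLast_head_splitBy
    (fun g h : List ℕ => decide (g.length = 1 ∧ h.length = 1)) (x.splitBy (fun a b : ℕ => a == b))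
  have hgroup : ∀ g ∈ (x.splitBy (fun a b : ℕ => a == b)).splitBy
      (fun g h : List ℕ => decide (g.length = 1 ∧ h.length = 1)), g ≠ [] ∧
      g.IsChain (fun r r' => r.length = 1 ∧ r'.length = 1) := fun g hg =>
    ⟨List.ne_nil_of_mem_splitBy hg, (List.isChain_of_mem_splitBy hg).imp (by simp)⟩
  have hrs := List.flatten_splitBy (fun g h : List ℕ => decide (g.length = 1 ∧ h.length = 1))
    (x.splitBy (fun a b : ℕ => a == b))
  rw [← hrs] at hrun hruns
  unfold pieces at hflat ⊢
  generalize (x.splitBy (fun a b : ℕ => a == b)).splitBy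
      (fun g h : List ℕ => decide (g.length = 1 ∧ h.length = 1)) = gs at *
  have hnil : [] ∉ gs := fun h => (hgroup [] h).1 rfl
  rw [List.isChain_flatten hnil] at hruns
  have hrun' : ∀ g ∈ gs, ∀ r ∈ g, r ≠ [] ∧ r.IsChain (· = ·) := fun g hg r hr =>
    hrun r (List.mem_flatten.2 ⟨g, hg, hr⟩)
  have hnil' : ∀ g ∈ gs, [] ∉ g := fun g hg h => (hrun' g hg [] h).1 rfl
  -- a group is a repetition or consists of runs of length one
  have hcase : ∀ g ∈ gs, (∃ r, g = [r] ∧ IsRep r) ∨ ∀ r ∈ g, r.length = 1 := by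
    intro g hg
    match g, hgroup g hg, hrun' g hg with
    | [], h, _ => exact absurd rfl h.1
    | [r], _, h =>
      by_cases hr : r.length = 1
      · right; simpa using hr
      · left
        refine ⟨r, rfl, ?_, (h r (by simp)).2⟩
        have := List.length_pos_iff.2 (h r (by simp)).1
        omega
    | r :: r' :: g, h, _ =>
      right
      have h2 := h.2
      clear h
      intro q hq
      rw [List.isChain_iff_getElem] at h2
      obtain ⟨i, hi, rfl⟩ := List.mem_iff_getElem.1 hq
      cases i with
      | zero => exact (h2 0 (by simp)).1
      | succ i => exact (h2 i hi).2
  apply laid_of_isChain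
  · intro m hm
    obtain ⟨g, hg, rfl⟩ := List.mem_map.1 hm
    constructor
    · rw [List.ne_nil_iff_exists_cons]
      obtain ⟨r, g', hrg⟩ := List.exists_cons_of_ne_nil (hgroup g hg).1
      obtain ⟨a, r', har⟩ := List.exists_cons_of_ne_nil (hrun' g hg r (by simp [hrg])).1
      exact ⟨a, r' ++ g'.flatten, by simp [hrg, har]⟩
    · rcases hcase g hg with ⟨r, rfl, hr⟩ | h
      · left; simpa using hr
      · right
        rw [List.isChain_flatten (hnil' g hg)]
        refine ⟨fun r hr => ?_, ?_⟩
        · obtain ⟨a, rfl⟩ := List.length_eq_one_iff.1 (h r hr)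
          exact List.isChain_singleton a
        · refine (hruns.1 g hg).imp ?_
          rintro a b ⟨ha, hb, hab⟩ u hu v hv rfl
          rw [List.getLast?_eq_getLast_of_ne_nil ha] at hu
          rw [List.head?_eq_some_head hb] at hv
          simp only [Option.mem_some_iff] at hu hv
          simp [hu, hv] at hab
  · rw [List.isChain_map]
    have hboth := hruns.2.and hgroups
    refine hboth.imp_of_mem_imp ?_
    rintro g g' hg hg' ⟨h1, h2, h3, h4⟩
    have hl := h1 _ (List.getLast?_eq_getLast_of_ne_nil h2) _ (List.head?_eq_some_head h3)
    obtain ⟨ha, hb, hab⟩ := hl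
    constructor
    · intro a hla b hhb
      have e1 : g.flatten.getLast? = some ((g.getLast h2).getLast ha) := by
        obtain ⟨gi, r, hgr⟩ := List.eq_nil_or_concat' g |>.resolve_left h2
        subst hgr
        simp only [List.getLast_append_singleton] at ha ⊢
        rw [List.flatten_append, List.getLast?_append]
        simp [List.getLast?_eq_getLast_of_ne_nil ha]
      have e2 : g'.flatten.head? = some ((g'.head h3).head hb) := by
        obtain ⟨r, gt, hgr⟩ := List.exists_cons_of_ne_nil h3
        subst hgr
        simp only [List.head_cons] at hb ⊢
        rw [List.flatten_cons, List.head?_append]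
        simp [List.head?_eq_some_head hb]
      rw [e1] at hla
      rw [e2] at hhb
      simp only [Option.mem_some_iff] at hla hhb
      rw [← hla, ← hhb]
      simpa using hab
    · simp only [decide_eq_false_iff_not, not_and_or] at h4
      rcases h4 with h4 | h4
      · left
        rcases hcase g hg with ⟨r, rfl, hr⟩ | h
        · simpa using hr
        · exact absurd (h _ (List.getLast_mem h2)) h4
      · right
        rcases hcase g' hg' with ⟨r, rfl, hr⟩ | h
        · simpa using hr
        · exact absurd (h _ (List.head_mem h3)) h4
  · intro i hi
    rw [hflat, Nat.zero_add]
  · rw [hflat, Nat.zero_add]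

/-- The blocks of a level. -/
theorem blocks_eq_blocksFrom {k : ℕ} {x : List ℕ} (hx : 2 ≤ x.length) :
    blocks k x = blocksFrom (Hard k (fun j => x.getD j 0) x.length) 0 x.length :=
  (blocksFrom_attach hx (laid_pieces x)).symm

/-! ## Block boundaries that do not depend on the context -/

section Sure

variable (k : ℕ) (X : ℕ → ℕ) (m : ℕ)

/-- Position `j` of a pattern is certainly not part of a repetition. -/
def InnerSolo (j : ℕ) : Prop := 1 ≤ j ∧ j + 1 < m ∧ X (j - 1) ≠ X j ∧ X j ≠ X (j + 1)

def SureStart (q : ℕ) : Prop :=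
  2 ≤ q ∧ q + 2 < m ∧ X (q - 1) ≠ X q ∧
    (X q = X (q + 1) ∨ (X (q - 2) = X (q - 1) ∧ X (q + 1) ≠ X (q + 2)))

def SureCut (q : ℕ) : Prop :=
  ∃ s e, s + k + 4 ≤ q ∧ q + 7 ≤ e ∧ s + 2 * k < e ∧ (∀ j, s ≤ j → j < e → InnerSolo X m j) ∧
    IsLandmark (finalLabel k X) (q + 1)

/-- In every occurrence of the pattern `X 0, …, X (m - 1)`, the parsing starts anew at `q`. -/
def Sure (q : ℕ) : Prop := SureStart X m q ∨ SureCut k X m q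

/-- The first position with `Sure`, or `m` if there is none. -/
noncomputable def firstSure : ℕ := sInf {q | Sure k X m q ∨ m ≤ q}

open Classical in
/-- The last position with `Sure`, or `m` if there is none. -/
noncomputable def lastSure : ℕ :=
  if firstSure k X m < m then sSup {q | Sure k X m q} else m

variable {k X m}

theorem Sure.bounds {q : ℕ} (h : Sure k X m q) : 2 ≤ q ∧ q + 2 < m := by
  rcases h with h | ⟨s, e, h1, h2, -, h3, -⟩
  · exact ⟨h.1, h.2.1⟩
  · have := (h3 (q + 2) (by omega) (by omega)).2.1
    omega

theorem firstSure_le : firstSure k X m ≤ m := Nat.sInf_le (Or.inr le_rfl)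

theorem firstSure_le_of_sure {q : ℕ} (h : Sure k X m q) : firstSure k X m ≤ q :=
  Nat.sInf_le (Or.inl h)

theorem not_sure_of_lt_firstSure {q : ℕ} (h : q < firstSure k X m) : ¬ Sure k X m q :=
  fun hs => by have := firstSure_le_of_sure hs; omega

theorem sure_firstSure (h : firstSure k X m < m) : Sure k X m (firstSure k X m) := by
  have : firstSure k X m ∈ {q | Sure k X m q ∨ m ≤ q} := Nat.sInf_mem ⟨m, Or.inr le_rfl⟩
  rcases this with h' | h'
  · exact h'
  · omega

theorem bddAbove_sure : BddAbove {q | Sure k X m q} := ⟨m, fun q hq => by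
  have := hq.bounds; omega⟩

theorem sure_lastSure (h : firstSure k X m < m) : Sure k X m (lastSure k X m) := by
  rw [lastSure, if_pos h]
  exact Nat.sSup_mem ⟨_, sure_firstSure h⟩ bddAbove_sure

theorem le_lastSure {q : ℕ} (h : Sure k X m q) : q ≤ lastSure k X m := by
  have h1 := firstSure_le_of_sure h
  have h2 := h.bounds
  rw [lastSure, if_pos (by omega)]
  exact le_csSup bddAbove_sure h

theorem lastSure_of_eq (h : firstSure k X m = m) : lastSure k X m = m := by
  rw [lastSure, if_neg (by omega)]

theorem firstSure_le_lastSure : firstSure k X m ≤ lastSure k X m := by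
  rcases Nat.lt_or_ge (firstSure k X m) m with h | h
  · exact le_lastSure (sure_firstSure h)
  · rw [lastSure, if_neg (by omega)]; exact firstSure_le

theorem lastSure_le : lastSure k X m ≤ m := by
  rcases Nat.lt_or_ge (firstSure k X m) m with h | h
  · have := (sure_lastSure h).bounds; omega
  · rw [lastSure, if_neg (by omega)]

variable {Y : ℕ → ℕ} {N u : ℕ}

theorem InnerSolo.solo (hY : ∀ i < m, Y (u + i) = X i) (hN : u + m ≤ N) {j : ℕ}
    (h : InnerSolo X m j) : Solo Y N (u + j) := by
  obtain ⟨h1, h2, h3, h4⟩ := h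
  refine ⟨by omega, Or.inr ?_, Or.inr ?_⟩
  · rw [show u + j - 1 = u + (j - 1) by omega, hY _ (by omega), hY _ (by omega)]; exact h3
  · rw [Nat.add_assoc, hY _ (by omega), hY _ (by omega)]; exact h4

theorem Solo.innerSolo (hY : ∀ i < m, Y (u + i) = X i) (hN : u + m ≤ N) {j : ℕ}
    (h : Solo Y N (u + j)) (h1 : 1 ≤ j) (h2 : j + 1 < m) : InnerSolo X m j := by
  obtain ⟨-, h3, h4⟩ := h
  refine ⟨h1, h2, ?_, ?_⟩
  · rw [← hY _ (by omega), ← hY _ (by omega), show u + (j - 1) = u + j - 1 by omega]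
    exact h3.resolve_left (by omega)
  · rw [← hY _ (by omega), ← hY _ (by omega), ← Nat.add_assoc]
    exact h4.resolve_left (by omega)

theorem isLandmark_shift (hY : ∀ i < m, Y (u + i) = X i) {q : ℕ} (h1 : k + 4 ≤ q)
    (h2 : q + 7 ≤ m) :
    IsLandmark (finalLabel k Y) (u + q + 1) ↔ IsLandmark (finalLabel k X) (q + 1) := by
  have := isLandmark_congr (X := Y) (Y := X) k (u + (q - k - 4)) (q - k - 4) (fun t ht => by
    have := hY (q - k - 4 + t) (by omega)
    rwa [← Nat.add_assoc] at this)
  rwa [show u + (q - k - 4) + k + 5 = u + q + 1 by omega,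
    show q - k - 4 + k + 5 = q + 1 by omega] at this

/-- All symbols inspected by `PieceStart` are visible, as `SureStart` keeps two positions in front
of `q` and more than two from `q` on inside the pattern. The window of a `SureCut` consists of solo
positions in every context. -/
theorem Sure.hard (hY : ∀ i < m, Y (u + i) = X i) (hN : u + m ≤ N) {q : ℕ}
    (h : Sure k X m q) : Hard k Y N (u + q) := by
  have hb := h.bounds
  rcases h with ⟨h1, h2, h3, h4⟩ | ⟨s, e, h1, h2, h3, h4, h5⟩
  · refine Or.inr (Or.inl ⟨by omega, by omega, ?_, ?_⟩)
    · rw [show u + q - 1 = u + (q - 1) by omega, hY _ (by omega), hY _ (by omega)]; exact h3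
    · rw [show u + q - 2 = u + (q - 2) by omega, show u + q - 1 = u + (q - 1) by omega,
        show u + q + 1 = u + (q + 1) by omega, show u + q + 2 = u + (q + 2) by omega,
        hY _ (by omega), hY _ (by omega), hY _ (by omega), hY _ (by omega), hY _ (by omega)]
      tauto
  · have h6 := (h4 (e - 1) (by omega) (by omega)).2.1
    refine Or.inr (Or.inr ⟨u + s, u + e, by omega, by omega, by omega, fun j h7 h8 => ?_, ?_⟩)
    · have := (h4 (j - u) (by omega) (by omega)).solo hY hN
      rwa [show u + (j - u) = j by omega] at this
    · exact (isLandmark_shift hY (by omega) (by omega)).2 h5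

theorem SureStart.not_innerSolo {q : ℕ} (h : SureStart X m q) :
    ¬ (InnerSolo X m (q - 1) ∧ InnerSolo X m q) := by
  rintro ⟨h1, h2⟩
  obtain ⟨a1, a2, a3, a4⟩ := h
  rcases a4 with a4 | ⟨a4, -⟩
  · exact h2.2.2.2 a4
  · have := h1.2.2.1
    rw [show q - 1 - 1 = q - 2 by omega] at this
    exact this a4

/-- The danger is a cut whose witness window `[S, E)` leaves the pattern, since the length condition
and the margins may be met only outside. If the window sticks out on the left, it contains `a` and
its predecessor, so `a` cannot be a start of a piece and is itself a `SureCut`. Its window inside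
the pattern supplies the missing length and left margin. On the right, `b` plays the same role. -/
theorem sure_of_hard (hY : ∀ i < m, Y (u + i) = X i) (hN : u + m ≤ N) {a q b : ℕ}
    (ha : Sure k X m a) (hb : Sure k X m b) (haq : a < q) (hqb : q < b)
    (h : Hard k Y N (u + q)) : Sure k X m q := by
  have ha' := ha.bounds
  have hb' := hb.bounds
  rcases h with h | ⟨h1, h2, h3, h4⟩ | ⟨S, E, h1, h2, h3, h4, h5⟩
  · omega
  · left
    rw [show u + q - 2 = u + (q - 2) by omega, show u + q - 1 = u + (q - 1) by omega,
      show u + q + 1 = u + (q + 1) by omega, show u + q + 2 = u + (q + 2) by omega] at *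
    rw [hY _ (by omega), hY _ (by omega)] at h3 h4
    rw [hY _ (by omega), hY _ (by omega), hY _ (by omega)] at h4
    refine ⟨by omega, by omega, h3, ?_⟩
    rcases h4 with h4 | ⟨h4, h5⟩
    · exact Or.inl h4
    · exact Or.inr ⟨h4, h5.resolve_left (by omega)⟩
  · right
    -- inner positions of `[S, E)` are not part of a repetition of the pattern
    have hin : ∀ j, S ≤ u + j → u + j < E → 1 ≤ j → j + 1 < m → InnerSolo X m j :=
      fun j g1 g2 g3 g4 => (h4 _ g1 g2).innerSolo hY hN g3 g4
    have hcutA : S ≤ u → ∃ s e, s + k + 4 ≤ a ∧ a + 7 ≤ e ∧ s + 2 * k < e ∧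
        ∀ j, s ≤ j → j < e → InnerSolo X m j := by
      intro hS
      rcases ha with ha | ⟨s, e, g1, g2, g3, g4, -⟩
      · exfalso
        exact ha.not_innerSolo ⟨hin _ (by omega) (by omega) (by omega) (by omega),
          hin _ (by omega) (by omega) (by omega) (by omega)⟩
      · exact ⟨s, e, g1, g2, g3, g4⟩
    have hcutB : u + m ≤ E → ∃ s e, s + k + 4 ≤ b ∧ b + 7 ≤ e ∧ s + 2 * k < e ∧
        ∀ j, s ≤ j → j < e → InnerSolo X m j := by
      intro hE
      rcases hb with hb | ⟨s, e, g1, g2, g3, g4, -⟩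
      · exfalso
        exact hb.not_innerSolo ⟨hin _ (by omega) (by omega) (by omega) (by omega),
          hin _ (by omega) (by omega) (by omega) (by omega)⟩
      · exact ⟨s, e, g1, g2, g3, g4⟩
    have hlm : q + 7 ≤ m → k + 4 ≤ q → IsLandmark (finalLabel k X) (q + 1) := fun g1 g2 =>
      (isLandmark_shift hY g2 g1).1 h5
    by_cases hS : S ≤ u
    · obtain ⟨s₁, e₁, a1, a2, a3, a4⟩ := hcutA hS
      have b1 := (a4 s₁ le_rfl (by omega)).1
      have b2 := (a4 (e₁ - 1) (by omega) (by omega)).2.1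
      by_cases hE : u + m ≤ E
      · obtain ⟨s₂, e₂, c1, c2, c3, c4⟩ := hcutB hE
        have d2 := (c4 (e₂ - 1) (by omega) (by omega)).2.1
        exact ⟨1, m - 1, by omega, by omega, by omega,
          fun j g1 g2 => hin j (by omega) (by omega) g1 (by omega), hlm (by omega) (by omega)⟩
      -- The union of the window that belongs to `a` and the visible part of `[S, E)`. They overlap,
      -- so this is an interval; it starts at `1` because position `0` is never `InnerSolo`.
      · refine ⟨1, max e₁ (min (E - u) (m - 1)), by omega, ?_, by omega, fun j g1 g2 => ?_, hlm ?_ (by omega)⟩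
        · rcases Nat.lt_or_ge (E - u) m with hlt | hge
          · rcases Nat.lt_or_ge (E - u) (m - 1) with h' | h'
            · omega
            · have : E - u = m - 1 := by omega
              omega
          · omega
        · by_cases g3 : j < min (E - u) (m - 1)
          · exact hin j (by omega) (by omega) g1 (by omega)
          · exact a4 j (by omega) (by omega)
        · omega
    · by_cases hE : u + m ≤ E
      · obtain ⟨s₂, e₂, c1, c2, c3, c4⟩ := hcutB hE
        have d1 := (c4 s₂ le_rfl (by omega)).1
        have d2 := (c4 (e₂ - 1) (by omega) (by omega)).2.1
        refine ⟨min (S - u) s₂, m - 1, by omega, by omega, by omega, fun j g1 g2 => ?_,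
          hlm (by omega) (by omega)⟩
        by_cases g3 : S - u ≤ j
        · exact hin j (by omega) (by omega) (by omega) (by omega)
        · exact c4 j (by omega) (by omega)
      · by_cases hE' : u + m = E + 1 ∨ u + m > E + 1
        · refine ⟨S - u, E - u, by omega, by omega, by omega, fun j g1 g2 =>
            hin j (by omega) (by omega) (by omega) (by omega), hlm (by omega) (by omega)⟩
        · omega

end Sure

/-! ## The evidence computed from the pattern -/

open Classical in
/-- The symbols for the blocks of `p` between the positions `i` and `e`. -/
noncomputable def parseBlocks (rev : ℕ → ℕ → ℕ) (F : ℕ → Prop) (p : List ℕ) (i e : ℕ) : List ℕ :=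
  if i < e then
    if ¬ F (i + 2) ∧ F (i + 3) then
      rev (p.getD i 0) (rev (p.getD (i + 1) 0) (p.getD (i + 2) 0)) :: parseBlocks rev F p (i + 3) e
    else rev (p.getD i 0) (p.getD (i + 1) 0) :: parseBlocks rev F p (i + 2) e
  else []
termination_by e - i

/-- Every block has length at least two; the summand `1` allows the final block to run past `e`. -/
theorem length_parseBlocks (rev : ℕ → ℕ → ℕ) (F : ℕ → Prop) (p : List ℕ) (i e : ℕ) :
    2 * (parseBlocks rev F p i e).length ≤ e - i + 1 := by
  induction h : e - i using Nat.strong_induction_on generalizing i with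
  | _ d ih =>
    rw [parseBlocks]
    split_ifs with h1 h2
    · have := ih (e - (i + 3)) (by omega) (i + 3) rfl
      rw [List.length_cons]; omega
    · have := ih (e - (i + 2)) (by omega) (i + 2) rfl
      rw [List.length_cons]; omega
    · simp

section Evidence

variable (k : ℕ) (nm : ℕ → ℕ) (rev : ℕ → ℕ → ℕ)

/-- The names of the symbols of `p`. -/
def nameAt (p : List ℕ) (j : ℕ) : ℕ := (p.map nm).getD j 0

/-- The string of symbols of the next level that is certainly derived from `p`. -/
noncomputable def core (p : List ℕ) : List ℕ :=
  parseBlocks rev (Sure k (nameAt nm p) p.length) p (firstSure k (nameAt nm p) p.length)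
    (lastSure k (nameAt nm p) p.length)

/-- A sure position leaves more than enough room at the end of `p` to absorb the summand in
`length_parseBlocks`. -/
theorem two_mul_length_core_le (p : List ℕ) : 2 * (core k nm rev p).length ≤ p.length := by
  rw [core]
  rcases Nat.lt_or_ge (firstSure k (nameAt nm p) p.length) p.length with h | h
  · have h1 := (sure_lastSure h).bounds
    have := length_parseBlocks rev (Sure k (nameAt nm p) p.length) p
      (firstSure k (nameAt nm p) p.length) (lastSure k (nameAt nm p) p.length)
    omega
  · have h1 := lastSure_le (k := k) (X := nameAt nm p) (m := p.length)
    rw [parseBlocks, if_neg (by omega)]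
    simp

/-- Outside the range of the sure positions the blocks depend on the context, so these symbols stay
at the current level. Without sure positions both bounds are `p.length`: the core is empty and `p`
is kept as it is. -/
noncomputable def evidence (p : List ℕ) : List ℕ :=
  if p = [] then []
  else p.take (firstSure k (nameAt nm p) p.length) ++ evidence (core k nm rev p) ++
    p.drop (lastSure k (nameAt nm p) p.length)
termination_by p.length
decreasing_by
  have := two_mul_length_core_le k nm rev p
  have := List.length_pos_iff.2 ‹¬ p = []›
  omega

end Evidence

/-! ## Correctness of the evidence -/

theorem consecutive_append {T : PTree} {a b : List PTree} {i : ℕ} :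
    Consecutive T i (a ++ b) ↔
      Consecutive T i a ∧ Consecutive T (i + (a.flatMap PTree.yield).length) b := by
  induction a generalizing i with
  | nil => simp [Consecutive]
  | cons v a ih =>
    simp only [List.cons_append, Consecutive, ih, List.flatMap_cons, List.length_append, and_assoc,
      Nat.add_assoc]

theorem OccursAt.trans {T t u : PTree} {i j : ℕ} (h : OccursAt T i t) (h' : OccursAt t j u) :
    OccursAt T (i + j) u := by
  induction h with
  | here T => simpa using h'
  | left _ ih => exact .left (ih h')
  | right _ ih => rw [Nat.add_assoc]; exact .right (ih h')

theorem OccursAt.isParseTree {G : Slp} {T t : PTree} {i : ℕ} (h : OccursAt T i t)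
    (hT : G.IsParseTree T) : G.IsParseTree t := by
  induction h with
  | here T => exact hT
  | left _ ih => exact ih hT.2.1
  | right _ ih => exact ih hT.2.2

theorem Consecutive.isParseTree {G : Slp} {T : PTree} (hT : G.IsParseTree T) :
    ∀ {vs : List PTree} {i : ℕ}, Consecutive T i vs → ∀ v ∈ vs, G.IsParseTree v
  | [], _, _ => by simp
  | v :: vs, _, h => by
    intro v' hv'
    rcases List.mem_cons.1 hv' with rfl | hv'
    · exact h.1.isParseTree hT
    · exact Consecutive.isParseTree hT h.2 v' hv'

theorem Grouped.sum_eq {bs : List ℕ} {ts us : List PTree} (h : Grouped bs ts us) :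
    bs.sum = ts.length := by
  induction h with
  | nil => rfl
  | pair X a b _ ih => simp [ih]; omega
  | triple X Y a b c _ ih => simp [ih]; omega

theorem Grouped.yield_eq {bs : List ℕ} {ts us : List PTree} (h : Grouped bs ts us) :
    us.flatMap PTree.yield = ts.flatMap PTree.yield := by
  induction h with
  | nil => rfl
  | pair X a b _ ih => simp [ih, PTree.yield]
  | triple X Y a b c _ ih => simp [ih, PTree.yield]

theorem Grouped.consecutive {T : PTree} {bs : List ℕ} {ts us : List PTree}
    (h : Grouped bs ts us) : ∀ {i : ℕ}, Consecutive T i us → Consecutive T i ts := by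
  induction h with
  | nil => intro i h; exact h
  | pair X a b _ ih =>
    rintro i ⟨h1, h2⟩
    refine ⟨h1.trans (j := 0) (.left (.here a)), h1.trans (j := a.yield.length + 0)
      (.right (.here b)), ih ?_⟩
    simpa [PTree.yield, Nat.add_assoc] using h2
  | triple X Y a b c _ ih =>
    rintro i ⟨h1, h2⟩
    refine ⟨h1.trans (j := 0) (.left (.here a)), h1.trans (j := a.yield.length + 0)
      (.right (.left (.here b))), ?_, ih ?_⟩
    · have := h1.trans (j := a.yield.length + (b.yield.length + 0)) (.right (.right (.here c)))
      simpa [Nat.add_assoc] using this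
    · simpa [PTree.yield, Nat.add_assoc] using h2

theorem Grouped.split {bs₁ bs₂ : List ℕ} : ∀ {ts us : List PTree}, Grouped (bs₁ ++ bs₂) ts us →
    ∃ ts₁ ts₂ us₁ us₂, ts = ts₁ ++ ts₂ ∧ us = us₁ ++ us₂ ∧ Grouped bs₁ ts₁ us₁ ∧
      Grouped bs₂ ts₂ us₂ := by
  induction bs₁ with
  | nil => intro ts us h; exact ⟨[], ts, [], us, rfl, rfl, .nil, h⟩
  | cons b bs ih =>
    intro ts us h
    rw [List.cons_append] at h
    cases h with
    | pair X a b h =>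
      obtain ⟨ts₁, ts₂, us₁, us₂, rfl, rfl, h1, h2⟩ := ih h
      exact ⟨_, ts₂, _, us₂, rfl, rfl, .pair X a b h1, h2⟩
    | triple X Y a b c h =>
      obtain ⟨ts₁, ts₂, us₁, us₂, rfl, rfl, h1, h2⟩ := ih h
      exact ⟨_, ts₂, _, us₂, rfl, rfl, .triple X Y a b c h1, h2⟩

theorem EspTree.consecutive {k : ℕ} {name : ℕ → ℕ} {ts : List PTree} {T : PTree}
    (h : EspTree k name ts T) : Consecutive T 0 ts := by
  induction h with
  | single t => exact ⟨.here t, trivial⟩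
  | level _ h _ ih => exact h.consecutive ih

theorem EspTree.yield_eq {k : ℕ} {name : ℕ → ℕ} {ts : List PTree} {T : PTree}
    (h : EspTree k name ts T) : T.yield = ts.flatMap PTree.yield := by
  induction h with
  | single t => simp
  | level _ h _ ih => rw [ih, h.yield_eq]

/-! ### The action of one level on a substring, and the induction over the levels. -/

section Level

variable {G : Slp}

theorem Slp.WellFormed.label_eq (hG : G.WellFormed) {X : ℕ} {l r : PTree}
    (h : G.IsParseTree (.node X l r)) : X = G.rev l.label r.label := by
  obtain ⟨⟨k, rfl, hk⟩, -⟩ := h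
  exact (hG.rev_eq hk).symm

/-- A right-hand side determines its variable, so the labels of the parents can be recomputed from
those of the children with `rev`. The recursion of `parseBlocks` mirrors that of `blocksFrom`. -/
theorem Grouped.labels_eq (hG : G.WellFormed) {F : ℕ → Prop} {p : List ℕ} {e : ℕ} :
    ∀ (d i : ℕ), e - i = d → ∀ {ts us : List PTree}, Grouped (blocksFrom F i e) ts us →
    (∀ u ∈ us, G.IsParseTree u) →
    (∀ j < ts.length, p.getD (i + j) 0 = (ts.map PTree.label).getD j 0) →
    us.map PTree.label = parseBlocks G.rev F p i e := by
  intro d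
  induction d using Nat.strong_induction_on with
  | _ d ih =>
    intro i hd ts us h hus hp
    rw [blocksFrom] at h
    rw [parseBlocks]
    by_cases h1 : i < e
    swap
    · rw [if_neg h1] at h ⊢
      cases h; rfl
    rw [if_pos h1] at h ⊢
    by_cases h2 : ¬ F (i + 2) ∧ F (i + 3)
    · rw [if_pos h2] at h ⊢
      cases h with
      | @triple bs ts us X Y a b c h =>
        have e0 := hp 0 (by simp)
        have e1 := hp 1 (by simp)
        have e2 := hp 2 (by simp)
        simp only [List.map_cons, List.getD_cons_zero, List.getD_cons_succ, Nat.add_zero] at e0 e1 e2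
        have h3 := hus (.node X a (.node Y b c)) (by simp)
        rw [List.map_cons, e0, e1, e2, ← hG.label_eq h3.2.2, ← ih (e - (i + 3)) (by omega) (i + 3) rfl h
          (fun u hu => hus u (by simp [hu])) (fun j hj => by
            have := hp (j + 3) (by simp; omega)
            rw [Nat.add_assoc, Nat.add_comm 3, this]
            simp)]
        congr 1
        exact hG.label_eq h3
    · rw [if_neg h2] at h ⊢
      cases h with
      | @pair bs ts us X a b h =>
        have e0 := hp 0 (by simp)
        have e1 := hp 1 (by simp)
        simp only [List.map_cons, List.getD_cons_zero, List.getD_cons_succ, Nat.add_zero] at e0 e1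
        have h3 := hus (.node X a b) (by simp)
        rw [List.map_cons, e0, e1, ← ih (e - (i + 2)) (by omega) (i + 2) rfl h
          (fun u hu => hus u (by simp [hu])) (fun j hj => by
            have := hp (j + 2) (by simp; omega)
            rw [Nat.add_assoc, Nat.add_comm 2, this]
            simp)]
        congr 1
        exact hG.label_eq h3

/-- One level: the trees over the core of a substring. -/
theorem Grouped.core_eq (hG : G.WellFormed) {k : ℕ} {name nm : ℕ → ℕ}
    {us₁ vs us₂ us : List PTree} (h2 : 2 ≤ (us₁ ++ vs ++ us₂).length)
    (h : Grouped (blocks k ((us₁ ++ vs ++ us₂).map (fun u => name u.label))) (us₁ ++ vs ++ us₂) us)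
    (hus : ∀ u ∈ us, G.IsParseTree u) (hnm : ∀ v ∈ vs, nm v.label = name v.label)
    (hL : firstSure k (nameAt nm (vs.map PTree.label)) vs.length < vs.length) :
    ∃ W₁ W W₂ : List PTree, us = W₁ ++ W ++ W₂ ∧
      W.map PTree.label = core k nm G.rev (vs.map PTree.label) ∧
      W₁.flatMap PTree.yield = us₁.flatMap PTree.yield ++
        (vs.take (firstSure k (nameAt nm (vs.map PTree.label)) vs.length)).flatMap PTree.yield ∧
      vs.flatMap PTree.yield =
        (vs.take (firstSure k (nameAt nm (vs.map PTree.label)) vs.length)).flatMap PTree.yield ++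
        W.flatMap PTree.yield ++
        (vs.drop (lastSure k (nameAt nm (vs.map PTree.label)) vs.length)).flatMap PTree.yield := by
  set p := vs.map PTree.label with hp
  set X := nameAt nm p with hX
  set x := (us₁ ++ vs ++ us₂).map (fun u => name u.label) with hx
  set Y : ℕ → ℕ := fun j => x.getD j 0 with hYdef
  have hlen : p.length = vs.length := by simp [hp]
  have hxlen : x.length = us₁.length + vs.length + us₂.length := by simp [hx, Nat.add_assoc]
  have hY : ∀ i < vs.length, Y (us₁.length + i) = X i := by
    intro i hi
    have e1 : Y (us₁.length + i) = name (vs[i]).label := by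
      simp only [hYdef, hx, List.append_assoc, List.map_append]
      rw [List.getD_append_right _ _ _ _ (by simp), List.getD_append _ _ _ _ (by simpa using hi),
        List.getD_eq_getElem _ _ (by simpa using hi)]
      simp
    have e2 : X i = nm (vs[i]).label := by
      simp only [hX, nameAt, hp]
      rw [List.getD_eq_getElem _ _ (by simpa using hi)]
      simp
    rw [e1, e2, hnm _ (List.getElem_mem hi)]
  have hN : us₁.length + vs.length ≤ x.length := by omega
  set L := firstSure k X vs.length with hLdef
  set R := lastSure k X vs.length with hRdef
  have sL := sure_firstSure hL
  have sR := sure_lastSure hL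
  have hLR : L ≤ R := le_lastSure sL
  have hRm : R ≤ vs.length := lastSure_le
  have hHL : Hard k Y x.length (us₁.length + L) := sL.hard hY hN
  have hHR : Hard k Y x.length (us₁.length + R) := sR.hard hY hN
  have hspace : ∀ q, Sure k X vs.length q → ¬ Sure k X vs.length (q + 1) := fun q h3 h4 =>
    (h3.hard hY hN).not_succ (h4.hard hY hN)
  rw [blocks_eq_blocksFrom (by rw [hxlen]; simpa [Nat.add_assoc] using h2)] at h
  rw [blocksFrom_append (hard_spacing k Y x.length) hHL hHL.le 0 (by omega) (by
      intro h3
      have := h3.two_le (by rw [hxlen]; simpa [Nat.add_assoc] using h2)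
      omega),
    blocksFrom_append (hard_spacing k Y x.length) hHR hHR.le _ (by omega) hHL.not_succ] at h
  have hsum := sum_blocksFrom (hard_spacing k Y x.length) hHL 0 (by omega) (by
      intro h3
      have := h3.two_le (by rw [hxlen]; simpa [Nat.add_assoc] using h2)
      omega)
  have hsum2 := sum_blocksFrom (hard_spacing k Y x.length) hHR (us₁.length + L) (by omega)
    hHL.not_succ
  obtain ⟨ts₁, ts', W₁, W', e1, rfl, g1, h⟩ := h.split
  obtain ⟨ts₂, ts₃, W, W₂, rfl, rfl, g2, g3⟩ := h.split
  have l1 : ts₁.length = us₁.length + L := by rw [← g1.sum_eq]; omega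
  have l2 : ts₂.length = R - L := by
    rw [← g2.sum_eq]
    change us₁.length + L + (blocksFrom (Hard k Y x.length) _ _).sum = _ at hsum2
    omega
  have e2 : us₁ ++ vs ++ us₂ = (us₁ ++ vs.take L) ++ ((vs.drop L).take (R - L) ++ (vs.drop R ++ us₂)) := by
    have : vs = vs.take L ++ ((vs.drop L).take (R - L) ++ vs.drop R) := by
      conv_lhs => rw [← List.take_append_drop L vs, ← List.take_append_drop (R - L) (vs.drop L)]
      rw [List.drop_drop, Nat.add_sub_cancel' hLR]
    conv_lhs => rw [this]
    simp
  rw [e2] at e1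
  obtain ⟨e3, e4⟩ := List.append_inj e1 (by simp [l1]; omega)
  obtain ⟨e5, e6⟩ := List.append_inj e4 (by simp [l2]; omega)
  refine ⟨W₁, W, W₂, by simp, ?_, ?_, ?_⟩
  -- Between the first and the last sure position, hard in the context and sure in the pattern mean
  -- the same, so both parsings produce the same blocks.
  · have hb : blocksFrom (Hard k Y x.length) (us₁.length + L) (us₁.length + R)
        = blocksFrom (Sure k X vs.length) L R := by
      refine blocksFrom_congr hspace sR us₁.length L (fun q h3 h4 => ⟨fun h => h.hard hY hN,
        fun h => ?_⟩) L hLR (hspace _ sL) le_rfl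
      rcases Nat.eq_or_lt_of_le h4 with rfl | h4
      · exact sR
      · exact sure_of_hard hY hN sL sR h3 h4 h
    change Grouped (blocksFrom (Hard k Y x.length) _ _) _ _ at g2
    rw [hb] at g2
    have := g2.labels_eq hG (p := p) (R - L) L rfl (fun u hu => hus u (by simp [hu])) (by
      intro j hj
      rw [← e5, hp, List.map_take, List.map_drop]
      rw [l2] at hj
      simp [List.getD, hj])
    rw [this, core, ← hX, hlen]
  · rw [g1.yield_eq, ← e3, List.flatMap_append]
  · rw [g2.yield_eq, ← e5]
    conv_lhs => rw [← List.take_append_drop L vs, ← List.take_append_drop (R - L) (vs.drop L),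
      List.drop_drop, Nat.add_sub_cancel' hLR]
    simp

/-- Induction over the levels, for an arbitrary segment `vs` of the current forest, so that the
hypothesis applies to the trees over the core of the segment one level up. The kept prefix and
suffix contribute nodes of the current level on both sides. -/
theorem EspTree.exists_evidence (hG : G.WellFormed) {k : ℕ} {name nm : ℕ → ℕ}
    (hnm : ∀ X < G.numSymbols, nm X = name X) {ts : List PTree} {T : PTree}
    (h : EspTree k name ts T) (hT : G.IsParseTree T) :
    ∀ us₁ vs us₂ : List PTree, ts = us₁ ++ vs ++ us₂ →
    ∃ vs' : List PTree, vs'.map PTree.label = evidence k nm G.rev (vs.map PTree.label) ∧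
      vs'.flatMap PTree.yield = vs.flatMap PTree.yield ∧
      Consecutive T (us₁.flatMap PTree.yield).length vs' := by
  -- Without a sure position the recursion stops, and the segment itself provides the nodes. This
  -- may happen far below the root.
  have htriv : ∀ {ts : List PTree}, Consecutive T 0 ts → ∀ us₁ vs us₂ : List PTree,
      ts = us₁ ++ vs ++ us₂ → vs.length ≤ firstSure k (nameAt nm (vs.map PTree.label)) vs.length →
      ∃ vs' : List PTree, vs'.map PTree.label = evidence k nm G.rev (vs.map PTree.label) ∧
      vs'.flatMap PTree.yield = vs.flatMap PTree.yield ∧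
      Consecutive T (us₁.flatMap PTree.yield).length vs' := by
    rintro ts hc us₁ vs us₂ rfl hle
    refine ⟨vs, ?_, rfl, ?_⟩
    · rw [evidence]
      split_ifs with h0
      · exact h0
      · have e1 : firstSure k (nameAt nm (vs.map PTree.label)) (vs.map PTree.label).length
            = (vs.map PTree.label).length := by
          rw [List.length_map]; exact le_antisymm firstSure_le hle
        have e2 := lastSure_of_eq e1
        have e3 : core k nm G.rev (vs.map PTree.label) = [] := by
          rw [core, parseBlocks, if_neg (by omega)]
        rw [e1, e2, e3, evidence, if_pos rfl]
        simp
    · rw [consecutive_append, consecutive_append] at hc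
      simpa using hc.1.2
  induction h with
  | single t =>
    intro us₁ vs us₂ hts
    refine htriv (EspTree.consecutive (.single (k := k) (name := name) t)) us₁ vs us₂ hts ?_
    by_contra hlt
    push Not at hlt
    have := (sure_firstSure hlt).bounds
    have := congrArg List.length hts
    simp at this
    omega
  | @level ts us T h2 hg hesp ih =>
    intro us₁ vs us₂ hts
    have hc := hesp.consecutive
    rcases Nat.lt_or_ge (firstSure k (nameAt nm (vs.map PTree.label)) vs.length) vs.length with
      hlt | hge
    swap
    · exact htriv (hg.consecutive hc) us₁ vs us₂ hts hge
    subst hts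
    have hus := hc.isParseTree hT
    have hcts := hg.consecutive hc
    have hvs := hcts.isParseTree hT
    obtain ⟨W₁, W, W₂, rfl, a1, a2, a3⟩ := hg.core_eq hG h2 hus (nm := nm) (fun v hv =>
      hnm _ (PTree.follows_of_isParseTree (hvs v (by simp [hv]))).label_lt) hlt
    obtain ⟨vs', b1, b2, b3⟩ := ih hT htriv W₁ W W₂ rfl
    set L := firstSure k (nameAt nm (vs.map PTree.label)) vs.length with hL
    set R := lastSure k (nameAt nm (vs.map PTree.label)) vs.length with hR
    refine ⟨vs.take L ++ vs' ++ vs.drop R, ?_, ?_, ?_⟩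
    · have hne : vs.map PTree.label ≠ [] := by
        intro h
        rw [List.map_eq_nil_iff] at h
        rw [h] at hlt
        simp at hlt
      rw [evidence, if_neg hne, List.length_map, ← hL, ← hR, ← a1, ← b1]
      simp [List.map_take, List.map_drop]
    · rw [List.flatMap_append, List.flatMap_append, b2, a3]
    · rw [consecutive_append, consecutive_append] at hcts
      have hv := hcts.1.2
      rw [Nat.zero_add] at hv
      have hRm : R ≤ vs.length := lastSure_le
      have hLR : L ≤ R := firstSure_le_lastSure
      have c1 : Consecutive T (us₁.flatMap PTree.yield).length (vs.take L) := by
        rw [← List.take_append_drop L vs, consecutive_append] at hv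
        exact hv.1
      have c2 : Consecutive T ((us₁.flatMap PTree.yield).length +
          ((vs.take R).flatMap PTree.yield).length) (vs.drop R) := by
        rw [← List.take_append_drop R vs, consecutive_append] at hv
        exact hv.2
      have c3 : (vs.take R).flatMap PTree.yield = (vs.take L).flatMap PTree.yield ++
          W.flatMap PTree.yield := by
        have e1 : vs.flatMap PTree.yield = (vs.take R).flatMap PTree.yield ++
            (vs.drop R).flatMap PTree.yield := by
          rw [← List.flatMap_append, List.take_append_drop]
        rw [e1] at a3
        exact List.append_cancel_right a3
      rw [consecutive_append, consecutive_append]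
      refine ⟨⟨c1, ?_⟩, ?_⟩
      · rw [a2, List.length_append] at b3; exact b3
      · rw [c3] at c2
        rw [List.flatMap_append, b2]; exact c2

end Level

/-! ## The number of runs -/

theorem numRuns_cons_cons_of_ne {a b : ℕ} (h : a ≠ b) (l : List ℕ) :
    numRuns (a :: b :: l) = numRuns (b :: l) + 1 := by
  have h1 := List.splitBy_append (r := fun a b : ℕ => a == b) (l := [a]) (m := b :: l)
    (by simpa using h)
  rw [List.singleton_append] at h1
  rw [numRuns, h1, List.length_append, numRuns, Nat.add_comm]
  rfl

theorem numRuns_cons_cons_self (a : ℕ) (l : List ℕ) :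
    numRuns (a :: a :: l) = numRuns (a :: l) := by
  obtain ⟨g, gs, hg⟩ := List.exists_cons_of_ne_nil
    (List.splitBy_ne_nil.2 (List.cons_ne_nil a l) : (a :: l).splitBy (fun a b => a == b) ≠ [])
  obtain ⟨h1, h2, h3, h4⟩ := List.splitBy_eq_iff.1 hg
  have hgne : g ≠ [] := fun h => h2 (by simp [h])
  obtain ⟨b, g', rfl⟩ := List.exists_cons_of_ne_nil hgne
  have hab : a = b := by simpa using congrArg List.head? h1
  subst hab
  have key : (a :: a :: l).splitBy (fun a b => a == b) = (a :: a :: g') :: gs := by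
    rw [List.splitBy_eq_iff]
    refine ⟨by rw [h1]; simp, ?_, ?_, ?_⟩
    · simpa using fun h => h2 (by simp [h])
    · intro m hm
      rcases List.mem_cons.1 hm with rfl | hm
      · rw [List.isChain_cons_cons]
        exact ⟨by simp, h3 _ (by simp)⟩
      · exact h3 m (by simp [hm])
    · rw [List.isChain_cons] at h4 ⊢
      refine ⟨fun y hy => ?_, h4.2⟩
      obtain ⟨ha, hb, hab⟩ := h4.1 y hy
      exact ⟨by simp, hb, by simpa using hab⟩
  rw [numRuns, numRuns, key, hg]
  rfl

theorem numRuns_cons_le (a : ℕ) (l : List ℕ) : numRuns (a :: l) ≤ numRuns l + 1 := by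
  cases l with
  | nil => rfl
  | cons b l =>
    by_cases h : a = b
    · subst h; rw [numRuns_cons_cons_self]; omega
    · rw [numRuns_cons_cons_of_ne h]

theorem numRuns_append_le : ∀ u v : List ℕ, numRuns (u ++ v) ≤ numRuns u + numRuns v
  | [], v => by simp [numRuns]
  | [a], v => by
    have h := numRuns_cons_le a v
    have h1 : numRuns [a] = 1 := rfl
    rw [List.singleton_append]; omega
  | a :: b :: u, v => by
    have ih := numRuns_append_le (b :: u) v
    rw [List.cons_append] at ih
    rw [List.cons_append, List.cons_append]
    by_cases h : a = b
    · subst h; rw [numRuns_cons_cons_self, numRuns_cons_cons_self]; exact ih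
    · rw [numRuns_cons_cons_of_ne h, numRuns_cons_cons_of_ne h]; omega

theorem numRuns_le_length : ∀ l : List ℕ, numRuns l ≤ l.length
  | [] => le_rfl
  | a :: l => by
    have := numRuns_cons_le a l
    have := numRuns_le_length l
    rw [List.length_cons]; omega

theorem numRuns_le_one : ∀ {l : List ℕ}, l.IsChain (· = ·) → numRuns l ≤ 1
  | [], _ => by simp [numRuns]
  | [a], _ => le_rfl
  | a :: b :: l, h => by
    rw [List.isChain_cons_cons] at h
    obtain ⟨rfl, h⟩ := h
    rw [numRuns_cons_cons_self]
    exact numRuns_le_one h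

/-! ## Labels -/

theorem lowDiff_ne {a b : ℕ} (h : a ≠ b) :
    a / 2 ^ lowDiff a b % 2 ≠ b / 2 ^ lowDiff a b % 2 := by
  induction hn : a + b using Nat.strong_induction_on generalizing a b with
  | _ n ih =>
    rw [lowDiff, dif_neg h]
    split_ifs with h2
    · have := ih (a / 2 + b / 2) (by omega) (a := a / 2) (b := b / 2) (by omega) rfl
      rwa [Nat.pow_succ', ← Nat.div_div_eq_div_mul, ← Nat.div_div_eq_div_mul]
    · simpa using h2

theorem lowDiff_lt {e : ℕ} : ∀ {a b : ℕ}, a ≠ b → a < 2 ^ e → b < 2 ^ e → lowDiff a b < e := by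
  induction e with
  | zero => intro a b h ha hb; omega
  | succ e ih =>
    intro a b h ha hb
    rw [lowDiff, dif_neg h]
    rw [pow_succ] at ha hb
    split_ifs with h2
    · have := ih (a := a / 2) (b := b / 2) (by omega) (by omega) (by omega)
      omega
    · omega

theorem reduceLabel_lt {e a b : ℕ} (he : 1 ≤ e) (ha : a < 2 ^ e) (hb : b < 2 ^ e) :
    reduceLabel a b < 2 * e := by
  rw [reduceLabel]
  have h2 := Nat.mod_lt (b / 2 ^ lowDiff a b) (by norm_num : 2 > 0)
  by_cases h : a = b
  · have : lowDiff a b = 0 := by rw [lowDiff, dif_pos h]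
    omega
  · have := lowDiff_lt h ha hb
    omega

/-- If the two labels encoded the same bit position, this would be the lowest one in which `b` and
`c` differ, but the encoded bits would agree there. -/
theorem reduceLabel_ne {a b c : ℕ} (h2 : b ≠ c) :
    reduceLabel a b ≠ reduceLabel b c := by
  intro h
  simp only [reduceLabel] at h
  have g1 := Nat.mod_lt (b / 2 ^ lowDiff a b) (by norm_num : 2 > 0)
  have g2 := Nat.mod_lt (c / 2 ^ lowDiff b c) (by norm_num : 2 > 0)
  have e1 : lowDiff a b = lowDiff b c := by omega
  have e2 := lowDiff_ne h2
  rw [e1] at h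
  omega

theorem reduced_ne {X : ℕ → ℕ} {s e : ℕ} (h : ∀ j, s ≤ j → j < e → X j ≠ X (j + 1)) (i : ℕ) :
    ∀ j, s + i ≤ j → j < e → reduced X i j ≠ reduced X i (j + 1) := by
  induction i with
  | zero => exact h
  | succ i ih =>
    intro j h1 h2
    rw [reduced, reduced, Nat.add_sub_cancel]
    have g1 := ih (j - 1) (by omega) (by omega)
    rw [show j - 1 + 1 = j by omega] at g1
    exact reduceLabel_ne (ih j (by omega) h2)

theorem freeLabel_ne (a b : ℕ) : freeLabel a b ≠ a ∧ freeLabel a b ≠ b ∧ freeLabel a b ≤ 2 := by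
  unfold freeLabel
  split_ifs <;> omega

theorem eliminate_ne {y : ℕ → ℕ} {s e : ℕ} (c : ℕ) (h : ∀ j, s ≤ j → j < e → y j ≠ y (j + 1)) :
    ∀ j, s + 1 ≤ j → j + 1 < e → eliminate c y j ≠ eliminate c y (j + 1) := by
  intro j h1 h2
  have g1 := h (j - 1) (by omega) (by omega)
  have g2 := h j (by omega) (by omega)
  have g3 := h (j + 1) (by omega) (by omega)
  rw [show j - 1 + 1 = j by omega] at g1
  have f1 := freeLabel_ne (y (j - 1)) (y (j + 1))
  have f2 := freeLabel_ne (y j) (y (j + 1 + 1))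
  simp only [eliminate, Nat.add_sub_cancel]
  split_ifs with c1 c2 c2
  · omega
  · exact f1.2.1
  · exact f2.1.symm
  · exact g2

theorem eliminate_le {y : ℕ → ℕ} {K : ℕ} (c : ℕ) (hK : 2 ≤ K) (h : ∀ j, y j ≤ K) (j : ℕ) :
    eliminate c y j ≤ K := by
  rw [eliminate]
  split_ifs
  · exact (freeLabel_ne _ _).2.2.trans hK
  · exact h j

/-- The rounds lose `k` positions on the left and each elimination loses one on both sides. In an
elimination two neighbours cannot both carry the eliminated label, so a replaced label faces an
unchanged neighbour. -/
theorem finalLabel_ne {k : ℕ} {X : ℕ → ℕ} {s e : ℕ} (h : ∀ j, s ≤ j → j < e → X j ≠ X (j + 1)) :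
    ∀ j, s + k + 3 ≤ j → j + 3 < e → finalLabel k X j ≠ finalLabel k X (j + 1) := by
  intro j h1 h2
  exact eliminate_ne (e := e - 2) 3 (fun j h1 h2 => eliminate_ne (e := e - 1) 4
    (fun j h1 h2 => eliminate_ne 5 (fun j h1 h2 => reduced_ne h k j h1 h2) j h1 (by omega))
    j h1 (by omega)) j (by omega) (by omega)

theorem finalLabel_le {k K : ℕ} {X : ℕ → ℕ} (hK : 2 ≤ K) (h : ∀ j, reduced X k j ≤ K) (j : ℕ) :
    finalLabel k X j ≤ K :=
  eliminate_le 3 hK (eliminate_le 4 hK (eliminate_le 5 hK h)) j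

/-- Bounded labels with different neighbours have a local maximum in every long interval. -/
theorem exists_isLocalMax {y : ℕ → ℕ} {K c : ℕ} (hK : ∀ j, y j ≤ K)
    (h : ∀ j, c ≤ j → j ≤ c + 2 * K + 1 → y j ≠ y (j + 1)) :
    ∃ j, c < j ∧ j ≤ c + 2 * K + 1 ∧ IsLocalMax y j := by
  -- More than `K` descents in a row would make a label negative. After the ascent found here, an
  -- unbroken sequence of further ascents would exceed `K`, and the first descent behind it yields
  -- the maximum.
  have hasc : ∃ i ≤ K, y (c + i) < y (c + i + 1) := by
    by_contra hcon
    push Not at hcon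
    have : ∀ i ≤ K + 1, y (c + i) + i ≤ K := by
      intro i
      induction i with
      | zero => intro _; exact hK _
      | succ i ih =>
        intro hi
        have h1 := ih (by omega)
        have h2 := hcon i (by omega)
        have h3 := h (c + i) (by omega) (by omega)
        rw [show c + (i + 1) = c + i + 1 by omega]; omega
    have := this (K + 1) le_rfl
    omega
  obtain ⟨i, hi, hi'⟩ := hasc
  have hdesc : ∃ t, t ≤ K ∧ y (c + i + 1 + t + 1) < y (c + i + 1 + t) := by
    by_contra hcon
    push Not at hcon
    have : ∀ t ≤ K, t + 1 ≤ y (c + i + 1 + t) := by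
      intro t
      induction t with
      | zero => intro _; simp; omega
      | succ t ih =>
        intro ht
        have h1 := ih (by omega)
        have h2 := hcon t (by omega)
        have h3 := h (c + i + 1 + t) (by omega) (by omega)
        rw [← Nat.add_assoc]; omega
    have := this K le_rfl
    have := hK (c + i + 1 + K)
    omega
  classical
  have hspec := Nat.find_spec hdesc
  have hmin := fun t => Nat.find_min hdesc (m := t)
  generalize Nat.find hdesc = t at hspec hmin
  refine ⟨c + i + 1 + t, by omega, by omega, ?_, hspec.2⟩
  cases t with
  | zero => simpa using hi'
  | succ t =>
    have h1 := hmin t (by omega)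
    have h2 := h (c + i + 1 + t) (by omega) (by omega)
    rw [show c + i + 1 + (t + 1) - 1 = c + i + 1 + t by omega, ← Nat.add_assoc]
    have : ¬ y (c + i + 1 + t + 1) < y (c + i + 1 + t) := fun h => h1 ⟨by omega, h⟩
    omega

/-! ## Runs between block boundaries -/

/-- A longer window would contain a local maximum of the final labels, and hence a sure cut. The
bound has room for `k + 5` positions before the search, the `2 K + 1` positions of
`exists_isLocalMax`, the right margin of a cut and the length condition of type 2. -/
theorem length_le_of_not_sure {k m K : ℕ} {X : ℕ → ℕ} (hK2 : 2 ≤ K) (hK : ∀ j, reduced X k j ≤ K)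
    {s e : ℕ} (h : ∀ j, s ≤ j → j < e → InnerSolo X m j)
    (hs : ∀ q, s < q → q < e → ¬ Sure k X m q) : e ≤ s + (2 * k + 2 * K + 16) := by
  by_contra hlt
  have hne : ∀ j, s ≤ j → j < e → X j ≠ X (j + 1) := fun j h1 h2 => (h j h1 h2).2.2.2
  obtain ⟨j, h1, h2, h3⟩ := exists_isLocalMax (y := finalLabel k X) (c := s + k + 5)
    (finalLabel_le hK2 hK) (fun j h1 h2 => finalLabel_ne hne j (by omega) (by omega))
  apply hs (j - 1) (by omega) (by omega)
  refine Or.inr ⟨s, e, by omega, by omega, by omega, h, Or.inl ?_⟩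
  rwa [show j - 1 + 1 = j by omega]

/-- Once two neighbouring symbols of the segment differ, no repetition can begin any more, as its
start would be sure. So the segment consists of one symbol, one repetition, a repetition-free
stretch bounded by `length_le_of_not_sure`, and three symbols too close to the end to decide. -/
theorem numRuns_segment_le {k K : ℕ} {p : List ℕ} {nm : ℕ → ℕ}
    (hinj : ∀ a ∈ p, ∀ b ∈ p, nm a = nm b → a = b) (hK2 : 2 ≤ K)
    (hK : ∀ j, reduced (nameAt nm p) k j ≤ K) {a b : ℕ} (hb : b ≤ p.length)
    (hs : ∀ q, a < q → q < b → ¬ Sure k (nameAt nm p) p.length q) :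
    numRuns ((p.take b).drop a) ≤ 2 * k + 2 * K + 21 := by
  classical
  set X := nameAt nm p with hX
  have hXeq : ∀ i (hi : i < p.length), X i = nm p[i] := by
    intro i hi
    simp [hX, nameAt, List.getD, hi]
  by_cases hab : b ≤ a + 4
  · refine (numRuns_le_length _).trans ?_
    simp only [List.length_drop, List.length_take]; omega
  -- The first change of symbol, or `b - 3` if there is none before. The search starts at `a + 2`
  -- because a `SureStart` needs two positions in front of it, even when `a = 0`.
  have hex : ∃ q, a + 2 ≤ q ∧ (X (q - 1) ≠ X q ∨ b - 3 ≤ q) := ⟨b, by omega, Or.inr (by omega)⟩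
  have hq := Nat.find_spec hex
  have hmin := fun t => Nat.find_min hex (m := t)
  have hle : Nat.find hex ≤ b - 3 := Nat.find_min' hex ⟨by omega, Or.inr le_rfl⟩
  generalize Nat.find hex = q at hq hmin hle
  have hsolo : ∀ j, q ≤ j → j < b - 3 → X (j - 1) ≠ X j ∧ X j ≠ X (j + 1) := by
    intro j h1
    induction j, h1 using Nat.le_induction with
    | base =>
      intro h2
      have h3 := hq.2.resolve_right (by omega)
      refine ⟨h3, fun h4 => hs q (by omega) (by omega) (Or.inl ⟨by omega, by omega, h3, Or.inl h4⟩)⟩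
    | succ j h1 ih =>
      intro h2
      have h3 := (ih (by omega)).2
      refine ⟨by simpa using h3, fun h4 => hs (j + 1) (by omega) (by omega)
        (Or.inl ⟨by omega, by omega, by simpa using h3, Or.inl h4⟩)⟩
  have hlen := length_le_of_not_sure (m := p.length) hK2 hK (s := q) (e := b - 3)
    (fun j h1 h2 => ⟨by omega, by omega, hsolo j h1 h2⟩) (fun j h1 h2 => hs j (by omega) (by omega))
  have hsplit : (p.take b).drop a = ((p.take b).drop a).take 1 ++
      ((((p.take b).drop (a + 1)).take (q - (a + 1))) ++ (p.take b).drop q) := by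
    conv_lhs => rw [← List.take_append_drop 1 ((p.take b).drop a), List.drop_drop]
    congr 1
    conv_lhs => rw [← List.take_append_drop (q - (a + 1)) ((p.take b).drop (a + 1)), List.drop_drop]
    rw [show a + 1 + (q - (a + 1)) = q by omega]
  rw [hsplit]
  have h1 := numRuns_append_le (((p.take b).drop a).take 1)
    (((((p.take b).drop (a + 1)).take (q - (a + 1))) ++ (p.take b).drop q))
  have h2 := numRuns_append_le (((p.take b).drop (a + 1)).take (q - (a + 1))) ((p.take b).drop q)
  have h3 := numRuns_le_length (((p.take b).drop a).take 1)
  have h4 := numRuns_le_length ((p.take b).drop q)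
  have h5 : numRuns (((p.take b).drop (a + 1)).take (q - (a + 1))) ≤ 1 := by
    apply numRuns_le_one
    rw [List.isChain_iff_getElem]
    intro i hi
    simp only [List.length_take, List.length_drop] at hi
    simp only [List.getElem_take, List.getElem_drop]
    apply hinj _ (List.getElem_mem _) _ (List.getElem_mem _)
    rw [← hXeq _ (by omega), ← hXeq _ (by omega)]
    have h6 := hmin (a + 1 + (i + 1)) (by omega)
    by_contra hne
    apply h6
    refine ⟨by omega, Or.inl ?_⟩
    rwa [show a + 1 + (i + 1) - 1 = a + 1 + i by omega]
  simp only [List.length_take, List.length_drop] at h3 h4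
  omega

theorem parseBlocks_le {rev : ℕ → ℕ → ℕ} {M : ℕ} (hrev : ∀ x y, rev x y ≤ M) (F : ℕ → Prop)
    (p : List ℕ) (i e : ℕ) : ∀ a ∈ parseBlocks rev F p i e, a ≤ M := by
  induction h : e - i using Nat.strong_induction_on generalizing i with
  | _ d ih =>
    rw [parseBlocks]
    split_ifs with h1 h2
    · intro a ha
      rcases List.mem_cons.1 ha with rfl | ha
      · exact hrev _ _
      · exact ih (e - (i + 3)) (by omega) (i + 3) rfl a ha
    · intro a ha
      rcases List.mem_cons.1 ha with rfl | ha
      · exact hrev _ _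
      · exact ih (e - (i + 2)) (by omega) (i + 2) rfl a ha
    · simp

/-- Every level contributes two kept segments, and halving the length decreases the logarithm by
one. Injectivity of the names turns equal names into equal symbols; it has to cover `M` too, the
value of failing queries. -/
theorem numRuns_evidence_le {k K M : ℕ} {nm : ℕ → ℕ} {rev : ℕ → ℕ → ℕ}
    (hinj : Set.InjOn nm (Set.Iic M)) (hrev : ∀ x y, rev x y ≤ M) (hK2 : 2 ≤ K)
    (hK : ∀ p : List ℕ, (∀ a ∈ p, a ≤ M) → ∀ j, reduced (nameAt nm p) k j ≤ K) (p : List ℕ)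
    (hp : ∀ a ∈ p, a ≤ M) :
    numRuns (evidence k nm rev p) ≤
      (if p = [] then 0 else Nat.log 2 p.length + 1) * (2 * (2 * k + 2 * K + 21)) := by
  induction h : p.length using Nat.strong_induction_on generalizing p with
  | _ d ih =>
    rw [evidence]
    split_ifs with h0
    · simp [numRuns]
    have hpos : 0 < p.length := List.length_pos_iff.2 h0
    have hc := two_mul_length_core_le k nm rev p
    have ih' := ih _ (by omega) (core k nm rev p) (parseBlocks_le hrev _ _ _ _) rfl
    have hinj' : ∀ a ∈ p, ∀ b ∈ p, nm a = nm b → a = b := fun a ha b hb hab =>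
      hinj (hp a ha) (hp b hb) hab
    have h1 := numRuns_segment_le hinj' hK2 (hK p hp) (a := 0)
      (b := firstSure k (nameAt nm p) p.length) firstSure_le
      (fun q _ h2 => not_sure_of_lt_firstSure h2)
    have h2 := numRuns_segment_le hinj' hK2 (hK p hp)
      (a := lastSure k (nameAt nm p) p.length) (b := p.length) le_rfl
      (fun q h2 _ h3 => by have := le_lastSure h3; omega)
    rw [List.drop_zero] at h1
    rw [List.take_length] at h2
    have h3 := numRuns_append_le (p.take (firstSure k (nameAt nm p) p.length) ++
      evidence k nm rev (core k nm rev p)) (p.drop (lastSure k (nameAt nm p) p.length))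
    have h4 := numRuns_append_le (p.take (firstSure k (nameAt nm p) p.length))
      (evidence k nm rev (core k nm rev p))
    have h5 : (if core k nm rev p = [] then 0 else Nat.log 2 (core k nm rev p).length + 1)
        ≤ Nat.log 2 p.length := by
      split_ifs with h6
      · omega
      · have h7 : 0 < (core k nm rev p).length := List.length_pos_iff.2 h6
        rw [← Nat.log_mul_base (by norm_num) (by omega)]
        exact Nat.log_mono_right (by omega)
    have h6 := Nat.mul_le_mul_right (2 * (2 * k + 2 * K + 21)) h5
    rw [h] at h6
    rw [Nat.add_mul]
    omega

/-! ## The iterated logarithm -/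

/-- Since `lg x ≤ x - 1` for `x ≥ 2`, each application lowers the value by at least one. So the set
that defines `lgStar` is non-empty, and `lgStar u ≤ u`, which is what the word size needs. -/
theorem exists_iterate_logb_le (n : ℕ) : ∀ x : ℝ, 0 ≤ x → x ≤ n + 2 →
    ∃ i, 1 ≤ i ∧ i ≤ n + 1 ∧ (Real.logb 2)^[i] x ≤ 1 := by
  have hlow : ∀ x : ℝ, 0 ≤ x → x ≤ 2 → Real.logb 2 x ≤ 1 := by
    intro x h0 h2
    rcases eq_or_lt_of_le h0 with rfl | h0
    · simp
    · rw [← Real.logb_self_eq_one (b := 2) (by norm_num)]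
      exact Real.logb_le_logb_of_le (by norm_num) h0 h2
  induction n with
  | zero => intro x h0 h2; exact ⟨1, le_rfl, le_rfl, by simpa using hlow x h0 (by simpa using h2)⟩
  | succ n ih =>
    intro x h0 h2
    rcases le_or_gt x 2 with h | h
    · exact ⟨1, le_rfl, by omega, by simpa using hlow x h0 h⟩
    · have h3 : Real.logb 2 x ≤ x - 1 := by
        rw [Real.logb_le_iff_le_rpow (by norm_num) (by linarith)]
        have h4 := one_add_mul_self_le_rpow_one_add (s := 1) (by norm_num) (p := x - 1) (by linarith)
        norm_num at h4
        linarith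
      have h4 : 0 ≤ Real.logb 2 x := Real.logb_nonneg (by norm_num) (by linarith)
      obtain ⟨i, h5, h6, h7⟩ := ih (Real.logb 2 x) h4 (by push_cast at h2; linarith)
      exact ⟨i + 1, by omega, by omega, by rwa [Function.iterate_succ_apply]⟩

theorem lgStar_spec {u : ℕ} (hu : 2 ≤ u) : 1 ≤ lgStar u ∧ (Real.logb 2)^[lgStar u] (u : ℝ) ≤ 1 ∧
    lgStar u ≤ u := by
  obtain ⟨i, h1, h2, h3⟩ := exists_iterate_logb_le (u - 2) u (by positivity) (by
    have : ((u - 2 : ℕ) : ℝ) = u - 2 := by push_cast [hu]; ring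
    rw [this]; linarith)
  have h4 : lgStar u ∈ {i : ℕ | 1 ≤ i ∧ (Real.logb 2)^[i] (u : ℝ) ≤ 1} := Nat.sInf_mem ⟨i, h1, h3⟩
  have h5 : lgStar u ≤ i := Nat.sInf_le ⟨h1, h3⟩
  exact ⟨h4.1, h4.2, by omega⟩

theorem one_lt_of_lt_lgStar {u i : ℕ} (hu : 2 ≤ u) (hi : i < lgStar u) :
    1 < (Real.logb 2)^[i] (u : ℝ) := by
  rcases Nat.eq_zero_or_pos i with rfl | h
  · have : (2 : ℝ) ≤ u := by exact_mod_cast hu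
    simp; linarith
  · by_contra hcon
    push Not at hcon
    have : lgStar u ≤ i := Nat.sInf_le ⟨h, hcon⟩
    omega

theorem reduceLabel_le_logb {a b : ℕ} {M : ℝ} (hM : 1 ≤ M) (ha : (a : ℝ) ≤ M) (hb : (b : ℝ) ≤ M) :
    (reduceLabel a b : ℝ) ≤ 2 * Real.logb 2 M + 1 := by
  have hpos : 0 ≤ Real.logb 2 M := Real.logb_nonneg (by norm_num) hM
  rcases Nat.eq_zero_or_pos (max a b) with h | h
  · have ha0 : a = 0 := by omega
    have hb0 : b = 0 := by omega
    subst ha0 hb0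
    rw [show reduceLabel 0 0 = 0 by simp [reduceLabel, lowDiff]]
    push_cast; linarith
  · have h1 : max a b < 2 ^ (Nat.log 2 (max a b) + 1) := Nat.lt_pow_succ_log_self (by norm_num) _
    have h2 := reduceLabel_lt (e := Nat.log 2 (max a b) + 1) (by omega)
      (lt_of_le_of_lt (le_max_left a b) h1) (lt_of_le_of_lt (le_max_right a b) h1)
    have h3 : (reduceLabel a b : ℝ) ≤ 2 * (Nat.log 2 (max a b) : ℕ) + 1 := by
      exact_mod_cast (by omega : reduceLabel a b ≤ 2 * Nat.log 2 (max a b) + 1)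
    have h4 := Real.natLog_le_logb (max a b) 2
    have h5 : Real.logb 2 (max a b : ℕ) ≤ Real.logb 2 M := by
      apply Real.logb_le_logb_of_le (by norm_num) (by exact_mod_cast h)
      push_cast; exact max_le ha hb
    push_cast at h4 h5
    linarith

/-- The labels follow the iterated logarithm of `u` up to a fixed factor, and after `lgStar u`
rounds that logarithm is at most `1`. The labels need not fall below `6`; a bound that depends only
on σ is enough to force local maxima. -/
theorem reduced_le_of_lgStar {u σ : ℕ} (hu : 2 ≤ u) {X : ℕ → ℕ} (hX : ∀ j, X j ≤ u + σ) (j : ℕ) :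
    reduced X (lgStar u) j ≤ 2 * (16 + σ) := by
  -- The number `16` is large enough for `2 lg A + 3 ≤ A`, the inequality that reproduces the
  -- invariant from round to round.
  set A : ℝ := 16 + σ with hA
  have hA16 : (16 : ℝ) ≤ A := by rw [hA]; linarith [(Nat.cast_nonneg σ : (0 : ℝ) ≤ σ)]
  have hlogA : 2 * Real.logb 2 A + 3 ≤ A := by
    have h1 : Real.log A = 4 * Real.log 2 + Real.log (A / 16) := by
      rw [Real.log_div (by linarith) (by norm_num), show (16 : ℝ) = 2 ^ 4 by norm_num,
        Real.log_pow]; push_cast; ring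
    have h2 : Real.log (A / 16) ≤ A / 16 - 1 := Real.log_le_sub_one_of_pos (by linarith)
    have h3 := Real.log_two_gt_d9
    have h4 : Real.logb 2 A ≤ 4 + 2 * (A / 16 - 1) := by
      rw [Real.logb, div_le_iff₀ (by linarith), h1]
      nlinarith
    linarith
  -- Before the last round the iterate `v` exceeds `1`, so `lg (v + 1) ≤ 1 + lg v`, and the new
  -- label is at most `2 lg A + 3 + 2 lg v ≤ A (lg v + 1)`.
  have key : ∀ i ≤ lgStar u, ∀ j, (reduced X i j : ℝ) ≤ A * ((Real.logb 2)^[i] (u : ℝ) + 1) := by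
    intro i
    induction i with
    | zero =>
      intro _ j
      have h1 : (X j : ℝ) ≤ u + σ := by exact_mod_cast hX j
      have h2 : (2 : ℝ) ≤ u := by exact_mod_cast hu
      have h3 : (0 : ℝ) ≤ σ := Nat.cast_nonneg σ
      simp only [reduced, Function.iterate_zero, id]
      rw [hA]; nlinarith
    | succ i ih =>
      intro hi j
      have h1 := one_lt_of_lt_lgStar hu (show i < lgStar u by omega)
      have ih := ih (by omega)
      rw [Function.iterate_succ_apply', reduced]
      generalize (Real.logb 2)^[i] (u : ℝ) = v at *
      have h2 := reduceLabel_le_logb (M := A * (v + 1)) (by nlinarith) (ih (j - 1)) (ih j)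
      have h3 : Real.logb 2 (A * (v + 1)) ≤ Real.logb 2 A + (1 + Real.logb 2 v) := by
        rw [Real.logb_mul (by linarith) (by linarith)]
        have : Real.logb 2 (v + 1) ≤ Real.logb 2 (2 * v) :=
          Real.logb_le_logb_of_le (by norm_num) (by linarith) (by linarith)
        rw [Real.logb_mul (by norm_num) (by linarith), Real.logb_self_eq_one (by norm_num)] at this
        linarith
      have h4 : 0 < Real.logb 2 v := Real.logb_pos (by norm_num) h1
      nlinarith
  have h1 := key _ le_rfl j
  have h2 := (lgStar_spec hu).2.1
  have h3 : (reduced X (lgStar u) j : ℝ) ≤ 2 * (16 + σ) := by rw [← hA]; nlinarith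
  exact_mod_cast h3

/-! ## Filling an array -/

theorem Expr.eval_reg_of {w x a : ℕ} {s : State} (h : s.reg x = a) :
    (Expr.reg x).eval w s = a := h

/-- The entry with index `f` of the array whose address is in the register `r`. -/
def Expr.entry (r : ℕ) (f : Expr) : Expr := .load (.bin .plus (.reg r) f)

theorem Expr.eval_entry {w r a b : ℕ} {s : State} {f : Expr} (hr : s.reg r = b)
    (hf : f.eval w s = a) (h : b + a < 2 ^ w) : (Expr.entry r f).eval w s = s.mem (b + a) :=
  Expr.eval_load (Expr.eval_plus (Expr.eval_reg_of hr) hf h)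

/-- Fill the array at the address in the register `base` with `cnt` values; the program `body`
writes the value for the index in register `32` to register `33`. -/
def fill (cnt base : ℕ) (body : Program) : Program :=
  .seq (.assign 32 (.lit 0)) (.loop (.bin .less (.reg 32) (.reg cnt)) (.seq body
    (.seq (.store (.bin .plus (.reg base) (.reg 32)) (.reg 33))
      (.assign 32 (.bin .plus (.reg 32) (.lit 1))))))

/-- The registers below `n` have the same contents. -/
def Frame (n : ℕ) (s s' : State) : Prop := ∀ r < n, s'.reg r = s.reg r

theorem Frame.mono {n n' : ℕ} {s s' : State} (h : Frame n s s') (hn : n' ≤ n) : Frame n' s s' :=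
  fun r hr => h r (by omega)

theorem Frame.trans {n : ℕ} {s s' s'' : State} (h : Frame n s s') (h' : Frame n s' s'') :
    Frame n s s'' := fun r hr => (h' r hr).trans (h r hr)

section Fill

variable {E : Env} {e R : ℕ}

/-- The hypothesis on the body also provides the entries already written, so passes that compute a
recurrence are covered. -/
theorem Env.Ok.wp_fill (H : E.Ok e R) {cnt base : ℕ} {body : Program} {s : State} (hc : cnt < 32)
    (hb : base < 32) {N b : ℕ} (hN : s.reg cnt = N) (hbase : s.reg base = b)
    (hW : b + N + 2 ≤ 2 ^ E.w) (f : ℕ → ℕ) (τ : ℕ)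
    (hbody : ∀ j s', j < N → Frame 32 s s' → s'.reg 32 = j →
      (∀ a, a < b ∨ b + N ≤ a → s'.mem a = s.mem a) → (∀ i < j, s'.mem (b + i) = f i) →
      E.wp body s' τ (fun s'' => Frame 32 s s'' ∧ s''.reg 32 = j ∧ s''.reg 33 = f j ∧
        s''.mem = s'.mem)) :
    E.wp (fill cnt base body) s (N * (τ + 13) + 6) (fun s' => Frame 32 s s' ∧
      (∀ a, a < b ∨ b + N ≤ a → s'.mem a = s.mem a) ∧ ∀ i < N, s'.mem (b + i) = f i) := by
  have hinit : E.wp (.assign 32 (.lit 0)) s 2 (fun s' => Frame 32 s s' ∧ s'.reg 32 = 0 ∧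
      (∀ a, a < b ∨ b + N ≤ a → s'.mem a = s.mem a) ∧ ∀ i < 0, s'.mem (b + i) = f i) := by
    refine H.assign (by decide) ⟨fun r hr => ?_, ?_, fun _ _ => rfl, by simp⟩
    · rw [State.setReg_reg, if_neg (by omega)]
    · rw [State.setReg_reg, if_pos rfl, Expr.eval_lit (by omega)]
  refine (hinit.seq (V := N * (τ + 13) + 4) fun s0 h0 => ?_).mono (by omega) fun _ h => h
  refine (H.loopFor N (τ + 9) (fun j s' => Frame 32 s s' ∧ s'.reg 32 = j ∧
      (∀ a, a < b ∨ b + N ≤ a → s'.mem a = s.mem a) ∧ ∀ i < j, s'.mem (b + i) = f i)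
      ?_ ?_ h0 (U := N * (τ + 13) + 4) ?_).mono le_rfl
      fun s' h => ⟨h.1, h.2.2⟩
  · rintro j s1 hj ⟨h1, h2, h3, h4⟩
    refine ⟨((Expr.tests_less (by omega) (Expr.eval_reg_of h2) (Expr.eval_reg_of ((h1 cnt hc).trans hN))).ne_zero_iff).2 hj, ?_⟩
    refine ((hbody j s1 hj h1 h2 h3 h4).seq (V := 9) fun s2 ⟨g1, g2, g3, g4⟩ => ?_)
    have hst : E.wp (.store (.bin .plus (.reg base) (.reg 32)) (.reg 33)) s2 5 (fun s3 =>
        s3 = s2.setMem (b + j) (f j)) := by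
      refine H.store (by simp [Expr.cost]) ?_
      rw [Expr.eval_plus (a := b) (b := j) (Expr.eval_reg_of ((g1 base hb).trans hbase)) (Expr.eval_reg_of g2) (by omega),
        Expr.eval_reg, g3]
    refine (hst.seq (V := 4) fun s3 h => ?_).mono le_rfl fun _ h => h
    subst h
    refine H.assign (by decide) ⟨fun r hr => ?_, ?_, ?_, ?_⟩
    · rw [State.setReg_reg, if_neg (by omega)]; exact g1 r hr
    · rw [State.setReg_reg, if_pos rfl]
      exact Expr.eval_plus (Expr.eval_reg_of g2) (Expr.eval_lit (by omega)) (by omega)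
    · intro a ha
      rw [State.setReg_mem, State.setMem_mem, if_neg (by omega), g4, h3 a ha]
    · intro i hi
      rw [State.setReg_mem, State.setMem_mem]
      rcases Nat.lt_or_ge i j with h | h
      · rw [if_neg (by omega), g4, h4 i h]
      · obtain rfl : i = j := by omega
        rw [if_pos rfl]
  · rintro s1 ⟨h1, h2, -⟩
    exact ((Expr.tests_less (by omega) (Expr.eval_reg_of h2) (Expr.eval_reg_of ((h1 cnt hc).trans hN))).eq_zero_iff).2 (by omega)
  · simp only [Expr.cost]
    rw [show τ + 9 + (1 + 1 + 1) + 1 = τ + 13 by omega]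

theorem Env.Ok.wp_fillExpr (H : E.Ok e R) {cnt base : ℕ} {g : Expr} {s : State} (hc : cnt < 32)
    (hb : base < 32) {N b : ℕ} (hN : s.reg cnt = N) (hbase : s.reg base = b)
    (hW : b + N + 2 ≤ 2 ^ E.w) (f : ℕ → ℕ)
    (hbody : ∀ j s', j < N → Frame 32 s s' → s'.reg 32 = j →
      (∀ a, a < b ∨ b + N ≤ a → s'.mem a = s.mem a) → (∀ i < j, s'.mem (b + i) = f i) →
      g.eval E.w s' = f j) :
    E.wp (fill cnt base (.assign 33 g)) s (N * (g.cost + 14) + 6) (fun s' => Frame 32 s s' ∧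
      (∀ a, a < b ∨ b + N ≤ a → s'.mem a = s.mem a) ∧ ∀ i < N, s'.mem (b + i) = f i) := by
  refine H.wp_fill hc hb hN hbase hW f (g.cost + 1) (fun j s' h1 h2 h3 h4 h5 => ?_)
  refine H.assign le_rfl ⟨fun r hr => ?_, ?_, ?_, rfl⟩
  · rw [State.setReg_reg, if_neg (by omega)]; exact h2 r hr
  · rw [State.setReg_reg, if_neg (by omega)]; exact h3
  · rw [State.setReg_reg, if_pos rfl]; exact hbody j s' h1 h2 h3 h4 h5

end Fill

/-! ## The memory layout -/

/-- Bounds that exclude overflows, and the number `e` of bits of a name. -/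
structure Env.Fits (E : Env) (k M e : ℕ) : Prop where
  word : 32 * M + 4 * k + 4 * E.G.numSymbols + 64 ≤ 2 ^ E.w
  bits : E.G.numSymbols < 2 ^ e
  one_le : 1 ≤ e
  pow_le : 2 ^ e ≤ 2 * E.G.numSymbols

/-- The constant registers: the parameter `k`, the length `m` of the current string, the number of
symbols and the addresses of the arrays, which are multiples of `M`. -/
structure Layout (E : Env) (k M m : ℕ) (s : State) : Prop where
  r4 : s.reg 4 = k
  r5 : s.reg 5 = m
  r8 : s.reg 8 = E.G.numSymbols
  r9 : s.reg 9 = M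
  r10 : s.reg 10 = 2 * M
  r11 : s.reg 11 = 3 * M
  r12 : s.reg 12 = 4 * M
  r13 : s.reg 13 = 5 * M
  r14 : s.reg 14 = 6 * M
  r23 : s.reg 23 = 7 * M
  r24 : s.reg 24 = 8 * M

theorem Layout.frame {E : Env} {k M m : ℕ} {s s' : State} (h : Layout E k M m s)
    (hf : Frame 31 s s') : Layout E k M m s' :=
  ⟨(hf 4 (by omega)).trans h.r4, (hf 5 (by omega)).trans h.r5,
    (hf 8 (by omega)).trans h.r8, (hf 9 (by omega)).trans h.r9, (hf 10 (by omega)).trans h.r10,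
    (hf 11 (by omega)).trans h.r11, (hf 12 (by omega)).trans h.r12, (hf 13 (by omega)).trans h.r13,
    (hf 14 (by omega)).trans h.r14, (hf 23 (by omega)).trans h.r23, (hf 24 (by omega)).trans h.r24⟩

/-- Result of a pass: the array at address `b` contains the values of `f`, and the rest of the memory
and the lower registers are unchanged. -/
def Filled (b N : ℕ) (f : ℕ → ℕ) (s s' : State) : Prop :=
  Frame 32 s s' ∧ (∀ a, a < b ∨ b + N ≤ a → s'.mem a = s.mem a) ∧ ∀ i < N, s'.mem (b + i) = f i

/-- Names; the number that stands for a missing variable has a name of its own. -/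
def Env.nm (E : Env) (v : ℕ) : ℕ :=
  if v < E.G.numSymbols then E.name v else E.G.numSymbols

section Passes

variable {E : Env} {e R k M m : ℕ} {s : State}

/-- Compute the names of the symbols. -/
def namesPass : Program :=
  fill 5 9 (.seq (.assign 34 (.load (.reg 32)))
    (.cond (.bin .less (.reg 34) (.reg 8)) (.name 33 (.reg 34)) (.assign 33 (.reg 8))))

theorem Env.Ok.wp_namesPass (H : E.Ok e R) (hE : IsNaming E.G E.name) (hF : E.Fits k M e)
    (hL : Layout E k M m s) (hm : m ≤ M) : E.wp namesPass s (m * 22 + 6)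
      (Filled M m (fun j => E.nm (s.mem j)) s) := by
  have hW := hF.word
  refine (H.wp_fill (τ := 9) (by omega) (by omega) hL.r5 hL.r9 (by omega)
    (fun j => E.nm (s.mem j)) ?_).mono (by omega) fun s' h => h
  intro j s' hj h1 h2 h3 h4
  have hload : E.wp (.assign 34 (.load (.reg 32))) s' 3 (fun s'' => s'' = s'.setReg 34 (s.mem j)) := by
    refine H.assign (by decide) ?_
    rw [Expr.eval_load (a := j) (Expr.eval_reg_of h2), h3 j (by omega)]
  refine (hload.seq (V := 6) fun s'' h => ?_).mono (by omega) fun _ h => h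
  subst h
  have e34 : (s'.setReg 34 (s.mem j)).reg 34 = s.mem j := by rw [State.setReg_reg, if_pos rfl]
  have hlow : ∀ r, r ≠ 34 → (s'.setReg 34 (s.mem j)).reg r = s'.reg r := fun r hr => by
    rw [State.setReg_reg, if_neg hr]
  have e8 : (s'.setReg 34 (s.mem j)).reg 8 = E.G.numSymbols := by
    rw [hlow 8 (by omega), h1 8 (by omega)]; exact hL.r8
  have htest := Expr.tests_less (w := E.w) (e := .reg 34) (f := .reg 8) (by omega)
    (Expr.eval_reg_of e34) (Expr.eval_reg_of e8)
  by_cases hlt : s.mem j < E.G.numSymbols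
  · refine H.condTrue (U := 2) (htest.ne_zero_iff.2 hlt) (H.name (by decide) ?_) (by decide)
    refine ⟨fun r hr => ?_, ?_, ?_, rfl⟩
    · rw [State.setReg_reg, if_neg (by omega), hlow r (by omega)]; exact h1 r hr
    · rw [State.setReg_reg, if_neg (by omega), hlow 32 (by omega)]; exact h2
    · rw [State.setReg_reg, if_pos rfl, Expr.eval_reg, e34, Env.nm, if_pos hlt]
      have := hE.2 _ hlt
      exact Nat.mod_eq_of_lt (by omega)
  · refine H.condFalse (U := 2) (htest.eq_zero_iff.2 hlt) (H.assign (by decide) ?_) (by decide)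
    refine ⟨fun r hr => ?_, ?_, ?_, rfl⟩
    · rw [State.setReg_reg, if_neg (by omega), hlow r (by omega)]; exact h1 r hr
    · rw [State.setReg_reg, if_neg (by omega), hlow 32 (by omega)]; exact h2
    · rw [State.setReg_reg, if_pos rfl, Expr.eval_reg, e8, Env.nm, if_neg hlt]

/-- Copy the array at `src` to `dst`. -/
def copyPass (src dst : ℕ) : Program := fill 5 dst (.assign 33 (.entry src (.reg 32)))

theorem Env.Ok.wp_copyPass (H : E.Ok e R) (hF : E.Fits k M e) (hL : Layout E k M m s) (hm : m ≤ M)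
    {src dst b b' : ℕ} (h1 : src < 31) (h2 : dst < 31) (hb : s.reg src = b) (hb' : s.reg dst = b')
    (hd : b + M ≤ b' ∨ b' + M ≤ b) (hle : b ≤ 9 * M) (hle' : b' ≤ 9 * M) :
    E.wp (copyPass src dst) s (m * 18 + 6) (Filled b' m (fun j => s.mem (b + j)) s) := by
  have hW := hF.word
  refine (H.wp_fillExpr (by omega) (by omega) hL.r5 hb' (by omega)
    (fun j => s.mem (b + j)) ?_).mono (by simp [Expr.cost, Expr.entry])
    fun s' h => h
  intro j s' hj g1 g2 g3 g4
  rw [Expr.eval_entry ((g1 src (by omega)).trans hb) (Expr.eval_reg_of g2) (by omega), g3 _ (by omega)]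

theorem lowDiff_succ {a b : ℕ} (h : a ≠ b) (h2 : a % 2 = b % 2) :
    lowDiff a b = lowDiff (a / 2) (b / 2) + 1 := by
  conv_lhs => rw [lowDiff]
  rw [dif_neg h, if_pos h2]

theorem lowDiff_eq_zero {a b : ℕ} (h : ¬ (a ≠ b ∧ a % 2 = b % 2)) : lowDiff a b = 0 := by
  rw [lowDiff]
  split_ifs with h1 h2
  · rfl
  · exact absurd ⟨h1, h2⟩ h
  · rfl

/-- The search for the lowest differing bit of the registers `34` and `35`. -/
def lowDiffLoop : Program :=
  .loop (.bin .less (.bin .equal (.reg 34) (.reg 35))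
      (.bin .equal (.bin .rem (.reg 34) (.lit 2)) (.bin .rem (.reg 35) (.lit 2))))
    (.seq (.assign 34 (.bin .quot (.reg 34) (.lit 2)))
    (.seq (.assign 35 (.bin .quot (.reg 35) (.lit 2)))
      (.assign 36 (.bin .plus (.reg 36) (.lit 1)))))

/-- Both numbers are halved as long as they differ but have equal parity; the decreasing number
bounds their remaining bits. The loop test compares two truth values with `less`, which expresses
exactly "not equal, but of equal parity". -/
theorem Env.Ok.wp_lowDiffLoop (H : E.Ok e R) {a b i : ℕ} {s₀ : State}
    (hi : i + 4 ≤ 2 ^ E.w) (ha : a < 2 ^ i) (hb : b < 2 ^ i) (hew : 2 ^ i ≤ 2 ^ E.w)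
    (h0 : Frame 33 s₀ s) (hmem : s.mem = s₀.mem) (h34 : s.reg 34 = a) (h35 : s.reg 35 = b)
    (h36 : s.reg 36 = 0) :
    E.wp lowDiffLoop s (i * 24 + 12)
      (fun s' => Frame 33 s₀ s' ∧ s'.mem = s₀.mem ∧ s'.reg 36 = lowDiff a b ∧
        s'.reg 35 = b / 2 ^ lowDiff a b) := by
  refine H.loop (fun i => i * 24 + 12) (fun i' s => i' ≤ i ∧ Frame 33 s₀ s ∧ s.mem = s₀.mem ∧
    s.reg 34 < 2 ^ i' ∧ s.reg 35 < 2 ^ i' ∧ s.reg 36 + i' = i ∧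
    lowDiff a b = s.reg 36 + lowDiff (s.reg 34) (s.reg 35) ∧
    b / 2 ^ s.reg 36 = s.reg 35) ?_ i s
    ⟨le_rfl, h0, hmem, h34 ▸ ha, h35 ▸ hb, by omega, by rw [h34, h35, h36, Nat.zero_add],
      by rw [h36, h35]; simp⟩
  rintro i' s1 ⟨g0, g1, g2, g3, g4, g5, g6, g7⟩
  have hpow : 2 ^ i' ≤ 2 ^ i := Nat.pow_le_pow_right (by omega) g0
  have htest : (Expr.bin .less (.bin .equal (.reg 34) (.reg 35))
      (.bin .equal (.bin .rem (.reg 34) (.lit 2)) (.bin .rem (.reg 35) (.lit 2)))).Tests E.w s1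
      (s1.reg 34 ≠ s1.reg 35 ∧ s1.reg 34 % 2 = s1.reg 35 % 2) := by
    refine (Expr.tests_less (by omega)
      (Expr.tests_equal (by omega) rfl rfl).eval_eq
      (Expr.tests_equal (by omega) (Expr.eval_rem rfl (Expr.eval_lit (by omega)) ?_)
        (Expr.eval_rem rfl (Expr.eval_lit (by omega)) ?_)).eval_eq).congr ?_
    · exact lt_of_lt_of_le (g3.trans_le hpow) hew
    · exact lt_of_lt_of_le (g4.trans_le hpow) hew
    · by_cases h1 : s1.reg 34 = s1.reg 35 <;> by_cases h2 : s1.reg 34 % 2 = s1.reg 35 % 2 <;>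
        simp [Expr.eval_reg, h1, h2]
  by_cases hc : s1.reg 34 ≠ s1.reg 35 ∧ s1.reg 34 % 2 = s1.reg 35 % 2
  · right
    obtain ⟨i', rfl⟩ : ∃ i'', i' = i'' + 1 := by
      refine ⟨i' - 1, ?_⟩
      rcases Nat.eq_zero_or_pos i' with rfl | h
      · exact absurd (by simp at g3 g4; omega) hc.1
      · omega
    refine ⟨htest.ne_zero_iff.2 hc, i', by omega, 12, ?_, by simp only [Expr.cost]; omega⟩
    have e1 : E.wp (.assign 34 (.bin .quot (.reg 34) (.lit 2))) s1 4
        (fun s2 => s2 = s1.setReg 34 (s1.reg 34 / 2)) :=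
      H.assign (by decide) (by
        rw [Expr.eval_quot rfl (Expr.eval_lit (by omega))
          (lt_of_lt_of_le (g3.trans_le hpow) hew)]; rfl)
    refine (e1.seq (V := 8) fun s2 h => ?_).mono (by omega) fun _ h => h
    subst h
    have e2 : E.wp (.assign 35 (.bin .quot (.reg 35) (.lit 2))) (s1.setReg 34 (s1.reg 34 / 2)) 4
        (fun s2 => s2 = (s1.setReg 34 (s1.reg 34 / 2)).setReg 35 (s1.reg 35 / 2)) :=
      H.assign (by decide) (by
        rw [Expr.eval_quot (a := s1.reg 35) (Expr.eval_reg_of (by simp [State.setReg_reg]))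
          (Expr.eval_lit (by omega)) (lt_of_lt_of_le (g4.trans_le hpow) hew)])
    refine (e2.seq (V := 4) fun s3 h => ?_).mono (by omega) fun _ h => h
    subst h
    refine H.assign (by decide) ?_
    rw [Expr.eval_plus (a := s1.reg 36) (Expr.eval_reg_of (by simp [State.setReg_reg]))
      (Expr.eval_lit (by omega)) (by omega)]
    refine ⟨by omega, fun r hr => ?_, g2, ?_, ?_, ?_, ?_, ?_⟩
    · simp only [State.setReg_reg]
      rw [if_neg (by omega), if_neg (by omega), if_neg (by omega)]; exact g1 r hr
    · simp [State.setReg_reg]; omega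
    · simp [State.setReg_reg]; omega
    · simp [State.setReg_reg]; omega
    · simp only [State.setReg_reg]
      rw [g6, lowDiff_succ hc.1 hc.2]; simp; omega
    · simp only [State.setReg_reg]
      simp only [if_true, show (35 : ℕ) ≠ 36 by omega, if_false]
      rw [pow_succ, ← Nat.div_div_eq_div_mul, g7]
  · left
    refine ⟨htest.eq_zero_iff.2 hc, by simp only [Expr.cost]; omega, g1, g2, ?_, ?_⟩
    · rw [g6, lowDiff_eq_zero hc, Nat.add_zero]
    · rw [g6, lowDiff_eq_zero hc, Nat.add_zero, g7]

end Passes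

/-! ## Alphabet reduction on the machine -/

section Reduction

variable {E : Env} {e R k M m : ℕ} {s : State}

/-- One round of alphabet reduction from the array at `10` to the array at `11`. -/
def reducePass : Program :=
  fill 5 11 (.seq (.assign 34 (.entry 10 (.bin .minus (.reg 32) (.lit 1))))
    (.seq (.assign 35 (.entry 10 (.reg 32)))
    (.seq (.assign 36 (.lit 0))
    (.seq lowDiffLoop
    (.assign 33 (.bin .plus (.bin .times (.lit 2) (.reg 36)) (.bin .rem (.reg 35) (.lit 2))))))))

theorem Env.Fits.two_mul_le (hF : E.Fits k M e) : 2 * e ≤ 2 ^ e := by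
  have : ∀ n, 2 * (n + 1) ≤ 2 ^ (n + 1) := by
    intro n
    induction n with
    | zero => norm_num
    | succ n ih => rw [pow_succ]; omega
  obtain ⟨n, rfl⟩ : ∃ n, e = n + 1 := ⟨e - 1, by have := hF.one_le; omega⟩
  exact this n

/-- At position `0` truncated subtraction makes the machine read the entry itself as its left
neighbour, in agreement with the definition of `reduced`. -/
theorem Env.Ok.wp_reducePass (H : E.Ok e R) (hF : E.Fits k M e) (hL : Layout E k M m s)
    (hm : m ≤ M) (hX : ∀ j < m, s.mem (2 * M + j) < 2 ^ e) :
    E.wp reducePass s (m * (24 * e + 47) + 6)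
      (Filled (3 * M) m (fun j => reduceLabel (s.mem (2 * M + (j - 1))) (s.mem (2 * M + j))) s) := by
  have hW := hF.word
  have hp := hF.pow_le
  have hp2 := hF.two_mul_le
  refine (H.wp_fill (τ := 24 * e + 34) (by omega) (by omega) hL.r5 hL.r11 (by omega) _ ?_).mono
    (by rw [show 24 * e + 34 + 13 = 24 * e + 47 by omega]) fun s' h => h
  intro j s' hj h1 h2 h3 h4
  have r10 : s'.reg 10 = 2 * M := (h1 10 (by omega)).trans hL.r10
  set a := s.mem (2 * M + (j - 1)) with ha
  set b := s.mem (2 * M + j) with hb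
  have e1 : E.wp (.assign 34 (.entry 10 (.bin .minus (.reg 32) (.lit 1)))) s' 7
      (fun s2 => s2 = s'.setReg 34 a) := by
    refine H.assign (by decide) ?_
    rw [Expr.eval_entry r10 (Expr.eval_minus (Expr.eval_reg_of h2) (Expr.eval_lit (by omega))
      (by omega)) (by omega), h3 _ (by omega)]
  refine (e1.seq (V := 24 * e + 27) fun s2 h => ?_).mono (by omega) fun _ h => h
  subst h
  have e2 : E.wp (.assign 35 (.entry 10 (.reg 32))) (s'.setReg 34 a) 5
      (fun s2 => s2 = (s'.setReg 34 a).setReg 35 b) := by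
    refine H.assign (by decide) ?_
    rw [Expr.eval_entry (b := 2 * M) (a := j) (by simp [State.setReg_reg, r10])
      (Expr.eval_reg_of (by simp [State.setReg_reg, h2])) (by omega), State.setReg_mem,
      h3 _ (by omega)]
  refine (e2.seq (V := 24 * e + 22) fun s2 h => ?_).mono (by omega) fun _ h => h
  subst h
  have e3 : E.wp (.assign 36 (.lit 0)) ((s'.setReg 34 a).setReg 35 b) 2
      (fun s2 => s2 = ((s'.setReg 34 a).setReg 35 b).setReg 36 0) := by
    refine H.assign (by decide) ?_
    rw [Expr.eval_lit (by omega)]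
  refine (e3.seq (V := 24 * e + 20) fun s2 h => ?_).mono (by omega) fun _ h => h
  subst h
  have e4 := H.wp_lowDiffLoop (s := ((s'.setReg 34 a).setReg 35 b).setReg 36 0) (a := a) (b := b)
    (i := e) (s₀ := s') (by omega) (hX _ (by omega)) (hX _ hj) (by omega) (fun r hr => ?_) rfl
    (by simp [State.setReg_reg]) (by simp [State.setReg_reg]) (by simp [State.setReg_reg])
  refine (e4.seq (V := 8) fun s2 ⟨g1, g2, g3, g4⟩ => ?_).mono (by omega) fun _ h => h
  rotate_left
  · simp only [State.setReg_reg]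
    rw [if_neg (by omega), if_neg (by omega), if_neg (by omega)]
  · refine H.assign (by decide) ⟨fun r hr => ?_, ?_, ?_, g2⟩
    · rw [State.setReg_reg, if_neg (by omega)]; exact (g1 r (by omega)).trans (h1 r hr)
    · rw [State.setReg_reg, if_neg (by omega)]; exact (g1 32 (by omega)).trans h2
    · rw [State.setReg_reg, if_pos rfl]
      have hlt : reduceLabel a b < 2 * e := reduceLabel_lt hF.one_le (hX _ (by omega)) (hX _ hj)
      rw [reduceLabel] at hlt ⊢
      have hb2 : b / 2 ^ lowDiff a b < 2 ^ E.w :=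
        lt_of_le_of_lt (Nat.div_le_self _ _) (by have := hX _ hj; omega)
      exact Expr.eval_plus (Expr.eval_times (Expr.eval_lit (by omega)) (Expr.eval_reg_of g3)
        (by omega)) (Expr.eval_rem (Expr.eval_reg_of g4) (Expr.eval_lit (by omega)) hb2) (by omega)

/-- All rounds of alphabet reduction on the array at `10`. -/
def reduceRounds : Program :=
  .seq (.assign 31 (.lit 0)) (.loop (.bin .less (.reg 31) (.reg 4))
    (.seq reducePass (.seq (copyPass 11 10) (.assign 31 (.bin .plus (.reg 31) (.lit 1))))))

/-- As `2 e ≤ 2 ^ e`, labels never need more bits than the names, so one bit length serves for all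
rounds. -/
theorem reduced_lt {X : ℕ → ℕ} (he : 2 * e ≤ 2 ^ e) (he1 : 1 ≤ e) (hX : ∀ j < m, X j < 2 ^ e) (i : ℕ) :
    ∀ j < m, reduced X i j < 2 ^ e := by
  induction i with
  | zero => exact hX
  | succ i ih =>
    intro j hj
    exact (reduceLabel_lt he1 (ih (j - 1) (by omega)) (ih j hj)).trans_le he

theorem Env.Ok.wp_reduceRounds (H : E.Ok e R) (hF : E.Fits k M e) (hL : Layout E k M m s)
    (hm : m ≤ M) {X : ℕ → ℕ} (hX : ∀ j < m, X j < 2 ^ e) (hs : ∀ j < m, s.mem (2 * M + j) = X j) :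
    E.wp reduceRounds s (k * (m * (24 * e + 65) + 20) + 6) (fun s' => Frame 31 s s' ∧
      (∀ a, a < 2 * M ∨ 4 * M ≤ a → s'.mem a = s.mem a) ∧
      ∀ j < m, s'.mem (2 * M + j) = reduced X k j) := by
  have hW := hF.word
  have hinit : E.wp (.assign 31 (.lit 0)) s 2 (fun s' => Frame 31 s s' ∧ s'.reg 31 = 0 ∧
      (∀ a, a < 2 * M ∨ 4 * M ≤ a → s'.mem a = s.mem a) ∧
      ∀ j < m, s'.mem (2 * M + j) = reduced X 0 j) := by
    refine H.assign (by decide) ⟨fun r hr => ?_, ?_, fun _ _ => rfl, hs⟩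
    · rw [State.setReg_reg, if_neg (by omega)]
    · rw [State.setReg_reg, if_pos rfl, Expr.eval_lit (by omega)]
  refine (hinit.seq (V := k * (m * (24 * e + 65) + 20) + 4) fun s0 h0 => ?_).mono (by omega)
    fun _ h => h
  refine (H.loopFor k (m * (24 * e + 65) + 16) (fun i s' => Frame 31 s s' ∧ s'.reg 31 = i ∧
      (∀ a, a < 2 * M ∨ 4 * M ≤ a → s'.mem a = s.mem a) ∧
      ∀ j < m, s'.mem (2 * M + j) = reduced X i j)
      ?_ ?_ h0 (by simp [Expr.cost, Nat.add_assoc])).mono le_rfl fun s' h => ⟨h.1, h.2.2⟩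
  · rintro i s1 hi ⟨h1, h2, h3, h4⟩
    have hL1 := hL.frame h1
    refine ⟨((Expr.tests_less (by omega) (Expr.eval_reg_of h2)
      (Expr.eval_reg_of hL1.r4)).ne_zero_iff).2 hi, ?_⟩
    have hlt := reduced_lt (m := m) hF.two_mul_le hF.one_le hX i
    refine ((H.wp_reducePass hF hL1 hm fun j hj => by rw [h4 j hj]; exact hlt j hj).seq
      (V := m * 18 + 10) fun s2 ⟨g1, g2, g3⟩ => ?_).mono (by
        rw [Nat.mul_add m, Nat.mul_add m]; omega) fun _ h => h
    have hL2 := hL1.frame (g1.mono (by omega))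
    refine (H.wp_copyPass hF hL2 hm (by omega) (by omega) hL2.r11 hL2.r10 (by omega) (by omega)
      (by omega)).seq (V := 4) fun s3 ⟨g4, g5, g6⟩ => ?_
    refine H.assign (by decide) ⟨fun r hr => ?_, ?_, ?_, ?_⟩
    · rw [State.setReg_reg, if_neg (by omega), g4 r (by omega), g1 r (by omega), h1 r hr]
    · rw [State.setReg_reg, if_pos rfl]
      refine Expr.eval_plus (Expr.eval_reg_of ?_) (Expr.eval_lit (by omega)) (by omega)
      rw [g4 31 (by omega), g1 31 (by omega), h2]
    · intro a ha
      rw [State.setReg_mem, g5 a (by omega), g2 a (by omega), h3 a ha]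
    · intro j hj
      rw [State.setReg_mem]
      refine (g6 j hj).trans ((g3 j hj).trans ?_)
      simp only [h4 j hj, h4 (j - 1) (by omega), reduced]
  · rintro s1 ⟨h1, h2, -⟩
    exact ((Expr.tests_less (by omega) (Expr.eval_reg_of h2)
      (Expr.eval_reg_of (hL.frame h1).r4)).eq_zero_iff).2 (by omega)

/-! ## Elimination of labels -/

/-- The expression `f` if `t` is true, and `0` otherwise. -/
def Expr.guard (t f : Expr) : Expr := .bin .times t f

/-- The guarded expression matters only if the test is true: multiplication by `0` hides any
meaningless value, such as an entry read outside its array. -/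
theorem Expr.eval_guard {w a : ℕ} {t f : Expr} {P : Prop} [Decidable P] (ht : t.Tests w s P)
    (hf : P → f.eval w s = a ∧ a < 2 ^ w) : (Expr.guard t f).eval w s = if P then a else 0 := by
  split_ifs with h
  · obtain ⟨h1, h2⟩ := hf h
    rw [Expr.guard, Expr.eval_times (ht.1 h) h1 (by omega), one_mul]
  · rw [Expr.guard, Expr.eval, ht.2 h]
    simp [BinOp.apply]

/-- The least number different from the values of `f` and `g`. -/
def Expr.free (f g : Expr) : Expr :=
  let t0 : Expr := .bin .times (.neg (.bin .equal f (.lit 0))) (.neg (.bin .equal g (.lit 0)))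
  let t1 : Expr := .bin .times (.neg (.bin .equal f (.lit 1))) (.neg (.bin .equal g (.lit 1)))
  .guard t0.neg (.bin .plus (.lit 1) (.neg t1))

theorem Expr.eval_free {w a b : ℕ} {f g : Expr} (hw : 4 ≤ 2 ^ w) (hf : f.eval w s = a)
    (hg : g.eval w s = b) : (Expr.free f g).eval w s = freeLabel a b := by
  have ht : ∀ c < 2, (Expr.bin .times (.neg (.bin .equal f (.lit c)))
      (.neg (.bin .equal g (.lit c)))).Tests w s (a ≠ c ∧ b ≠ c) := fun c hc =>
    ((Expr.tests_equal (by omega) hf (Expr.eval_lit (by omega))).neg (by omega)).and (by omega)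
      ((Expr.tests_equal (by omega) hg (Expr.eval_lit (by omega))).neg (by omega))
  -- If `0` is taken, the result is `1` plus the truth value of "`1` is taken as well".
  have h1 : (if a ≠ 1 ∧ b ≠ 1 then 0 else 1) < 2 := by split_ifs <;> omega
  rw [Expr.free, Expr.eval_guard (a := 1 + if a ≠ 1 ∧ b ≠ 1 then 0 else 1)
    ((ht 0 (by omega)).neg (by omega)) fun _ => ⟨Expr.eval_plus (Expr.eval_lit (by omega))
      ?_ (by omega), by omega⟩, freeLabel]
  · split_ifs <;> simp_all
  · rw [((ht 1 (by omega)).neg (by omega)).eval_eq]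
    split_ifs <;> simp_all

/-- Eliminate the label `c` from the array at `src`; the result is the array at `dst`. -/
def elimPass (c src dst : ℕ) : Program :=
  let y : Expr := .entry src (.reg 32)
  let t : Expr := .bin .equal y (.lit c)
  fill 5 dst (.assign 33 (.bin .plus
    (.guard t (.free (.entry src (.bin .minus (.reg 32) (.lit 1)))
      (.entry src (.bin .plus (.reg 32) (.lit 1)))))
    (.guard t.neg y)))

theorem freeLabel_le (a b : ℕ) : freeLabel a b ≤ 2 := by
  rw [freeLabel]; split_ifs <;> omega

theorem eliminate_lt {c B : ℕ} {y : ℕ → ℕ} {j : ℕ} (hB : 2 < B) (h : y j < B) :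
    eliminate c y j < B := by
  have := freeLabel_le (y (j - 1)) (y (j + 1))
  rw [eliminate]; split_ifs <;> omega

theorem Env.Ok.wp_elimPass (H : E.Ok e R) (hF : E.Fits k M e) (hL : Layout E k M m s)
    (hm : m + 8 ≤ M) {c src dst b b' : ℕ} (hc : c < 8) (h1 : src < 31) (h2 : dst < 31)
    (hb : s.reg src = b) (hb' : s.reg dst = b')
    (hd : b + M ≤ b' ∨ b' + M ≤ b) (hle : b ≤ 9 * M) (hle' : b' ≤ 9 * M)
    (hlt : ∀ j < m, s.mem (b + j) < 2 ^ E.w) :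
    E.wp (elimPass c src dst) s (m * 100 + 6)
      (Filled b' m (eliminate c (fun j => s.mem (b + j))) s) := by
  have hW := hF.word
  refine (H.wp_fillExpr (by omega) (by omega) hL.r5 hb' (by omega) _ ?_).mono (by
    simp only [Expr.cost, Expr.entry, Expr.guard, Expr.neg, Expr.free]; omega)
    fun s' h => h
  intro j s' hj g1 g2 g3 g4
  have hr := (g1 src (by omega)).trans hb
  have ey := Expr.eval_entry (w := E.w) hr (Expr.eval_reg_of g2) (by omega)
  have e1 := Expr.eval_entry (w := E.w) hr (Expr.eval_minus (Expr.eval_reg_of g2)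
    (Expr.eval_lit (a := 1) (by omega)) (by omega)) (by omega)
  have e2 := Expr.eval_entry (w := E.w) hr (Expr.eval_plus (Expr.eval_reg_of g2)
    (Expr.eval_lit (a := 1) (by omega)) (by omega)) (by omega)
  rw [g3 _ (by omega)] at ey e1 e2
  have ht := Expr.tests_equal (by omega) ey (Expr.eval_lit (w := E.w) (s := s') (a := c) (by omega))
  have hfree := freeLabel_le (s.mem (b + (j - 1))) (s.mem (b + (j + 1)))
  have hsum := Expr.eval_plus (Expr.eval_guard ht fun _ => ⟨Expr.eval_free (by omega) e1 e2,
      (by omega)⟩) (Expr.eval_guard (ht.neg (by omega)) fun _ => ⟨ey, hlt j hj⟩) (by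
      have := hlt j hj
      split_ifs <;> omega)
  rw [hsum, eliminate]
  split_ifs <;> simp_all

/-- The final labels, in the array at `11`. -/
def labelPass : Program :=
  .seq (copyPass 9 10) (.seq reduceRounds
    (.seq (elimPass 5 10 11) (.seq (elimPass 4 11 10) (elimPass 3 10 11))))

/-- The eliminations alternate between two arrays. Each reads one entry to the right, so after three
of them the last three entries may be meaningless; this is the reason for `j + 3 < m`. On the left
the conventions at position `0` agree. -/
theorem Env.Ok.wp_labelPass (H : E.Ok e R) (hF : E.Fits k M e) (hL : Layout E k M m s)
    (hm : m + 8 ≤ M) {X : ℕ → ℕ} (hX : ∀ j < m, X j < 2 ^ e) (hs : ∀ j < m, s.mem (M + j) = X j) :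
    E.wp labelPass s (k * (m * (24 * e + 65) + 20) + m * 318 + 30) (fun s' => Frame 31 s s' ∧
      (∀ a, a < 2 * M ∨ 4 * M ≤ a → s'.mem a = s.mem a) ∧
      ∀ j, j + 3 < m → s'.mem (3 * M + j) = finalLabel k X j) := by
  have hW := hF.word
  have hp := hF.pow_le
  have h2 : 2 < 2 ^ E.w := by omega
  refine ((H.wp_copyPass hF hL (by omega) (by omega) (by omega) hL.r9 hL.r10 (by omega) (by omega)
    (by omega)).seq (V := k * (m * (24 * e + 65) + 20) + m * 300 + 24)
    fun s1 ⟨f1, u1, v1⟩ => ?_).mono (by omega) fun _ h => h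
  have hL1 := hL.frame (f1.mono (by omega))
  refine ((H.wp_reduceRounds hF hL1 (by omega) hX fun j hj => (v1 j hj).trans (hs j hj)).seq
    (V := m * 300 + 18) fun s2 ⟨f2, u2, v2⟩ => ?_).mono (by omega) fun _ h => h
  have hL2 := hL1.frame f2
  have hlt := reduced_lt (m := m) hF.two_mul_le hF.one_le hX k
  have b2 : ∀ j < m, s2.mem (2 * M + j) < 2 ^ E.w := fun j hj => by
    have := hlt j hj
    rw [v2 j hj]; omega
  refine ((H.wp_elimPass hF hL2 hm (by omega) (by omega) (by omega) hL2.r10 hL2.r11 (by omega)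
    (by omega) (by omega) b2).seq (V := m * 200 + 12)
    fun s3 ⟨f3, u3, v3⟩ => ?_).mono (by omega) fun _ h => h
  have hL3 := hL2.frame (f3.mono (by omega))
  have b3 : ∀ j < m, s3.mem (3 * M + j) < 2 ^ E.w := fun j hj => by
    rw [v3 j hj]; exact eliminate_lt h2 (b2 j hj)
  refine ((H.wp_elimPass hF hL3 hm (by omega) (by omega) (by omega) hL3.r11 hL3.r10 (by omega)
    (by omega) (by omega) b3).seq (V := m * 100 + 6)
    fun s4 ⟨f4, u4, v4⟩ => ?_).mono (by omega) fun _ h => h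
  have hL4 := hL3.frame (f4.mono (by omega))
  have b4 : ∀ j < m, s4.mem (2 * M + j) < 2 ^ E.w := fun j hj => by
    rw [v4 j hj]; exact eliminate_lt h2 (b3 j hj)
  refine (H.wp_elimPass hF hL4 hm (by omega) (by omega) (by omega) hL4.r10 hL4.r11 (by omega)
    (by omega) (by omega) b4).mono (by omega) fun s5 ⟨f5, u5, v5⟩ => ⟨?_, ?_, ?_⟩
  · exact (((((f1.mono (by omega)).trans f2).trans (f3.mono (by omega))).trans
      (f4.mono (by omega))).trans (f5.mono (by omega)))
  · intro a ha
    rw [u5 a (by omega), u4 a (by omega), u3 a (by omega), u2 a (by omega), u1 a (by omega)]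
  · have c3 : ∀ j, j + 1 < m → s3.mem (3 * M + j) = eliminate 5 (reduced X k) j := by
      intro j hj
      rw [v3 j (by omega)]
      simp only [eliminate, v2 j (by omega), v2 (j - 1) (by omega), v2 (j + 1) (by omega)]
    have c4 : ∀ j, j + 2 < m → s4.mem (2 * M + j) = eliminate 4 (eliminate 5 (reduced X k)) j := by
      intro j hj
      rw [v4 j (by omega), eliminate, c3 j (by omega), c3 (j - 1) (by omega), c3 (j + 1) (by omega),
        ← eliminate]
    intro j hj
    rw [v5 j (by omega), eliminate, c4 j (by omega), c4 (j - 1) (by omega), c4 (j + 1) (by omega),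
        ← eliminate, finalLabel]

end Reduction

/-! ## Runs of positions with a property -/

open Classical in
/-- The length of the longest interval of elements of `P` that ends in front of `q`. -/
noncomputable def leftRun (P : ℕ → Prop) : ℕ → ℕ
  | 0 => 0
  | q + 1 => if P q then leftRun P q + 1 else 0

theorem leftRun_le (P : ℕ → Prop) (q : ℕ) : leftRun P q ≤ q := by
  induction q with
  | zero => exact le_rfl
  | succ q ih => rw [leftRun]; split_ifs <;> omega

theorem le_leftRun_iff {P : ℕ → Prop} {q : ℕ} :
    ∀ {n : ℕ}, n ≤ leftRun P q ↔ n ≤ q ∧ ∀ j, q ≤ j + n → j < q → P j := by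
  induction q with
  | zero => intro n; simp [leftRun]
  | succ q ih =>
    intro n
    rw [leftRun]
    rcases Nat.eq_zero_or_pos n with rfl | hn
    · simp only [Nat.zero_le, true_and, true_iff]; intro j h1 h2; omega
    obtain ⟨n, rfl⟩ : ∃ n', n = n' + 1 := ⟨n - 1, by omega⟩
    split_ifs with h
    · rw [Nat.add_le_add_iff_right, Nat.add_le_add_iff_right, ih]
      refine and_congr_right fun _ => ⟨fun g j h1 h2 => ?_, fun g j h1 h2 => g j (by omega) (by omega)⟩
      rcases Nat.lt_or_ge j q with h3 | h3
      · exact g j (by omega) h3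
      · rwa [show j = q by omega]
    · constructor
      · intro h'; omega
      · rintro ⟨-, g⟩; exact absurd (g q (by omega) (by omega)) h

section Sure

variable {k m : ℕ} {X Y z : ℕ → ℕ}

/-- The description of `Sure` that is evaluated on the machine. -/
theorem sure_iff (hz : ∀ j, j + 3 < m → z j = finalLabel k X j) {q : ℕ} (hq : q < m) :
    Sure k X m q ↔ SureStart X m q ∨ (k + 4 ≤ leftRun (InnerSolo X m) q ∧
      7 ≤ leftRun (fun i => InnerSolo X m (m - 1 - i)) (m - q) ∧
      2 * k < leftRun (InnerSolo X m) q + leftRun (fun i => InnerSolo X m (m - 1 - i)) (m - q) ∧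
      IsLandmark z (q + 1)) := by
  set l := leftRun (InnerSolo X m) q with hl
  set r := leftRun (fun i => InnerSolo X m (m - 1 - i)) (m - q) with hr
  have hlq : l ≤ q := leftRun_le _ _
  have hrq : r ≤ m - q := leftRun_le _ _
  have hzl : q + 6 < m → (IsLandmark z (q + 1) ↔ IsLandmark (finalLabel k X) (q + 1)) := by
    intro h
    simp only [IsLandmark, IsLocalMax, IsLocalMin, Nat.add_sub_cancel]
    rw [hz (q + 1) (by omega), hz q (by omega), hz (q + 1 + 1) (by omega), hz (q - 1) (by omega),
      hz (q + 1 + 1 + 1) (by omega)]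
  refine or_congr_right ⟨?_, ?_⟩
  · rintro ⟨s, e, h1, h2, h3, h4, h5⟩
    have hm : q + 6 < m := by have := (h4 (q + 6) (by omega) (by omega)).2.1; omega
    have hem : e ≤ m := by
      by_contra h
      have := (h4 m (by omega) (by omega)).2.1; omega
    have g1 : q - s ≤ l := le_leftRun_iff.2 ⟨by omega, fun j _ _ => h4 j (by omega) (by omega)⟩
    have g2 : e - q ≤ r :=
      le_leftRun_iff.2 ⟨by omega, fun j _ _ => h4 (m - 1 - j) (by omega) (by omega)⟩
    exact ⟨by omega, by omega, by omega, (hzl hm).2 h5⟩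
  -- The maximal window of inner solo positions around `q` is a witness whenever some window is, so
  -- its two run lengths decide.
  · rintro ⟨h1, h2, h3, h4⟩
    have gl := (le_leftRun_iff.1 hl.le).2
    have gr := (le_leftRun_iff.1 hr.le).2
    have h5 : ∀ j, q - l ≤ j → j < q + r → InnerSolo X m j := by
      intro j hj1 hj2
      rcases Nat.lt_or_ge j q with h | h
      · exact gl j (by omega) h
      · have := gr (m - 1 - j) (by omega) (by omega)
        rwa [show m - 1 - (m - 1 - j) = j by omega] at this
    have hm : q + 6 < m := by have := (h5 (q + 6) (by omega) (by omega)).2.1; omega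
    exact ⟨q - l, q + r, by omega, by omega, by omega, h5, (hzl hm).1 h4⟩

theorem InnerSolo.congr (h : ∀ j < m, X j = Y j) {j : ℕ} (hj : InnerSolo X m j) :
    InnerSolo Y m j := by
  obtain ⟨h1, h2, h3, h4⟩ := hj
  rw [h _ (by omega), h _ (by omega)] at h3 h4
  exact ⟨h1, h2, h3, h4⟩

end Sure

/-! ## Flags of the sure positions -/

section Flags

variable {E : Env} {e R k M m : ℕ} {s : State}

/-- The conjunction of truth values. -/
def Expr.conj (f g : Expr) : Expr := .bin .times f g

/-- The numbers in front of and behind the value of an expression. -/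
def Expr.pred (f : Expr) : Expr := .bin .minus f (.lit 1)

def Expr.succ (f : Expr) : Expr := .bin .plus f (.lit 1)

/-- The arrays at `b` have the entries `y`. -/
def State.Reads (s : State) (w r N : ℕ) (y : ℕ → ℕ) : Prop :=
  ∀ i ≤ N, s.reg r + i < 2 ^ w ∧ s.mem (s.reg r + i) = y i

/-! ### Expressions that test the local predicates. -/

section Tests

variable {w N r i : ℕ} {d : Expr} {y : ℕ → ℕ}

theorem Expr.eval_pred (hd : d.eval w s = i) (hw : i + 1 < 2 ^ w) : d.pred.eval w s = i - 1 :=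
  Expr.eval_minus hd (Expr.eval_lit (by omega)) (by omega)

theorem Expr.eval_succ (hd : d.eval w s = i) (hw : i + 1 < 2 ^ w) : d.succ.eval w s = i + 1 :=
  Expr.eval_plus hd (Expr.eval_lit (by omega)) (by omega)

theorem State.Reads.eval (h : s.Reads w r N y) (hd : d.eval w s = i) (hi : i ≤ N) :
    (Expr.entry r d).eval w s = y i := by
  rw [Expr.eval_entry rfl hd (h i hi).1, (h i hi).2]

def Expr.innerSolo (d : Expr) : Expr :=
  .conj (.bin .less (.lit 0) d) (.conj (.bin .less d.succ (.reg 5))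
    (.conj (.neg (.bin .equal (.entry 9 d.pred) (.entry 9 d)))
      (.neg (.bin .equal (.entry 9 d) (.entry 9 d.succ)))))

theorem Expr.tests_innerSolo (hw : N + 4 ≤ 2 ^ w) (h : s.Reads w 9 N y) (hm : s.reg 5 = m)
    (hd : d.eval w s = i) (hi : i + 1 ≤ N) : (Expr.innerSolo d).Tests w s (InnerSolo y m i) := by
  have h1 := Expr.eval_pred hd (by omega)
  have h2 := Expr.eval_succ hd (by omega)
  have w1 : 1 < 2 ^ w := by omega
  exact (Expr.tests_less w1 (Expr.eval_lit (by omega)) hd).and w1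
    ((Expr.tests_less w1 h2 (Expr.eval_reg_of hm)).and w1
    (((Expr.tests_equal w1 (h.eval h1 (by omega)) (h.eval hd (by omega))).neg w1).and w1
    ((Expr.tests_equal w1 (h.eval hd (by omega)) (h.eval h2 (by omega))).neg w1)))

def Expr.localMax (r : ℕ) (d : Expr) : Expr :=
  .conj (.bin .less (.entry r d.pred) (.entry r d)) (.bin .less (.entry r d.succ) (.entry r d))

theorem Expr.tests_localMax (hw : N + 4 ≤ 2 ^ w) (h : s.Reads w r N y)
    (hd : d.eval w s = i) (hi : i + 1 ≤ N) : (Expr.localMax r d).Tests w s (IsLocalMax y i) := by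
  have h1 := Expr.eval_pred hd (by omega)
  have h2 := Expr.eval_succ hd (by omega)
  have w1 : 1 < 2 ^ w := by omega
  exact (Expr.tests_less w1 (h.eval h1 (by omega)) (h.eval hd (by omega))).and w1
    (Expr.tests_less w1 (h.eval h2 (by omega)) (h.eval hd (by omega)))

def Expr.localMin (r : ℕ) (d : Expr) : Expr :=
  .conj (.bin .less (.entry r d) (.entry r d.pred)) (.bin .less (.entry r d) (.entry r d.succ))

theorem Expr.tests_localMin (hw : N + 4 ≤ 2 ^ w) (h : s.Reads w r N y)
    (hd : d.eval w s = i) (hi : i + 1 ≤ N) : (Expr.localMin r d).Tests w s (IsLocalMin y i) := by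
  have h1 := Expr.eval_pred hd (by omega)
  have h2 := Expr.eval_succ hd (by omega)
  have w1 : 1 < 2 ^ w := by omega
  exact (Expr.tests_less w1 (h.eval hd (by omega)) (h.eval h1 (by omega))).and w1
    (Expr.tests_less w1 (h.eval hd (by omega)) (h.eval h2 (by omega)))

def Expr.landmark (r : ℕ) (d : Expr) : Expr :=
  .or (.localMax r d)
    (.conj (.localMin r d) (.conj (.neg (.localMax r d.pred)) (.neg (.localMax r d.succ))))

theorem Expr.tests_landmark (hw : N + 4 ≤ 2 ^ w) (h : s.Reads w r N y)
    (hd : d.eval w s = i) (hi : i + 2 ≤ N) : (Expr.landmark r d).Tests w s (IsLandmark y i) := by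
  have h1 := Expr.eval_pred hd (by omega)
  have h2 := Expr.eval_succ hd (by omega)
  have w1 : 1 < 2 ^ w := by omega
  exact (Expr.tests_localMax hw h hd (by omega)).or w1
    ((Expr.tests_localMin hw h hd (by omega)).and w1
    (((Expr.tests_localMax hw h h1 (by omega)).neg w1).and w1
    ((Expr.tests_localMax hw h h2 (by omega)).neg w1)))

def Expr.sureStart (d : Expr) : Expr :=
  .conj (.bin .less (.lit 1) d) (.conj (.bin .less d.succ.succ (.reg 5))
    (.conj (.neg (.bin .equal (.entry 9 d.pred) (.entry 9 d)))
      (.or (.bin .equal (.entry 9 d) (.entry 9 d.succ))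
        (.conj (.bin .equal (.entry 9 d.pred.pred) (.entry 9 d.pred))
          (.neg (.bin .equal (.entry 9 d.succ) (.entry 9 d.succ.succ)))))))

theorem Expr.tests_sureStart (hw : N + 4 ≤ 2 ^ w) (h : s.Reads w 9 N y) (hm : s.reg 5 = m)
    (hd : d.eval w s = i) (hi : i + 2 ≤ N) : (Expr.sureStart d).Tests w s (SureStart y m i) := by
  have h1 := Expr.eval_pred hd (by omega)
  have h2 := Expr.eval_succ hd (by omega)
  have h3 := Expr.eval_pred h1 (by omega)
  have h4 := Expr.eval_succ h2 (by omega)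
  have w1 : 1 < 2 ^ w := by omega
  exact (Expr.tests_less w1 (Expr.eval_lit (by omega)) hd).and w1
    ((Expr.tests_less w1 h4 (Expr.eval_reg_of hm)).and w1
    (((Expr.tests_equal w1 (h.eval h1 (by omega)) (h.eval hd (by omega))).neg w1).and w1
    ((Expr.tests_equal w1 (h.eval hd (by omega)) (h.eval h2 (by omega))).or w1
    ((Expr.tests_equal w1 (h.eval h3 (by omega)) (h.eval h1 (by omega))).and w1
    ((Expr.tests_equal w1 (h.eval h2 (by omega)) (h.eval h4 (by omega))).neg w1)))))

end Tests

theorem Frame.reads {s' : State} (hf : Frame 32 s s') (hF : E.Fits k M e) (hm : m + 8 ≤ M)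
    {r b c : ℕ} (hr : r < 32) (hb : s.reg r = b) (hc : b + M ≤ c)
    (hc' : c ≤ 9 * M) (hmem : ∀ a < c, s'.mem a = s.mem a) :
    s'.Reads E.w r (m + 4) (fun j => s.mem (b + j)) := by
  intro i hi
  have hW := hF.word
  rw [(hf r hr).trans hb]
  exact ⟨by omega, hmem _ (by omega)⟩

/-- Lengths of runs of positions that are not part of a repetition; the position is `d`. -/
def runPass (dst : ℕ) (d : Expr) : Program :=
  fill 5 dst (.assign 33 (.guard d.innerSolo (Expr.entry dst (Expr.pred (.reg 32))).succ))

/-- A run length is `0` or one more than the previous entry. The first tested position is at the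
border of the pattern and never solo, so no entry in front of the array is used. The function `g` is
the order in which positions are visited, from the left or from the right. -/
theorem Env.Ok.wp_runPass (H : E.Ok e R) (hF : E.Fits k M e) (hL : Layout E k M m s)
    (hm : m + 8 ≤ M) {dst b : ℕ} {d : Expr} (hdst : dst < 31) (hb : s.reg dst = b)
    (hMb : 2 * M ≤ b) (hb' : b ≤ 9 * M) {g f : ℕ → ℕ}
    (hd : ∀ j < m, ∀ s', Frame 32 s s' → s'.reg 32 = j → d.eval E.w s' = g j)
    (hg : ∀ j < m, g j < m) (hcost : d.cost ≤ 5)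
    (hg0 : ¬ InnerSolo (fun j => s.mem (M + j)) m (g 0))
    (hf : ∀ j, j + 1 < m → InnerSolo (fun j => s.mem (M + j)) m (g (j + 1)) → f (j + 1) = f j + 1)
    (hf' : ∀ j < m, ¬ InnerSolo (fun j => s.mem (M + j)) m (g j) → f j = 0)
    (hfm : ∀ j < m, f j ≤ m) :
    E.wp (runPass dst d) s (m * 100 + 6) (Filled b m f s) := by
  classical
  have hW := hF.word
  refine (H.wp_fillExpr (by omega) (by omega) hL.r5 hb (by omega) f ?_).mono ?_ fun s' h => h
  · intro j s' hj g1 g2 g3 g4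
    have hR := g1.reads hF hm (by omega) hL.r9 (c := 2 * M) (by omega)
      (by omega) (fun a ha => g3 a (by omega))
    have ht := Expr.tests_innerSolo (by omega) hR ((g1 5 (by omega)).trans hL.r5)
      (hd j hj s' g1 g2) (by have := hg j hj; omega)
    rw [Expr.eval_guard (a := f j) ht]
    · split_ifs with h
      · rfl
      · exact (hf' j hj h).symm
    · intro h
      obtain ⟨j, rfl⟩ : ∃ j', j = j' + 1 := by
        refine ⟨j - 1, ?_⟩
        rcases Nat.eq_zero_or_pos j with rfl | h'
        · exact absurd h hg0
        · omega
      have := hfm (j + 1) hj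
      rw [hf j hj h] at this ⊢
      refine ⟨Expr.eval_succ ?_ (by omega), by omega⟩
      rw [Expr.eval_entry ((g1 dst (by omega)).trans hb)
        (Expr.eval_pred (Expr.eval_reg_of g2) (by omega)) (by omega), Nat.add_sub_cancel,
        g4 j (by omega)]
  · refine Nat.add_le_add_right (Nat.mul_le_mul_left _ ?_) _
    simp only [Expr.cost, Expr.guard, Expr.innerSolo, Expr.conj, Expr.neg, Expr.entry, Expr.pred,
      Expr.succ]
    omega

/-- Mark the sure positions. -/
def flagPass : Program :=
  let q : Expr := .reg 32
  let l : Expr := .entry 12 q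
  let r : Expr := .entry 13 (.bin .minus (.reg 5) q.succ)
  fill 5 14 (.assign 33 (.or q.sureStart
    (.conj (.bin .less (.bin .plus (.reg 4) (.lit 3)) l) (.conj (.bin .less (.lit 6) r)
      (.conj (.bin .less (.bin .plus (.reg 4) (.reg 4)) (.bin .plus l r)) (q.succ.landmark 11))))))

open Classical in
theorem Env.Ok.wp_flagPass (H : E.Ok e R) (hF : E.Fits k M e) (hL : Layout E k M m s)
    (hm : m + 8 ≤ M) {X : ℕ → ℕ} (hX : ∀ j < m, s.mem (M + j) = X j)
    (hz : ∀ j, j + 3 < m → s.mem (3 * M + j) = finalLabel k X j)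
    (hl : ∀ j < m, s.mem (4 * M + j) = leftRun (InnerSolo X m) j)
    (hr : ∀ j < m, s.mem (5 * M + j) = leftRun (fun i => InnerSolo X m (m - 1 - i)) (j + 1)) :
    E.wp flagPass s (m * 500 + 6)
      (Filled (6 * M) m (fun q => if Sure k X m q then 1 else 0) s) := by
  have hW := hF.word
  have w1 : 1 < 2 ^ E.w := by omega
  refine (H.wp_fillExpr (by omega) (by omega) hL.r5 hL.r14 (by omega) _ ?_).mono ?_ fun s' h => h
  · intro q s' hq g1 g2 g3 g4
    have hR := g1.reads hF hm (by omega) hL.r9 (c := 6 * M) (by omega)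
      (by omega) (fun a ha => g3 a (by omega))
    have hZ := g1.reads hF hm (by omega) hL.r11 (c := 6 * M) (by omega)
      (by omega) (fun a ha => g3 a (by omega))
    have hl' := (g1.reads hF hm (by omega) hL.r12 (c := 6 * M) (by omega)
      (by omega) (fun a ha => g3 a (by omega))).eval (Expr.eval_reg_of g2) (by omega)
    have r5 := (g1 5 (by omega)).trans hL.r5
    have r4 := (g1 4 (by omega)).trans hL.r4
    have hr' := (g1.reads hF hm (by omega) hL.r13 (c := 6 * M) (by omega)
      (by omega) (fun a ha => g3 a (by omega))).eval (Expr.eval_minus (Expr.eval_reg_of r5)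
        (Expr.eval_succ (Expr.eval_reg_of g2) (by omega)) (by omega)) (by omega)
    rw [hl q hq] at hl'
    -- The array of right runs is indexed from the end of the string: its entry `m - (q + 1)` counts
    -- the run that begins at `q`.
    rw [hr _ (by omega), show m - (q + 1) + 1 = m - q by omega] at hr'
    have b1 := leftRun_le (InnerSolo X m) q
    have b2 := leftRun_le (fun i => InnerSolo X m (m - 1 - i)) (m - q)
    have ht := (Expr.tests_sureStart (by omega) hR r5 (Expr.eval_reg_of g2) (by omega)).or w1
      ((Expr.tests_less w1 (Expr.eval_plus (Expr.eval_reg_of r4)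
          (Expr.eval_lit (a := 3) (by omega)) (by omega)) hl').and w1
      ((Expr.tests_less w1 (Expr.eval_lit (a := 6) (by omega)) hr').and w1
      ((Expr.tests_less w1 (Expr.eval_plus (Expr.eval_reg_of r4) (Expr.eval_reg_of r4) (by omega))
        (Expr.eval_plus hl' hr' (by omega))).and w1
      (Expr.tests_landmark (by omega) hZ (Expr.eval_succ (Expr.eval_reg_of g2) (by omega))
        (by omega)))))
    have hstart : SureStart (fun j => s.mem (M + j)) m q ↔ SureStart X m q := by
      simp only [SureStart]
      refine and_congr_right fun h1 => and_congr_right fun h2 => ?_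
      rw [hX _ (by omega), hX _ (by omega), hX _ (by omega), hX _ (by omega), hX _ (by omega)]
    refine (ht.congr ?_).eval_eq
    rw [sure_iff hz hq, hstart]
    refine or_congr_right ?_
    rw [show k + k = 2 * k by omega]
    constructor <;> rintro ⟨h1, h2, h3⟩ <;> exact ⟨by omega, by omega, h3⟩
  · refine Nat.add_le_add_right (Nat.mul_le_mul_left _ ?_) _
    simp only [Expr.cost, Expr.sureStart, Expr.conj, Expr.neg, Expr.entry, Expr.pred, Expr.or,
      Expr.succ, Expr.landmark, Expr.localMax, Expr.localMin]
    omega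

/-- Mark the sure positions of the string at address `0`. -/
def markPass : Program :=
  .seq namesPass (.seq labelPass (.seq (runPass 12 (Expr.pred (.reg 32)))
    (.seq (runPass 13 (.bin .minus (Expr.pred (.reg 5)) (.reg 32))) flagPass)))

/-- Only the alphabet reduction costs more than a constant per symbol: `k` rounds with up to `e`
bits each. The run lengths make the test of `sure_iff` a constant-time expression. -/
theorem Env.Ok.wp_markPass (H : E.Ok e R) (hE : IsNaming E.G E.name) (hF : E.Fits k M e)
    (hL : Layout E k M m s) (hm : m + 8 ≤ M) {X : ℕ → ℕ} (hX : ∀ j < m, E.nm (s.mem j) = X j) :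
    E.wp markPass s (k * (m * (24 * e + 65) + 20) + m * 1040 + 60) (fun s' => Frame 31 s s' ∧
      (∀ a, a < M ∨ 7 * M ≤ a → s'.mem a = s.mem a) ∧
      ∀ q < m, (Sure k X m q → s'.mem (6 * M + q) = 1) ∧ (¬ Sure k X m q → s'.mem (6 * M + q) = 0)) := by
  classical
  have hW := hF.word
  have hXe : ∀ j < m, X j < 2 ^ e := by
    intro j hj
    rw [← hX j hj, Env.nm]
    have := hF.bits
    split_ifs with h
    · exact (hE.2 _ h).trans this
    · exact this
  refine ((H.wp_namesPass hE hF hL (by omega)).seq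
    (V := k * (m * (24 * e + 65) + 20) + m * 1018 + 54)
    fun s1 ⟨f1, u1, v1⟩ => ?_).mono (by omega) fun _ h => h
  have hL1 := hL.frame (f1.mono (by omega))
  have x1 : ∀ j < m, s1.mem (M + j) = X j := fun j hj => (v1 j hj).trans (hX j hj)
  refine ((H.wp_labelPass hF hL1 hm hXe x1).seq (V := m * 700 + 18)
    fun s2 ⟨f2, u2, v2⟩ => ?_).mono (by omega) fun _ h => h
  have hL2 := hL1.frame f2
  have x2 : ∀ j < m, s2.mem (M + j) = X j := fun j hj => by rw [u2 _ (by omega), x1 j hj]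
  have p2 : ∀ j, InnerSolo (fun j => s2.mem (M + j)) m j ↔ InnerSolo X m j := fun j =>
    ⟨InnerSolo.congr x2, InnerSolo.congr fun j hj => (x2 j hj).symm⟩
  refine ((H.wp_runPass hF hL2 hm (by omega) hL2.r12 (by omega) (by omega) (g := fun j => j - 1)
    (f := leftRun (InnerSolo X m)) ?_ ?_ (by decide) ?_ ?_ ?_ ?_).seq (V := m * 600 + 12)
    fun s3 ⟨f3, u3, v3⟩ => ?_).mono (by omega) fun _ h => h
  · intro j hj s' _ h2
    exact Expr.eval_pred (Expr.eval_reg_of h2) (by omega)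
  · intro j hj; omega
  · rw [p2]; exact fun h => absurd h.1 (by simp)
  · intro j hj h
    rw [p2, Nat.add_sub_cancel] at h
    rw [leftRun, if_pos h]
  · intro j hj h
    rw [p2] at h
    rcases j with _ | j
    · rfl
    · rw [Nat.add_sub_cancel] at h
      rw [leftRun, if_neg h]
  · intro j hj
    exact (leftRun_le _ _).trans hj.le
  have hL3 := hL2.frame (f3.mono (by omega))
  have x3 : ∀ j < m, s3.mem (M + j) = X j := fun j hj => by rw [u3 _ (by omega), x2 j hj]
  have p3 : ∀ j, InnerSolo (fun j => s3.mem (M + j)) m j ↔ InnerSolo X m j := fun j =>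
    ⟨InnerSolo.congr x3, InnerSolo.congr fun j hj => (x3 j hj).symm⟩
  have hlast : ¬ InnerSolo X m (m - 1) := fun h => by
    have := h.1; have := h.2.1; omega
  refine ((H.wp_runPass hF hL3 hm (by omega) hL3.r13 (by omega) (by omega)
    (g := fun j => m - 1 - j) (f := fun j => leftRun (fun i => InnerSolo X m (m - 1 - i)) (j + 1))
    ?_ ?_ (by decide) ?_ ?_ ?_ ?_).seq (V := m * 500 + 6)
    fun s4 ⟨f4, u4, v4⟩ => ?_).mono (by omega) fun _ h => h
  · intro j hj s' h1 h2
    exact Expr.eval_minus (Expr.eval_pred (Expr.eval_reg_of ((h1 5 (by omega)).trans hL3.r5))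
      (by omega)) (Expr.eval_reg_of h2) (by omega)
  · intro j hj; omega
  · rw [p3]; exact hlast
  · intro j hj h
    rw [p3] at h
    rw [leftRun, if_pos h]
  · intro j hj h
    rw [p3] at h
    rw [leftRun, if_neg h]
  · intro j hj
    exact (leftRun_le _ _).trans (by omega)
  have hL4 := hL3.frame (f4.mono (by omega))
  refine (H.wp_flagPass hF hL4 hm (X := X) ?_ ?_ ?_ ?_).mono (by omega)
    fun s5 ⟨f5, u5, v5⟩ => ⟨?_, ?_, ?_⟩
  · intro j hj; rw [u4 _ (by omega), x3 j hj]
  · intro j hj; rw [u4 _ (by omega), u3 _ (by omega), v2 j hj]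
  · intro j hj; rw [u4 _ (by omega), v3 j hj]
  · intro j hj; exact v4 j hj
  · exact ((((f1.mono (by omega)).trans f2).trans (f3.mono (by omega))).trans
      (f4.mono (by omega))).trans (f5.mono (by omega))
  · intro a ha
    rw [u5 a (by omega), u4 a (by omega), u3 a (by omega), u2 a (by omega), u1 a (by omega)]
  · intro q hq
    exact ⟨fun h => (v5 q hq).trans (if_pos h), fun h => (v5 q hq).trans (if_neg h)⟩

end Flags

/-! ## One level of the computation of the evidence -/

theorem Env.Ok.assignSeq {E : Env} {e R : ℕ} (H : E.Ok e R) {x v U V : ℕ} {f : Expr} {q : Program}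
    {s : State} {post : State → Prop} (hv : f.eval E.w s = v) (hq : E.wp q (s.setReg x v) V post)
    (hU : f.cost + 1 + V ≤ U) : E.wp (.seq (.assign x f) q) s U post := by
  have h1 : E.wp (.assign x f) s (f.cost + 1) (fun s' => s' = s.setReg x v) :=
    H.assign le_rfl (by rw [hv])
  exact (h1.seq fun s' h => h ▸ hq).mono hU fun _ h => h

theorem State.setReg_setReg (s : State) (x v v' : ℕ) : (s.setReg x v).setReg x v' = s.setReg x v' := by
  simp [State.setReg]

/-- The memory contains the list `l` at the address `a`. -/
def State.Holds (s : State) (a : ℕ) (l : List ℕ) : Prop := ∀ i < l.length, s.mem (a + i) = l.getD i 0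

theorem State.Holds.congr {s s' : State} {a : ℕ} {l : List ℕ} (h : s.Holds a l)
    (hs : ∀ i, a ≤ i → i < a + l.length → s'.mem i = s.mem i) : s'.Holds a l := fun i hi => by
  rw [hs _ (by omega) (by omega), h i hi]

theorem State.Holds.append {s : State} {a N : ℕ} {l : List ℕ} {f : ℕ → ℕ} (h : s.Holds a l)
    (hf : ∀ i < N, s.mem (a + l.length + i) = f i) : s.Holds a (l ++ (List.range N).map f) := by
  intro i hi
  rw [List.length_append, List.length_map, List.length_range] at hi
  rcases Nat.lt_or_ge i l.length with h1 | h1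
  · rw [List.getD_append _ _ _ _ h1, h i h1]
  · rw [List.getD_append_right _ _ _ _ h1, ← Nat.add_sub_cancel' h1, ← Nat.add_assoc,
      hf _ (by omega), Nat.add_sub_cancel_left, List.getD_eq_getElem _ _ (by simp; omega)]
    simp

theorem take_eq_map_range (p : List ℕ) {n : ℕ} (h : n ≤ p.length) :
    p.take n = (List.range n).map (fun j => p.getD j 0) := by
  refine List.ext_getElem (by simp [h]) fun i h1 h2 => ?_
  simp only [List.length_take] at h1
  simp only [List.getElem_take, List.getElem_map, List.getElem_range]
  rw [List.getD_eq_getElem p 0 (show i < p.length by omega)]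

theorem reverse_drop_eq_map_range (p : List ℕ) (n : ℕ) :
    (p.drop n).reverse = (List.range (p.length - n)).map (fun j => p.getD (p.length - 1 - j) 0) := by
  refine List.ext_getElem (by simp) fun i h1 h2 => ?_
  simp only [List.length_reverse, List.length_drop] at h1
  simp only [List.getElem_reverse, List.getElem_drop, List.length_drop, List.getElem_map,
    List.getElem_range]
  rw [List.getD_eq_getElem p 0 (show p.length - 1 - i < p.length by omega)]
  congr 1
  omega

section Level

variable {E : Env} {e R k M m : ℕ} {s : State}

theorem Layout.setReg (h : Layout E k M m s) {x v : ℕ}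
    (hx : x = 6 ∨ x = 7 ∨ (15 ≤ x ∧ x ≤ 22) ∨ 25 ≤ x) : Layout E k M m (s.setReg x v) := by
  constructor <;> rw [State.setReg_reg, if_neg (by omega)]
  exacts [h.r4, h.r5, h.r8, h.r9, h.r10, h.r11, h.r12, h.r13, h.r14, h.r23, h.r24]

theorem Layout.setLength (h : Layout E k M m s) (v : ℕ) : Layout E k M v (s.setReg 5 v) := by
  constructor <;> rw [State.setReg_reg]
  all_goals first | rw [if_neg (by omega)] | rw [if_pos rfl]
  exacts [h.r4, h.r8, h.r9, h.r10, h.r11, h.r12, h.r13, h.r14, h.r23, h.r24]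

/-- The flags of the sure positions. -/
def State.Flags (s : State) (M m : ℕ) (F : ℕ → Prop) : Prop :=
  ∀ q < m, (F q → s.mem (6 * M + q) = 1) ∧ (¬ F q → s.mem (6 * M + q) = 0)

def Expr.flag (d : Expr) : Expr := .conj (.bin .less d (.reg 5)) (.entry 14 d)

/-- The look-ahead may leave the string. There the length test is `0` and cancels whatever is read
from memory, in agreement with `F` being false. -/
theorem State.Flags.tests {F : ℕ → Prop} (h : s.Flags M m F) (hFm : ∀ q, F q → q < m)
    (hF : E.Fits k M e) (hL : Layout E k M m s) {d : Expr} {i : ℕ} (hd : d.eval E.w s = i)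
    (hi : i ≤ 2 * M) : d.flag.Tests E.w s (F i) := by
  have hW := hF.word
  have w1 : 1 < 2 ^ E.w := by omega
  have h1 := Expr.tests_less w1 hd (Expr.eval_reg_of hL.r5)
  have h2 := Expr.eval_entry hL.r14 hd (by omega)
  rcases Nat.lt_or_ge i m with him | him
  · have : (Expr.entry 14 d).Tests E.w s (F i) := by
      constructor <;> intro g <;> rw [h2]
      exacts [(h i him).1 g, (h i him).2 g]
    exact (h1.and w1 this).congr ⟨fun g => g.2, fun g => ⟨him, g⟩⟩
  · constructor
    · intro g; exact absurd (hFm i g) (by omega)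
    · intro _
      rw [Expr.flag, Expr.conj, Expr.eval, h1.2 (by omega)]
      simp [BinOp.apply]

/-- Search of the first and the last sure position. -/
def findPass : Program :=
  .seq (.assign 15 (.lit 0))
    (.seq (.loop (.conj (.bin .less (.reg 15) (.reg 5)) (Expr.flag (.reg 15)).neg)
        (.assign 15 (Expr.succ (.reg 15))))
    (.seq (.assign 16 (.reg 5))
      (.loop (.conj (.bin .less (.reg 15) (.reg 5)) (Expr.flag (.reg 16)).neg)
        (.assign 16 (Expr.pred (.reg 16))))))

/-- The second search runs downwards from `m` and only if the first one has succeeded; otherwise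
both registers keep the value `m`, the convention of `firstSure` and `lastSure`. -/
theorem Env.Ok.wp_findPass (H : E.Ok e R) (hF : E.Fits k M e) (hL : Layout E k M m s)
    (hm : m + 8 ≤ M) {X : ℕ → ℕ} (hfl : s.Flags M m (Sure k X m)) :
    E.wp findPass s (m * 50 + 50) (fun s' =>
      s' = (s.setReg 15 (firstSure k X m)).setReg 16 (lastSure k X m)) := by
  have hW := hF.word
  have w1 : 1 < 2 ^ E.w := by omega
  have hFm : ∀ q, Sure k X m q → q < m := fun q h => by have := h.bounds; omega
  have hfle := firstSure_le (k := k) (X := X) (m := m)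
  have hlle := lastSure_le (k := k) (X := X) (m := m)
  refine H.assignSeq (Expr.eval_lit (by omega)) (V := m * 50 + 48) ?_ (by simp only [Expr.cost]; omega)
  have key1 := H.loopFor (f := .conj (.bin .less (.reg 15) (.reg 5)) (Expr.flag (.reg 15)).neg)
    (p := .assign 15 (Expr.succ (.reg 15))) (s := s.setReg 15 0)
    (firstSure k X m) 4 (fun j s' => s' = s.setReg 15 j) (U := m * 25 + 20) ?_ ?_ rfl ?_
  rotate_left
  · rintro j _ hj rfl
    have e15 : (s.setReg 15 j).reg 15 = j := by rw [State.setReg_reg, if_pos rfl]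
    have ht := (Expr.tests_less w1 (Expr.eval_reg_of e15)
      (Expr.eval_reg_of (hL.setReg (x := 15) (v := j) (by omega)).r5)).and w1
      ((State.Flags.tests (s := s.setReg 15 j) hfl hFm hF (hL.setReg (by omega))
        (Expr.eval_reg_of e15) (by omega)).neg w1)
    refine ⟨ht.ne_zero_iff.2 ⟨by omega, not_sure_of_lt_firstSure hj⟩, H.assign (by decide) ?_⟩
    rw [Expr.eval_succ (Expr.eval_reg_of e15) (by omega), State.setReg_setReg]
  · rintro _ rfl
    have e15 : (s.setReg 15 (firstSure k X m)).reg 15 = firstSure k X m := by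
      rw [State.setReg_reg, if_pos rfl]
    have ht := (Expr.tests_less w1 (Expr.eval_reg_of e15)
      (Expr.eval_reg_of (hL.setReg (x := 15) (v := firstSure k X m) (by omega)).r5)).and w1
      ((State.Flags.tests (s := s.setReg 15 (firstSure k X m)) hfl hFm hF (hL.setReg (by omega))
        (Expr.eval_reg_of e15) (by omega)).neg w1)
    exact ht.eq_zero_iff.2 fun h => h.2 (sure_firstSure h.1)
  · simp only [Expr.cost, Expr.conj, Expr.neg, Expr.flag, Expr.entry]
    have := Nat.mul_le_mul_right 25 hfle
    omega
  refine (key1.seq (V := m * 25 + 28) fun s1 h1 => ?_).mono (by omega) fun _ h => h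
  subst h1
  have hL1 := hL.setReg (x := 15) (v := firstSure k X m) (by omega)
  refine H.assignSeq (Expr.eval_reg_of hL1.r5) (V := m * 25 + 26) ?_ (by simp only [Expr.cost]; omega)
  have hsl : ∀ l ≤ m, ((Expr.bin .less (.reg 15) (.reg 5)).conj (Expr.flag (.reg 16)).neg).Tests E.w
      ((s.setReg 15 (firstSure k X m)).setReg 16 l) (firstSure k X m < m ∧ ¬ Sure k X m l) := by
    intro l hl
    exact (Expr.tests_less w1 (Expr.eval_reg_of (by simp [State.setReg_reg]))
      (Expr.eval_reg_of (hL1.setReg (x := 16) (v := l) (by omega)).r5)).and w1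
      ((State.Flags.tests (s := (s.setReg 15 (firstSure k X m)).setReg 16 l) hfl hFm hF
        (hL1.setReg (by omega)) (Expr.eval_reg_of (by simp [State.setReg_reg])) (by omega)).neg w1)
  refine (H.loopFor (m - lastSure k X m) 4
    (fun j s' => s' = (s.setReg 15 (firstSure k X m)).setReg 16 (m - j)) ?_ ?_ rfl ?_).mono le_rfl ?_
  · rintro j _ hj rfl
    refine ⟨(hsl (m - j) (by omega)).ne_zero_iff.2 ⟨?_, fun h => ?_⟩, H.assign (by decide) ?_⟩
    · by_contra h
      have := lastSure_of_eq (k := k) (X := X) (m := m) (by omega)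
      omega
    · have := le_lastSure h; omega
    · rw [Expr.eval_pred (Expr.eval_reg_of (a := m - j) (by simp [State.setReg_reg])) (by omega),
        State.setReg_setReg, Nat.sub_sub]
  · rintro _ rfl
    refine (hsl _ (by omega)).eq_zero_iff.2 fun h => h.2 ?_
    rw [Nat.sub_sub_self hlle]
    exact sure_lastSure h.1
  · simp only [Expr.cost, Expr.conj, Expr.neg, Expr.flag, Expr.entry]
    have := Nat.mul_le_mul_right 25 (Nat.sub_le m (lastSure k X m))
    omega
  · rintro _ rfl
    rw [Nat.sub_sub_self hlle]

/-- Move the symbols in front of the first and behind the last sure position to the buffers. -/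
def movePass : Program :=
  .seq (fill 15 6 (.assign 33 (.load (.reg 32))))
    (.seq (.assign 6 (.bin .plus (.reg 6) (.reg 15)))
    (.seq (.assign 17 (.bin .minus (.reg 5) (.reg 16)))
    (.seq (fill 17 7 (.assign 33 (.load (.bin .minus (Expr.pred (.reg 5)) (.reg 32)))))
      (.assign 7 (.bin .plus (.reg 7) (.reg 17))))))

/-- From level to level the right part of the evidence grows at its front. Its buffer holds the
reversed string, so that it too is extended at the end and nothing has to be shifted. -/
theorem Env.Ok.wp_movePass (H : E.Ok e R) (hF : E.Fits k M e) {p left right : List ℕ}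
    (hL : Layout E k M p.length s) {i j : ℕ} (hi : i ≤ p.length) (h15 : s.reg 15 = i)
    (h16 : s.reg 16 = j) (h6 : s.reg 6 = 8 * M + left.length) (h7 : s.reg 7 = 7 * M + right.length)
    (hp : s.Holds 0 p) (hl : s.Holds (8 * M) left) (hr : s.Holds (7 * M) right.reverse)
    (hM : left.length + p.length + right.length + 8 ≤ M) :
    E.wp movePass s (p.length * 40 + 40) (fun s' => Layout E k M p.length s' ∧
      s'.reg 15 = i ∧ s'.reg 16 = j ∧ s'.reg 6 = 8 * M + (left ++ p.take i).length ∧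
      s'.reg 7 = 7 * M + (p.drop j ++ right).length ∧ (∀ a < 7 * M, s'.mem a = s.mem a) ∧
      s'.Holds (8 * M) (left ++ p.take i) ∧ s'.Holds (7 * M) (p.drop j ++ right).reverse) := by
  have hW := hF.word
  set m := p.length with hmdef
  have hfill1 := H.wp_fillExpr (cnt := 15) (base := 6) (g := .load (.reg 32)) (s := s)
    (by omega) (by omega) h15 h6 (by omega) (fun j => p.getD j 0) (fun j s' hj g1 g2 g3 g4 => by
      rw [Expr.eval_load (Expr.eval_reg_of g2), g3 _ (by omega)]
      have := hp j (by omega)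
      rwa [Nat.zero_add] at this)
  have c1 := Nat.mul_le_mul_right 16 hi
  refine (hfill1.seq (V := m * 24 + 34) fun s1 ⟨f1, u1, v1⟩ => ?_).mono
    (by simp only [Expr.cost]; omega) fun _ h => h
  have hL1 := hL.frame (f1.mono (by omega))
  refine H.assignSeq (Expr.eval_plus (Expr.eval_reg_of ((f1 6 (by omega)).trans h6))
    (Expr.eval_reg_of ((f1 15 (by omega)).trans h15)) (by omega)) (V := m * 24 + 30) ?_
    (by simp only [Expr.cost]; omega)
  have hL2 := hL1.setReg (x := 6) (v := 8 * M + left.length + i) (by omega)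
  refine H.assignSeq (Expr.eval_minus (Expr.eval_reg_of hL2.r5) (Expr.eval_reg_of (a := j) (by
    rw [State.setReg_reg, if_neg (by omega)]; exact (f1 16 (by omega)).trans h16)) (by omega))
    (V := m * 24 + 26) ?_ (by simp only [Expr.cost]; omega)
  have hL3 := hL2.setReg (x := 17) (v := m - j) (by omega)
  set s3 := (s1.setReg 6 (8 * M + left.length + i)).setReg 17 (m - j) with hs3
  have m3 : s3.mem = s1.mem := rfl
  have r3 : ∀ r < 32, r ≠ 6 → r ≠ 17 → s3.reg r = s.reg r := by
    intro r h1 h2 h3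
    rw [hs3, State.setReg_reg, if_neg h3, State.setReg_reg, if_neg h2]; exact f1 r h1
  have hfill2 := H.wp_fillExpr (cnt := 17) (base := 7)
    (g := .load (.bin .minus (Expr.pred (.reg 5)) (.reg 32))) (s := s3) (N := m - j)
    (b := 7 * M + right.length) (by omega) (by omega) (by simp [hs3, State.setReg_reg])
    ((r3 7 (by omega) (by omega) (by omega)).trans h7) (by omega)
    (fun j => p.getD (p.length - 1 - j) 0) (fun j s' hj g1 g2 g3 g4 => by
      rw [Expr.eval_load (Expr.eval_minus (Expr.eval_pred (Expr.eval_reg_of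
        ((g1 5 (by omega)).trans hL3.r5)) (by omega)) (Expr.eval_reg_of g2) (by omega)),
        g3 _ (by omega), m3, u1 _ (by omega)]
      have := hp (m - 1 - j) (by omega)
      rwa [Nat.zero_add] at this)
  have c2 := Nat.mul_le_mul_right 20 (Nat.sub_le m j)
  refine (hfill2.seq (V := 4) fun s4 ⟨f4, u4, v4⟩ => ?_).mono
    (by simp only [Expr.cost, Expr.pred]; omega) fun _ h => h
  have hL4 := hL3.frame (f4.mono (by omega))
  refine H.assign (by decide) ?_
  have e7 : (Expr.bin .plus (.reg 7) (.reg 17)).eval E.w s4 = 7 * M + right.length + (m - j) := by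
    refine Expr.eval_plus (Expr.eval_reg_of ?_) (Expr.eval_reg_of ?_) (by omega)
    · exact (f4 7 (by omega)).trans ((r3 7 (by omega) (by omega) (by omega)).trans h7)
    · exact (f4 17 (by omega)).trans (by simp [hs3, State.setReg_reg])
  rw [e7]
  refine ⟨hL4.setReg (by omega), ?_, ?_, ?_, ?_, ?_, ?_, ?_⟩
  · rw [State.setReg_reg, if_neg (by omega)]
    exact (f4 15 (by omega)).trans ((r3 15 (by omega) (by omega) (by omega)).trans h15)
  · rw [State.setReg_reg, if_neg (by omega)]
    exact (f4 16 (by omega)).trans ((r3 16 (by omega) (by omega) (by omega)).trans h16)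
  · rw [State.setReg_reg, if_neg (by omega), f4 6 (by omega)]
    simp [hs3, State.setReg_reg, ← hmdef]; omega
  · rw [State.setReg_reg, if_pos rfl]
    simp [← hmdef]; omega
  · intro a ha
    rw [State.setReg_mem, u4 a (by omega), m3, u1 a (by omega)]
  · rw [take_eq_map_range p hi]
    refine State.Holds.append (fun a ha => ?_) fun a ha => ?_
    · rw [State.setReg_mem, u4 _ (by omega), m3, u1 _ (by omega), hl a ha]
    · rw [State.setReg_mem, u4 _ (by omega), m3, v1 a ha]
  · rw [List.reverse_append, reverse_drop_eq_map_range, ← hmdef]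
    refine State.Holds.append (fun a ha => ?_) fun a ha => ?_
    · rw [List.length_reverse] at ha
      rw [State.setReg_mem, u4 _ (by omega), m3, u1 _ (by omega), hr a (by simpa using ha)]
    · rw [State.setReg_mem, List.length_reverse, v4 a ha]

end Level

/-! ## The program -/

section Stream

variable {E : Env} {e R k M m : ℕ} {s : State}

theorem Env.Ok.reverseSeq (H : E.Ok e R) {x a b U V : ℕ} {f g : Expr} {q : Program}
    {post : State → Prop} (hf : f.eval E.w s = a) (hg : g.eval E.w s = b)
    (hq : E.wp q (s.setReg x (E.G.rev a b)) V post)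
    (hU : f.cost + g.cost + 1 + R + V ≤ U) : E.wp (.seq (.reverse x f g) q) s U post := by
  have h1 : E.wp (.reverse x f g) s (f.cost + g.cost + 1 + R)
      (fun s' => s' = s.setReg x (E.G.rev a b)) := H.reverse le_rfl (by rw [hf, hg])
  exact (h1.seq fun s' h => h ▸ hq).mono hU fun _ h => h

theorem Env.Ok.storeSeq (H : E.Ok e R) {a b U V : ℕ} {f g : Expr} {q : Program}
    {post : State → Prop} (hf : f.eval E.w s = a) (hg : g.eval E.w s = b)
    (hq : E.wp q (s.setMem a b) V post)
    (hU : f.cost + g.cost + 1 + V ≤ U) : E.wp (.seq (.store f g) q) s U post := by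
  have h1 : E.wp (.store f g) s (f.cost + g.cost + 1)
      (fun s' => s' = s.setMem a b) := H.store le_rfl (by rw [hf, hg])
  exact (h1.seq fun s' h => h ▸ hq).mono hU fun _ h => h

/-- Replace one block by its variable. -/
def streamStep : Program :=
  let i : Expr := .reg 20
  .seq (.cond (.conj (Expr.flag (.bin .plus i (.lit 2))).neg (Expr.flag (.bin .plus i (.lit 3))))
      (.seq (.reverse 34 (.load i.succ) (.load (.bin .plus i (.lit 2))))
        (.seq (.reverse 34 (.load i) (.reg 34))
          (.seq (.store (.reg 21) (.reg 34)) (.assign 20 (.bin .plus i (.lit 3))))))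
      (.seq (.reverse 34 (.load i) (.load i.succ))
        (.seq (.store (.reg 21) (.reg 34)) (.assign 20 (.bin .plus i (.lit 2))))))
    (.assign 21 (Expr.succ (.reg 21)))

/-- Replace the blocks between the first and the last sure position by their variables. -/
def streamPass : Program :=
  .seq (.assign 20 (.reg 15)) (.seq (.assign 21 (.lit 0))
    (.seq (.loop (.bin .less (.reg 20) (.reg 16)) streamStep) (.assign 5 (.reg 21))))

/-- The state of the replacement after the output `out`; the next position is `i`. -/
structure Streaming (E : Env) (k M m r : ℕ) (s₀ : State) (i : ℕ) (out : List ℕ) (s : State) :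
    Prop where
  layout : Layout E k M m s
  r6 : s.reg 6 = s₀.reg 6
  r7 : s.reg 7 = s₀.reg 7
  r16 : s.reg 16 = r
  r20 : s.reg 20 = i
  r21 : s.reg 21 = out.length
  le : 2 * out.length ≤ i
  holds : s.Holds 0 out
  mem : ∀ a, i ≤ a → s.mem a = s₀.mem a

/-- Writing in place is safe: every emitted symbol has consumed at least two, so the write position
never overtakes the unread part. -/
theorem Streaming.emit {r i n v x : ℕ} {out : List ℕ} {s₀ : State}
    (h : Streaming E k M m r s₀ i out s) (hn : 2 ≤ n) :
    Streaming E k M m r s₀ (i + n) (out ++ [v])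
      ((((s.setReg 34 x).setMem out.length v).setReg 20 (i + n)).setReg 21 (out.length + 1)) := by
  have hle := h.le
  refine ⟨?_, h.r6, h.r7, h.r16, by simp [State.setReg_reg], by simp [State.setReg_reg],
    by simp; omega, ?_, ?_⟩
  · have h1 := h.layout.setReg (x := 34) (v := x) (by omega)
    have h2 : Layout E k M m ((s.setReg 34 x).setMem out.length v) :=
      h1.frame fun r hr => by rw [State.setMem_reg]
    exact (h2.setReg (by omega)).setReg (by omega)
  · intro a ha
    rw [List.length_append, List.length_singleton] at ha
    simp only [State.setReg_mem, State.setMem_mem, Nat.zero_add]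
    rcases Nat.lt_or_ge a out.length with h1 | h1
    · rw [if_neg (by omega), List.getD_append _ _ _ _ h1]
      have := h.holds a h1
      rwa [Nat.zero_add] at this
    · obtain rfl : a = out.length := by omega
      rw [if_pos rfl, List.getD_append_right _ _ _ _ le_rfl]
      simp
  · intro a ha
    simp only [State.setReg_mem, State.setMem_mem]
    rw [if_neg (by omega), h.mem a (by omega)]

/-- A block costs at most two queries, for the two rules of a triple, and at least one position is
charged for it. Both rules pass through `rev` even if a query fails, so the output is always
`parseBlocks`. -/
theorem Env.Ok.wp_streamPass (H : E.Ok e R) (hF : E.Fits k M e) {p : List ℕ}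
    (hL : Layout E k M p.length s) (hm : p.length + 8 ≤ M) {X : ℕ → ℕ}
    (hfl : s.Flags M p.length (Sure k X p.length)) {l r : ℕ} (h15 : s.reg 15 = l)
    (h16 : s.reg 16 = r) (hlr : l ≤ r) (hlm : l ≤ p.length) (hrm : l < r → r + 2 < p.length)
    (hp : s.Holds 0 p) :
    E.wp streamPass s (p.length * (2 * R + 60) + 12) (fun s' =>
      let out := parseBlocks E.G.rev (Sure k X p.length) p l r
      Layout E k M out.length s' ∧ s'.reg 6 = s.reg 6 ∧ s'.reg 7 = s.reg 7 ∧ s'.Holds 0 out ∧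
        ∀ a, M ≤ a → s'.mem a = s.mem a) := by
  have hW := hF.word
  have w1 : 1 < 2 ^ E.w := by omega
  set m := p.length with hmdef
  have hFm : ∀ q, Sure k X m q → q < m := fun q h => by have := h.bounds; omega
  refine H.assignSeq (Expr.eval_reg_of h15) (V := m * (2 * R + 60) + 10) ?_
    (by simp only [Expr.cost]; omega)
  refine H.assignSeq (Expr.eval_lit (by omega)) (V := m * (2 * R + 60) + 8) ?_
    (by simp only [Expr.cost]; omega)
  have hstart : Streaming E k M m r s l [] ((s.setReg 20 l).setReg 21 0) :=
    ⟨(hL.setReg (by omega)).setReg (by omega), rfl, rfl, h16, by simp [State.setReg_reg],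
      by simp [State.setReg_reg], by simp, fun i hi => absurd hi (by simp), fun _ _ => rfl⟩
  have key := H.loop (post := fun s' => ∃ i, Streaming E k M m r s i
      (parseBlocks E.G.rev (Sure k X m) p l r) s' ∧ i ≤ M)
    (f := .bin .less (.reg 20) (.reg 16)) (p := streamStep)
    (fun t => t * (2 * R + 60) + 4) (fun t s' => ∃ i out, t = r - i ∧ i ≤ M ∧
      Streaming E k M m r s i out s' ∧ out ++ parseBlocks E.G.rev (Sure k X m) p i r =
        parseBlocks E.G.rev (Sure k X m) p l r) ?_ (r - l) ((s.setReg 20 l).setReg 21 0)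
    ⟨l, [], rfl, by omega, hstart, rfl⟩
  · refine (key.seq (V := 2) fun s' ⟨i, h, hi⟩ => ?_).mono ?_ fun _ h => h
    · have hle := h.le
      refine H.assign (by decide) ?_
      rw [Expr.eval_reg_of h.r21]
      refine ⟨h.layout.setLength _, h.r6, h.r7, h.holds, fun a ha => h.mem a (by omega)⟩
    · have : r - l ≤ m := by
        rcases Nat.lt_or_ge l r with h | h
        · have := hrm h; omega
        · omega
      have := Nat.mul_le_mul_right (2 * R + 60) this
      omega
  · rintro t s1 ⟨i, out, rfl, hi, h, hout⟩
    have htest := Expr.tests_less w1 (Expr.eval_reg_of h.r20) (Expr.eval_reg_of h.r16)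
    rcases Nat.lt_or_ge i r with hir | hir
    swap
    · left
      refine ⟨htest.eq_zero_iff.2 (by omega), by simp only [Expr.cost]; omega, i, ?_, hi⟩
      rw [parseBlocks, if_neg (by omega), List.append_nil] at hout
      rwa [← hout]
    right
    rw [parseBlocks, if_pos hir] at hout
    have hle := h.le
    -- The loop body is reached only if `l < r`: otherwise `parseBlocks` from `l` would be empty,
    -- while `hout` exhibits an element of it.
    have hlen : r + 2 < m := by
      by_contra hc
      have h2 := length_parseBlocks E.G.rev (Sure k X m) p l r
      rcases Nat.lt_or_ge l r with h1 | h1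
      · exact hc (hrm h1)
      · rw [← hout] at h2
        split_ifs at h2 <;> simp at h2 <;> omega
    have hfl1 : s1.Flags M m (Sure k X m) := by
      intro q hq
      rw [h.mem _ (by omega)]; exact hfl q hq
    have e2 := Expr.eval_plus (Expr.eval_reg_of h.r20) (Expr.eval_lit (w := E.w) (a := 2) (by omega))
      (by omega)
    have e3 := Expr.eval_plus (Expr.eval_reg_of h.r20) (Expr.eval_lit (w := E.w) (a := 3) (by omega))
      (by omega)
    have ht := ((hfl1.tests hFm hF h.layout e2 (by omega)).neg w1).and w1
      (hfl1.tests hFm hF h.layout e3 (by omega))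
    have hr : ∀ j < m, i ≤ j → s1.mem j = p.getD j 0 := by
      intro j hj hij
      rw [h.mem j hij]
      have := hp j hj
      rwa [Nat.zero_add] at this
    have ev0 : (Expr.load (.reg 20)).eval E.w s1 = p.getD i 0 := by
      rw [Expr.eval_load (Expr.eval_reg_of h.r20), hr i (by omega) le_rfl]
    have ev1 : (Expr.load (Expr.succ (.reg 20))).eval E.w s1 = p.getD (i + 1) 0 := by
      rw [Expr.eval_load (Expr.eval_succ (Expr.eval_reg_of h.r20) (by omega)),
        hr (i + 1) (by omega) (by omega)]
    have ev2 : (Expr.load (.bin .plus (.reg 20) (.lit 2))).eval E.w s1 = p.getD (i + 2) 0 := by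
      rw [Expr.eval_load e2, hr (i + 2) (by omega) (by omega)]
    refine ⟨htest.ne_zero_iff.2 hir, ?_⟩
    by_cases hc : ¬ Sure k X m (i + 2) ∧ Sure k X m (i + 3)
    · rw [if_pos hc] at hout
      refine ⟨r - (i + 3), by omega, 2 * R + 52, ?_, ?_⟩
      swap
      · simp only [Expr.cost]
        have := Nat.mul_le_mul_right (2 * R + 60) (show r - (i + 3) + 1 ≤ r - i by omega)
        rw [Nat.add_mul] at this
        omega
      set v1 := E.G.rev (p.getD (i + 1) 0) (p.getD (i + 2) 0) with hv1
      set v := E.G.rev (p.getD i 0) v1 with hv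
      have body : E.wp (.seq (.reverse 34 (.load (Expr.succ (.reg 20))) (.load (.bin .plus (.reg 20) (.lit 2))))
          (.seq (.reverse 34 (.load (.reg 20)) (.reg 34))
            (.seq (.store (.reg 21) (.reg 34)) (.assign 20 (.bin .plus (.reg 20) (.lit 3))))))
          s1 (2 * R + 20) (fun s' => s' = ((s1.setReg 34 v).setMem out.length v).setReg 20 (i + 3)) := by
        refine H.reverseSeq ev1 ev2 (V := R + 11) ?_ (by simp only [Expr.cost, Expr.succ]; omega)
        refine H.reverseSeq (a := p.getD i 0) (b := v1) (V := 7) ?_ ?_ ?_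
          (by simp only [Expr.cost]; omega)
        · exact ev0
        · exact Expr.eval_reg_of (by rw [State.setReg_reg, if_pos rfl])
        rw [State.setReg_setReg, ← hv]
        refine H.storeSeq (a := out.length) (b := v) (V := 4) (Expr.eval_reg_of h.r21)
          (Expr.eval_reg_of (by rw [State.setReg_reg, if_pos rfl])) ?_ (by decide)
        refine H.assign (by decide) ?_
        rw [Expr.eval_plus (w := E.w) (s := (s1.setReg 34 v).setMem out.length v) (a := i) (b := 3)
          (Expr.eval_reg_of (x := 20) h.r20) (Expr.eval_lit (by omega))
          (by omega)]
      refine ((H.condTrue (V := 2 * R + 48) (ht.ne_zero_iff.2 hc) body (by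
        simp only [Expr.cost, Expr.neg, Expr.flag, Expr.entry, Expr.conj]; omega)).seq
        (V := 4) fun s' h' => ?_).mono (by omega) fun _ h => h
      subst h'
      refine H.assign (by decide) ?_
      rw [Expr.eval_succ (w := E.w) (s := ((s1.setReg 34 v).setMem out.length v).setReg 20 (i + 3))
        (i := out.length) (Expr.eval_reg_of (x := 21) h.r21) (by omega)]
      exact ⟨i + 3, out ++ [v], rfl, by omega, h.emit (by omega), by
        rw [← hout, List.append_assoc]; rfl⟩
    · rw [if_neg hc] at hout
      refine ⟨r - (i + 2), by omega, 2 * R + 52, ?_, ?_⟩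
      swap
      · simp only [Expr.cost]
        have := Nat.mul_le_mul_right (2 * R + 60) (show r - (i + 2) + 1 ≤ r - i by omega)
        rw [Nat.add_mul] at this
        omega
      set v := E.G.rev (p.getD i 0) (p.getD (i + 1) 0) with hv
      have body : E.wp (.seq (.reverse 34 (.load (.reg 20)) (.load (Expr.succ (.reg 20))))
            (.seq (.store (.reg 21) (.reg 34)) (.assign 20 (.bin .plus (.reg 20) (.lit 2)))))
          s1 (2 * R + 20) (fun s' => s' = ((s1.setReg 34 v).setMem out.length v).setReg 20 (i + 2)) := by
        refine H.reverseSeq ev0 ev1 (V := 7) ?_ (by simp only [Expr.cost, Expr.succ]; omega)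
        refine H.storeSeq (a := out.length) (b := v) (V := 4) (Expr.eval_reg_of h.r21)
          (Expr.eval_reg_of (by rw [State.setReg_reg, if_pos rfl])) ?_ (by decide)
        refine H.assign (by decide) ?_
        rw [Expr.eval_plus (w := E.w) (s := (s1.setReg 34 v).setMem out.length v) (a := i) (b := 2)
          (Expr.eval_reg_of (x := 20) h.r20) (Expr.eval_lit (by omega))
          (by omega)]
      refine ((H.condFalse (V := 2 * R + 48) (ht.eq_zero_iff.2 hc) body (by
        simp only [Expr.cost, Expr.neg, Expr.flag, Expr.entry, Expr.conj]; omega)).seq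
        (V := 4) fun s' h' => ?_).mono (by omega) fun _ h => h
      subst h'
      refine H.assign (by decide) ?_
      rw [Expr.eval_succ (w := E.w) (s := ((s1.setReg 34 v).setMem out.length v).setReg 20 (i + 2))
        (i := out.length) (Expr.eval_reg_of (x := 21) h.r21) (by omega)]
      exact ⟨i + 2, out ++ [v], rfl, by omega, h.emit (by omega), by
        rw [← hout, List.append_assoc]; rfl⟩

/-! ## The levels -/

def levelPass : Program := .seq markPass (.seq findPass (.seq movePass streamPass))

/-- The state in front of a level: the current string and the two buffers. -/
structure AtLevel (E : Env) (k M : ℕ) (p left right : List ℕ) (s : State) : Prop where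
  layout : Layout E k M p.length s
  r6 : s.reg 6 = 8 * M + left.length
  r7 : s.reg 7 = 7 * M + right.length
  holds : s.Holds 0 p
  holdsLeft : s.Holds (8 * M) left
  holdsRight : s.Holds (7 * M) right.reverse
  length_le : left.length + p.length + right.length + 8 ≤ M

theorem Env.Ok.wp_levelPass (H : E.Ok e R) (hE : IsNaming E.G E.name) (hF : E.Fits k M e)
    (hk : 1 ≤ k) {p left right : List ℕ} (hp : p ≠ []) (h : AtLevel E k M p left right s) :
    E.wp levelPass s (p.length * (2000 * (k * e) + 2 * R)) (fun s' =>
      AtLevel E k M (core k E.nm E.G.rev p)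
        (left ++ p.take (firstSure k (nameAt E.nm p) p.length))
        (p.drop (lastSure k (nameAt E.nm p) p.length) ++ right) s') := by
  have hlen := h.length_le
  set m := p.length with hmdef
  set X := nameAt E.nm p with hX
  have hm1 : 1 ≤ m := List.length_pos_iff.2 hp
  refine ((H.wp_markPass hE hF h.layout (by omega) (X := X) fun j hj => ?_).seq
    (V := m * (2 * R + 150) + 102) fun s1 ⟨f1, u1, v1⟩ => ?_).mono ?_ fun _ h => h
  · have := h.holds j hj
    rw [Nat.zero_add] at this
    rw [this, hX, nameAt, List.getD_eq_getElem _ _ hj, List.getD_eq_getElem _ _ (by simpa using hj),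
      List.getElem_map]
  rotate_left
  -- As `k`, `e` and `m` are at least `1`, all terms of lower order are absorbed by `2000 m k e`.
  · have he := hF.one_le
    have h1 : k * (m * (24 * e + 65) + 20) = 24 * (m * (k * e)) + 65 * (m * k) + 20 * k := by ring
    have h2 : k ≤ k * e := Nat.le_mul_of_pos_right k he
    have h3 : m * k ≤ m * (k * e) := Nat.mul_le_mul_left m h2
    have h4 : k ≤ m * k := Nat.le_mul_of_pos_left k hm1
    have h5 : m ≤ m * k := Nat.le_mul_of_pos_right m hk
    have h6 : m * (2000 * (k * e) + 2 * R) = 2000 * (m * (k * e)) + m * (2 * R) := by ring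
    have h7 : m * (2 * R + 150) = m * (2 * R) + 150 * m := by ring
    rw [h1, h6, h7]
    omega
  have hL1 := h.layout.frame f1
  refine ((H.wp_findPass hF hL1 (by omega) (X := X) v1).seq
    (V := m * (2 * R + 100) + 52) fun s2 h2 => ?_).mono (by rw [Nat.mul_add m, Nat.mul_add m]; omega)
    fun _ h => h
  have hfl := firstSure_le (k := k) (X := X) (m := m)
  have hlr := firstSure_le_lastSure (k := k) (X := X) (m := m)
  have hlm := lastSure_le (k := k) (X := X) (m := m)
  have hL2 : Layout E k M m s2 := by
    rw [h2]; exact (hL1.setReg (by omega)).setReg (by omega)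
  have m2 : s2.mem = s1.mem := by rw [h2]; rfl
  refine ((H.wp_movePass hF hL2 (left := left) (right := right) hfl (j := lastSure k X m)
    (by rw [h2]; simp [State.setReg_reg, hmdef]) (by rw [h2]; simp [State.setReg_reg, hmdef])
    (by rw [h2]; exact (f1 6 (by omega)).trans h.r6) (by rw [h2]; exact (f1 7 (by omega)).trans h.r7)
    (h.holds.congr fun i _ hi => ?_) (h.holdsLeft.congr fun i hi _ => ?_)
    (h.holdsRight.congr fun i hi _ => ?_) (by omega)).seq
    (V := m * (2 * R + 60) + 12) fun s3 ⟨hL3, a1, a2, a3, a4, a5, a6, a7⟩ => ?_).mono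
    (by rw [Nat.mul_add m, Nat.mul_add m]; omega) fun _ h => h
  · rw [m2, u1 i (by omega)]
  · rw [m2, u1 i (by omega)]
  · rw [m2, u1 i (by omega)]
  refine (H.wp_streamPass hF hL3 (by omega) (X := X) (fun q hq => ?_) a1 a2 hlr (by omega)
    (fun hlt => ?_) (h.holds.congr fun i _ hi => ?_)).mono le_rfl
    fun s4 ⟨b1, b2, b3, b4, b5⟩ => ?_
  · rw [a5 _ (by omega), m2]; exact v1 q hq
  · exact (sure_lastSure (k := k) (X := X) (m := m) (by omega)).bounds.2
  · rw [a5 i (by omega), m2, u1 i (by omega)]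
  · have hcore : core k E.nm E.G.rev p = parseBlocks E.G.rev (Sure k X m) p (firstSure k X m)
      (lastSure k X m) := rfl
    have hpl := length_parseBlocks E.G.rev (Sure k X m) p (firstSure k X m) (lastSure k X m)
    rw [hcore]
    refine ⟨b1, b2.trans a3, b3.trans a4, b4, a6.congr fun i hi _ => b5 i (by omega),
      a7.congr fun i hi _ => b5 i (by omega), ?_⟩
    simp only [List.length_append, List.length_take, List.length_drop, ← hmdef]
    omega

/-! ## The whole program -/

/-- Compute the constants and the memory layout. -/
def initPass (q : Program) : Program :=
  .seq (.assign 9 (.bin .plus (.reg 0) (.lit 8))) (.seq (.assign 10 (.bin .plus (.reg 9) (.reg 9)))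
  (.seq (.assign 11 (.bin .plus (.reg 10) (.reg 9))) (.seq (.assign 12 (.bin .plus (.reg 11) (.reg 9)))
  (.seq (.assign 13 (.bin .plus (.reg 12) (.reg 9))) (.seq (.assign 14 (.bin .plus (.reg 13) (.reg 9)))
  (.seq (.assign 23 (.bin .plus (.reg 14) (.reg 9))) (.seq (.assign 24 (.bin .plus (.reg 23) (.reg 9)))
  (.seq (.assign 8 (.bin .plus (.reg 3) (.reg 2))) (.seq (.assign 5 (.reg 0))
  (.seq (.assign 6 (.reg 24)) (.seq (.assign 7 (.reg 23)) q)))))))))))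

theorem Env.Ok.wp_initPass (H : E.Ok e R) (hF : E.Fits k M e) {P : List ℕ} {l : ℕ}
    (hM : M = P.length + 8) {q : Program} {V : ℕ} {post : State → Prop}
    (hq : ∀ s, AtLevel E k M P [] [] s → E.wp q s V post) :
    E.wp (initPass q) (inputState E.G l k P) (V + 50) post := by
  have hW := hF.word
  have hN : E.G.n + E.G.sigma = E.G.numSymbols := rfl
  have i0 : (inputState E.G l k P).reg 0 = P.length := rfl
  have i2 : (inputState E.G l k P).reg 2 = E.G.sigma := rfl
  have i3 : (inputState E.G l k P).reg 3 = E.G.n := rfl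
  have i4 : (inputState E.G l k P).reg 4 = k := rfl
  refine H.assignSeq (v := M) (V := V + 46) ?_ ?_ (by simp only [Expr.cost]; omega)
  · rw [Expr.eval_plus (Expr.eval_reg_of i0) (Expr.eval_lit (by omega)) (by omega), hM]
  have plusReg : ∀ {s : State} {x y a b c : ℕ}, s.reg x = a → s.reg y = b → c = a + b →
      a + b < 2 ^ E.w → (Expr.bin .plus (.reg x) (.reg y)).eval E.w s = c := by
    intro s x y a b c h1 h2 h3 h4
    rw [Expr.eval_plus (Expr.eval_reg_of h1) (Expr.eval_reg_of h2) h4, h3]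
  refine H.assignSeq (v := 2 * M) (V := V + 42) (plusReg (a := M) (b := M) ?_ ?_ (by omega) (by omega))
    ?_ (by simp only [Expr.cost]; omega)
  iterate 2 simp [State.setReg_reg]
  refine H.assignSeq (v := 3 * M) (V := V + 38)
    (plusReg (a := 2 * M) (b := M) ?_ ?_ (by omega) (by omega)) ?_ (by simp only [Expr.cost]; omega)
  iterate 2 simp [State.setReg_reg]
  refine H.assignSeq (v := 4 * M) (V := V + 34)
    (plusReg (a := 3 * M) (b := M) ?_ ?_ (by omega) (by omega)) ?_ (by simp only [Expr.cost]; omega)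
  iterate 2 simp [State.setReg_reg]
  refine H.assignSeq (v := 5 * M) (V := V + 30)
    (plusReg (a := 4 * M) (b := M) ?_ ?_ (by omega) (by omega)) ?_ (by simp only [Expr.cost]; omega)
  iterate 2 simp [State.setReg_reg]
  refine H.assignSeq (v := 6 * M) (V := V + 26)
    (plusReg (a := 5 * M) (b := M) ?_ ?_ (by omega) (by omega)) ?_ (by simp only [Expr.cost]; omega)
  iterate 2 simp [State.setReg_reg]
  refine H.assignSeq (v := 7 * M) (V := V + 22)
    (plusReg (a := 6 * M) (b := M) ?_ ?_ (by omega) (by omega)) ?_ (by simp only [Expr.cost]; omega)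
  iterate 2 simp [State.setReg_reg]
  refine H.assignSeq (v := 8 * M) (V := V + 18)
    (plusReg (a := 7 * M) (b := M) ?_ ?_ (by omega) (by omega)) ?_ (by simp only [Expr.cost]; omega)
  iterate 2 simp [State.setReg_reg]
  refine H.assignSeq (v := E.G.numSymbols) (V := V + 14)
    (plusReg (a := E.G.n) (b := E.G.sigma) ?_ ?_ (by omega) (by omega)) ?_
    (by simp only [Expr.cost]; omega)
  iterate 2 simp [State.setReg_reg, i2, i3]
  refine H.assignSeq (v := P.length) (V := V + 12) (Expr.eval_reg_of ?_) ?_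
    (by simp only [Expr.cost]; omega)
  · simp [State.setReg_reg, i0]
  refine H.assignSeq (v := 8 * M) (V := V + 10) (Expr.eval_reg_of ?_) ?_
    (by simp only [Expr.cost]; omega)
  · simp [State.setReg_reg]
  refine H.assignSeq (v := 7 * M) (V := V) (Expr.eval_reg_of ?_) ?_
    (by simp only [Expr.cost]; omega)
  · simp [State.setReg_reg]
  refine hq _ ⟨?_, ?_, ?_, ?_, ?_, ?_, ?_⟩
  · constructor <;> simp [State.setReg_reg, i4]
  · simp [State.setReg_reg]
  · simp [State.setReg_reg]
  · intro a _
    simp only [State.setReg_mem, Nat.zero_add]; rfl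
  · intro a ha; exact absurd ha (by simp)
  · intro a ha; exact absurd ha (by simp)
  · simp; omega

/-- Append the right buffer to the left buffer. -/
def outputPass : Program :=
  .seq (.assign 17 (.bin .minus (.reg 7) (.reg 23)))
    (.seq (fill 17 6 (.assign 33 (.load (.bin .minus (Expr.pred (.reg 7)) (.reg 32)))))
    (.seq (.assign 1 (.bin .minus (.bin .plus (.reg 6) (.reg 17)) (.reg 24)))
      (.assign 0 (.reg 24))))

theorem State.Holds.output_eq {l : List ℕ} {a : ℕ} (h : s.Holds a l) (h0 : s.reg 0 = a)
    (h1 : s.reg 1 = l.length) : output s = l := by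
  rw [output, h0, h1]
  refine List.ext_getElem (by simp) fun i h2 h3 => ?_
  rw [List.getElem_map, List.getElem_range, h i h3, List.getD_eq_getElem _ _ h3]

/-- Reading the right buffer from its end undoes the reversal while it is appended to the left one.
-/
theorem Env.Ok.wp_outputPass (H : E.Ok e R) (hF : E.Fits k M e) {left right : List ℕ}
    (h : AtLevel E k M [] left right s) :
    E.wp outputPass s (right.length * 20 + 20) (fun s' => output s' = left ++ right) := by
  have hW := hF.word
  have hlen := h.length_le
  refine H.assignSeq (v := right.length) (V := right.length * 20 + 16) ?_ ?_
    (by simp only [Expr.cost]; omega)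
  · rw [Expr.eval_minus (Expr.eval_reg_of h.r7) (Expr.eval_reg_of h.layout.r23) (by omega)]
    omega
  set s1 := s.setReg 17 right.length with hs1
  have hL1 : Layout E k M 0 s1 := h.layout.setReg (by omega)
  have m1 : s1.mem = s.mem := rfl
  have e7 : s1.reg 7 = 7 * M + right.length := h.r7
  have e6 : s1.reg 6 = 8 * M + left.length := h.r6
  have e17 : s1.reg 17 = right.length := by simp [hs1, State.setReg_reg]
  have hfill := H.wp_fillExpr (cnt := 17) (base := 6)
    (g := .load (.bin .minus (Expr.pred (.reg 7)) (.reg 32))) (s := s1) (by omega) (by omega)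
    e17 e6 (by omega) (fun j => right.getD j 0) (fun j s' hj g1 g2 g3 g4 => by
      rw [Expr.eval_load (Expr.eval_minus (Expr.eval_pred (Expr.eval_reg_of
        ((g1 7 (by omega)).trans e7)) (by omega)) (Expr.eval_reg_of g2) (by omega)),
        g3 _ (by omega), m1]
      have := h.holdsRight (right.length - 1 - j) (by simp; omega)
      rw [show 7 * M + right.length - 1 - j = 7 * M + (right.length - 1 - j) by omega, this,
        List.getD_eq_getElem _ _ (by simp; omega), List.getD_eq_getElem _ _ hj,
        List.getElem_reverse]
      congr 1
      omega)
  refine (hfill.seq (V := 10) fun s2 ⟨f2, u2, v2⟩ => ?_).mono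
    (by simp only [Expr.cost, Expr.pred]; omega) fun _ h => h
  have hL2 := hL1.frame (f2.mono (by omega))
  refine H.assignSeq (v := left.length + right.length) (V := 2) ?_ ?_
    (by simp only [Expr.cost]; omega)
  · rw [Expr.eval_minus (Expr.eval_plus (Expr.eval_reg_of ((f2 6 (by omega)).trans e6))
      (Expr.eval_reg_of ((f2 17 (by omega)).trans e17)) (by omega)) (Expr.eval_reg_of hL2.r24)
      (by omega)]
    omega
  refine H.assign (by decide) ?_
  rw [Expr.eval_reg_of (a := 8 * M) (by rw [State.setReg_reg, if_neg (by omega)]; exact hL2.r24)]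
  refine State.Holds.output_eq (a := 8 * M) ?_ (by simp [State.setReg_reg])
    (by simp [State.setReg_reg])
  have hright : right = (List.range right.length).map (fun j => right.getD j 0) := by
    rw [← take_eq_map_range right le_rfl, List.take_length]
  rw [hright]
  refine State.Holds.append (fun i hi => ?_) fun i hi => ?_
  · rw [State.setReg_mem, State.setReg_mem, u2 _ (by omega), m1, h.holdsLeft i hi]
  · rw [State.setReg_mem, State.setReg_mem, v2 i hi]

/-- The program that computes the evidence of a pattern. -/
def evidenceProgram : Program := initPass (.seq (.loop (.reg 5) levelPass) outputPass)

/-- The invariant is that left buffer, evidence of the current string and right buffer together form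
the evidence of `P`. The string halves at every level, so twice the cost of a level covers that
level and all later ones; the loop is bounded by the length of the string as the decreasing number.
-/
theorem Env.Ok.wp_evidenceProgram (H : E.Ok e R) (hE : IsNaming E.G E.name)
    (hF : E.Fits k M e) (hk : 1 ≤ k) {P : List ℕ} (hP : P ≠ []) {l : ℕ} (hM : M = P.length + 8) :
    E.wp evidenceProgram (inputState E.G l k P) (P.length * (4200 * (k * e) + 4 * R))
      (fun s' => output s' = evidence k E.nm E.G.rev P) := by
  have hP1 : 1 ≤ P.length := List.length_pos_iff.2 hP
  have hke : 1 ≤ k * e := Nat.mul_pos hk hF.one_le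
  refine (H.wp_initPass hF (V := P.length * (4040 * (k * e) + 4 * R) + 30) hM fun s h => ?_).mono ?_
    fun _ h => h
  swap
  · have h1 := Nat.mul_le_mul hP1 hke
    have h2 : P.length * (4200 * (k * e) + 4 * R) = P.length * (4040 * (k * e) + 4 * R) +
      160 * (P.length * (k * e)) := by ring
    omega
  have key := H.loop (post := fun s' => ∃ left right, AtLevel E k M [] left right s' ∧
      left ++ right = evidence k E.nm E.G.rev P)
    (f := .reg 5) (p := levelPass)
    (fun i => i * (2 * (2000 * (k * e) + 2 * R + 2)) + 2) (fun i s' => ∃ p left right,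
      i = p.length ∧ AtLevel E k M p left right s' ∧
      left ++ evidence k E.nm E.G.rev p ++ right = evidence k E.nm E.G.rev P) ?_ P.length s
      ⟨P, [], [], rfl, h, by simp⟩
  · refine (key.seq (V := P.length * 20 + 20) fun s' ⟨left, right, h1, h2⟩ => ?_).mono ?_ fun _ h => h
    · have h3 := h1.length_le
      rw [← h2]
      refine (H.wp_outputPass hF h1).mono ?_ fun _ h => h
      simp at h3
      omega
    · have h1 : P.length * (4040 * (k * e) + 4 * R) = P.length * (4000 * (k * e) + 4 * R) +
        40 * (P.length * (k * e)) := by ring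
      have h2 : P.length * (2 * (2000 * (k * e) + 2 * R + 2)) =
        P.length * (4000 * (k * e) + 4 * R) + 4 * P.length := by ring
      have h3 : P.length ≤ P.length * (k * e) := Nat.le_mul_of_pos_right _ hke
      rw [h1, h2]
      omega
  · rintro i s1 ⟨p, left, right, rfl, h1, h2⟩
    rcases eq_or_ne p [] with rfl | hp
    · left
      refine ⟨h1.layout.r5, by simp only [Expr.cost]; omega, left, right, h1, ?_⟩
      rw [← h2, evidence]
      simp
    · right
      have hpos := List.length_pos_iff.2 hp
      have hcore := two_mul_length_core_le k E.nm E.G.rev p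
      refine ⟨by rw [Expr.eval_reg, h1.layout.r5]; omega, (core k E.nm E.G.rev p).length, by omega,
        _, (H.wp_levelPass hE hF hk hp h1).mono le_rfl fun s' h' =>
          ⟨_, _, _, rfl, h', ?_⟩, ?_⟩
      · rw [← h2]
        conv_rhs => rw [evidence, if_neg hp]
        simp only [List.append_assoc]
      · simp only [Expr.cost]
        set W := 2000 * (k * e) + 2 * R with hWd
        have h3 := Nat.mul_le_mul_right (W + 2) hcore
        have h4 : (core k E.nm E.G.rev p).length * (2 * (W + 2)) =
          2 * (core k E.nm E.G.rev p).length * (W + 2) := by ring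
        have h5 : p.length * (2 * (W + 2)) = p.length * (W + 2) + p.length * W + 2 * p.length := by
          ring
        rw [h4, h5]
        omega

end Stream

/-! ## Evidences of the occurrences of a pattern -/

section Occurrence

variable {G : Slp} {name nm : ℕ → ℕ} {S : List ℕ} {T : PTree}

theorem flatMap_yield_map_leaf (l : List ℕ) : (l.map PTree.leaf).flatMap PTree.yield = l := by
  induction l with
  | nil => rfl
  | cons a l ih => rw [List.map_cons, List.flatMap_cons, ih]; rfl

theorem map_label_map_leaf (l : List ℕ) : (l.map PTree.leaf).map PTree.label = l := by
  simp [Function.comp_def, PTree.label]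

theorem IsEspGrammar.yield_eq (h : IsEspGrammar G name S T) : T.yield = S := by
  rw [h.2.2.yield_eq, flatMap_yield_map_leaf]

theorem IsEspGrammar.isEvidenceAt (h : IsEspGrammar G name S T)
    (hnm : ∀ X < G.numSymbols, nm X = name X) {P : List ℕ} (hP : P ≠ []) {i : ℕ}
    (hi : P <+: S.drop i) : IsEvidenceAt T P i (evidence (lgStar S.length) nm G.rev P) := by
  obtain ⟨t, ht⟩ := hi
  have hlt : i < S.length := by
    by_contra hc
    rw [List.drop_eq_nil_of_le (by omega)] at ht
    exact hP (List.append_eq_nil_iff.1 ht).1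
  obtain ⟨vs, h1, h2, h3⟩ := h.2.2.exists_evidence h.1.1 hnm h.1.2.1
    ((S.take i).map PTree.leaf) (P.map PTree.leaf) (t.map PTree.leaf) (by
      rw [← List.map_append, ← List.map_append, List.append_assoc, ht, List.take_append_drop])
  rw [flatMap_yield_map_leaf, List.length_take, Nat.min_eq_left hlt.le] at h3
  rw [map_label_map_leaf] at h1
  rw [flatMap_yield_map_leaf] at h2
  exact ⟨vs, h3, h2, h1⟩

theorem IsEspGrammar.n_pos (h : IsEspGrammar G name S T) (hS : 2 ≤ S.length) : 0 < G.n := by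
  have h1 := congrArg List.length h.1.2.2
  rw [List.length_range'] at h1
  rw [← h1]
  rw [← h.yield_eq] at hS
  cases T with
  | leaf a => simp [PTree.yield] at hS
  | node X l r => simp [PTree.partialTree, PTree.prune, PTree.internals]

/-- Every variable labels an inner node of the pruned tree, and a parse tree with `|S|` leaves has
`|S| - 1` inner nodes. This bounds names by `|S| + σ`. -/
theorem IsEspGrammar.n_lt (h : IsEspGrammar G name S T) : G.n < S.length := by
  have h1 := congrArg List.length h.1.2.2
  rw [List.length_range'] at h1
  have h2 := T.length_internals_prune []
  have h3 := T.length_yield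
  rw [h.yield_eq] at h3
  rw [PTree.partialTree] at h1
  omega

end Occurrence

/-! ## Names and bounds -/

theorem Env.nm_le {E : Env} (hE : IsNaming E.G E.name) (v : ℕ) : E.nm v ≤ E.G.numSymbols := by
  rw [Env.nm]
  split_ifs with h
  · exact (hE.2 v h).le
  · exact le_rfl

theorem Env.nm_injOn {E : Env} (hE : IsNaming E.G E.name) :
    Set.InjOn E.nm (Set.Iic E.G.numSymbols) := by
  intro a ha b hb hab
  rw [Set.mem_Iic] at ha hb
  rw [Env.nm, Env.nm] at hab
  split_ifs at hab with h1 h2 h2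
  · exact hE.1 h1 h2 hab
  · have := hE.2 a h1; omega
  · have := hE.2 b h2; omega
  · omega

theorem Env.numRuns_evidence_le {E : Env} (hE : IsNaming E.G E.name) {u : ℕ} (hu : 2 ≤ u)
    (hN : E.G.n ≤ u) {P : List ℕ} (hP : ∀ a ∈ P, a < E.G.sigma) (hP' : P ≠ []) :
    (numRuns (evidence (lgStar u) E.nm E.G.rev P) : ℝ) ≤
      (2 * (23 + 4 * (16 + E.G.sigma)) : ℕ) * ((1 + Real.logb 2 P.length) * lgStar u) := by
  have hnum : E.G.numSymbols = E.G.n + E.G.sigma := rfl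
  have h1 := OESP.numRuns_evidence_le (k := lgStar u) (K := 2 * (16 + E.G.sigma))
    (Env.nm_injOn hE) E.G.rev_le (by omega)
    (fun p _ => reduced_le_of_lgStar hu (σ := E.G.sigma) fun j => by
      rw [nameAt]
      rcases Nat.lt_or_ge j (p.map E.nm).length with h | h
      · rw [List.getD_eq_getElem _ _ h, List.getElem_map]
        have := E.nm_le hE (p[j]'(by simpa using h))
        omega
      · rw [List.getD_eq_default _ _ h]; omega) P
    (fun a ha => by have := hP a ha; omega)
  rw [if_neg hP'] at h1
  have hk := (lgStar_spec hu).1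
  -- Since `lgStar u ≥ 1`, the summands without this factor can be multiplied by it; this yields the
  -- constant `D` for σ.
  have h2 : (2 * (2 * lgStar u + 2 * (2 * (16 + E.G.sigma)) + 21)) ≤
      2 * (23 + 4 * (16 + E.G.sigma)) * lgStar u := by
    have := Nat.mul_le_mul_left (2 * (2 * (16 + E.G.sigma)) + 21) hk
    nlinarith
  have h3 : (numRuns (evidence (lgStar u) E.nm E.G.rev P) : ℝ) ≤
      ((Nat.log 2 P.length + 1) * (2 * (23 + 4 * (16 + E.G.sigma)) * lgStar u) : ℕ) := by
    exact_mod_cast h1.trans (Nat.mul_le_mul_left _ h2)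
  have h4 : (Nat.log 2 P.length : ℝ) ≤ Real.logb 2 P.length := Real.natLog_le_logb _ _
  refine h3.trans ?_
  have h5 : (((Nat.log 2 P.length + 1) * (2 * (23 + 4 * (16 + E.G.sigma)) * lgStar u) : ℕ) : ℝ) =
      (2 * (23 + 4 * (16 + E.G.sigma)) : ℕ) * ((1 + (Nat.log 2 P.length : ℝ)) * lgStar u) := by
    push_cast; ring
  rw [h5]
  gcongr

/-- From `n / m ≤ 1 / α` one gets `R ≤ (52 + 3) e / α`, and `4200 + 4 · 55 = 4420`. Replacing `e` by
`2 L` doubles this to `8840`. -/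
theorem cost_le {α L n m : ℝ} {e R k p : ℕ} (hα : 0 < α) (hα1 : α ≤ 1) (hk : 1 ≤ k) (he1 : 1 ≤ e)
    (he : (e : ℝ) ≤ 2 * L) (hm : 0 < m) (hn : α * n ≤ m)
    (hR : (R : ℝ) ≤ (1 + n / m) * (9 * e + 17) + 3) :
    ((p * (4200 * (k * e) + 4 * R) : ℕ) : ℝ) ≤ 8840 * ((1 / α) * p * L * k) := by
  have h1 : 1 ≤ 1 / α := by rw [le_div_iff₀ hα]; linarith
  have hnm : n / m ≤ 1 / α := by
    rw [div_le_div_iff₀ hm hα]; linarith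
  have hk' : (1 : ℝ) ≤ k := by exact_mod_cast hk
  have he1' : (1 : ℝ) ≤ e := by exact_mod_cast he1
  have h2 : (R : ℝ) ≤ 55 * ((1 / α) * e) := by
    have h3 : (1 + n / m) * (9 * e + 17) ≤ (2 * (1 / α)) * (26 * (e : ℝ)) :=
      mul_le_mul (by linarith) (by linarith) (by positivity) (by positivity)
    have h4 : 1 * 1 ≤ (1 / α) * (e : ℝ) := mul_le_mul h1 he1' (by norm_num) (by positivity)
    linarith
  have h5 : (1 / α) * (e : ℝ) ≤ (1 / α) * (k * e) := by
    refine mul_le_mul_of_nonneg_left ?_ (by positivity)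
    nlinarith
  have h6 : (k * e : ℝ) ≤ (1 / α) * (k * e) := by
    have : (0 : ℝ) ≤ k * e := by positivity
    nlinarith
  have h7 : (4200 * (k * e) + 4 * R : ℝ) ≤ 4420 * ((1 / α) * (k * e)) := by linarith
  have h8 : (1 / α) * (k * e : ℝ) ≤ (1 / α) * (k * (2 * L)) := by gcongr
  push_cast
  calc (p : ℝ) * (4200 * (k * e) + 4 * R) ≤ p * (4420 * ((1 / α) * (k * (2 * L)))) := by
        refine mul_le_mul_of_nonneg_left ?_ (by positivity)
        linarith
    _ = 8840 * ((1 / α) * p * L * k) := by ring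

end OESP

theorem mainTheorem4 :
    ∃ (prog : OESP.Program) (C : ℝ) (c : ℕ), ∀ σ : ℕ, ∃ D : ℝ,
      ∀ (S : List ℕ) (G : OESP.Slp) (name : ℕ → ℕ) (T : OESP.PTree)
        (α : ℝ) (P : List ℕ) (w : ℕ),
        G.sigma = σ → 2 ≤ S.length → OESP.IsEspGrammar G name S T →
        0 < α → α ≤ 1 →
        P ≠ [] → (∀ a ∈ P, a < σ) →
        c * (S.length + σ + P.length) ≤ 2 ^ w →
        ∃ (Q : List ℕ) (time : OESP.HashFun G (OESP.tableSize G α) → ℕ),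
          (∀ h : OESP.HashFun G (OESP.tableSize G α),
            OESP.Computes G name T (OESP.lgStar S.length) h w prog P Q (time h)) ∧
          OESP.expectedTime G (OESP.tableSize G α) time ≤
            C * ((1 / α) * P.length * Real.logb 2 (G.n + σ) * OESP.lgStar S.length) ∧
          (P <:+: S →
            OESP.IsEvidence T P Q ∧
            (∀ i, P <+: S.drop i → OESP.IsEvidenceAt T P i Q) ∧
            (OESP.numRuns Q : ℝ) ≤
              D * ((1 + Real.logb 2 P.length) * OESP.lgStar S.length)) := by
  -- The factor `8840` is that of `cost_le`, and `128` leaves room in a word for all addresses and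
  -- names, because `lgStar |S| ≤ |S|` and `n < |S|`. The last witness is the constant of
  -- `Env.numRuns_evidence_le`.
  refine ⟨OESP.evidenceProgram, 8840, 128, fun σ => ⟨(2 * (23 + 4 * (16 + σ)) : ℕ), ?_⟩⟩
  rintro S G name T α P w rfl hS hG hα hα1 hP hPσ hw
  have hn := hG.n_pos hS
  have hnS := hG.n_lt
  have hnum : G.numSymbols = G.n + G.sigma := rfl
  have hσ : 0 < G.sigma := by
    obtain ⟨a, ha⟩ := List.exists_mem_of_ne_nil P hP
    have := hPσ a ha
    omega
  have hP1 : 1 ≤ P.length := List.length_pos_iff.2 hP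
  obtain ⟨hk, -, hkS⟩ := OESP.lgStar_spec hS
  have hαn : 0 < α * G.n := mul_pos hα (by exact_mod_cast hn)
  have htable : 0 < OESP.tableSize G α := Nat.ceil_pos.2 hαn
  have hlt : G.numSymbols < 2 ^ (Nat.log 2 G.numSymbols + 1) :=
    Nat.lt_pow_succ_log_self (by norm_num) _
  have hle : 2 ^ Nat.log 2 G.numSymbols ≤ G.numSymbols := Nat.pow_log_le_self 2 (by omega)
  let E : OESP.Env := ⟨G, name, T, OESP.tableSize G α, w⟩
  have hOk : E.Ok (Nat.log 2 G.numSymbols + 1) ⌈(1 + (G.n : ℝ) / OESP.tableSize G α) *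
      (9 * (Nat.log 2 G.numSymbols + 1 : ℕ) + 17) + 2⌉₊ :=
    ⟨htable.ne', ⟨hG.1, hσ, hlt⟩, Nat.le_ceil _⟩
  have hFits : E.Fits (OESP.lgStar S.length) (P.length + 8) (Nat.log 2 G.numSymbols + 1) := by
    refine ⟨?_, hlt, by omega, ?_⟩
    · change 32 * (P.length + 8) + 4 * OESP.lgStar S.length + 4 * G.numSymbols + 64 ≤ 2 ^ w
      omega
    · rw [pow_succ, mul_comm]
      exact Nat.mul_le_mul_left 2 hle
  obtain ⟨s', ⟨time, h1, h2⟩, h3⟩ := hOk.wp_evidenceProgram (l := T.yield.length) hG.2.1 hFits hk hP rfl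
  refine ⟨OESP.evidence (OESP.lgStar S.length) E.nm G.rev P, time, fun h => ⟨s', h1 h, h3⟩,
    h2.trans ?_, fun hocc => ?_⟩
  -- As `n + σ ≥ 2`, the logarithm is at least `1`, and the `+ 1` in the number of bits at most
  -- doubles it.
  · have hlog : (1 : ℝ) ≤ Real.logb 2 (G.n + G.sigma) := by
      rw [Real.le_logb_iff_rpow_le (by norm_num) (by positivity), Real.rpow_one]
      exact_mod_cast (show 2 ≤ G.n + G.sigma by omega)
    have hnat : (Nat.log 2 G.numSymbols : ℝ) ≤ Real.logb 2 (G.n + G.sigma) := by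
      have := Real.natLog_le_logb G.numSymbols 2
      rwa [hnum, Nat.cast_add] at this
    refine OESP.cost_le (n := G.n) (m := OESP.tableSize G α) hα hα1 hk (by omega) ?_ (by exact_mod_cast htable) (Nat.le_ceil _)
      ((Nat.ceil_lt_add_one (by positivity)).le.trans (by linarith))
    push_cast
    linarith
  · have hev : ∀ i, P <+: S.drop i → OESP.IsEvidenceAt T P i
        (OESP.evidence (OESP.lgStar S.length) E.nm G.rev P) := fun i hi =>
      hG.isEvidenceAt (fun X hX => if_pos hX) hP hi
    refine ⟨?_, hev, OESP.Env.numRuns_evidence_le (E := E) hG.2.1 hS hnS.le hPσ hP⟩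
    obtain ⟨a, b, rfl⟩ := hocc
    exact ⟨a.length, hev _ ⟨b, by simp⟩⟩
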